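/- Let $M=(M_0,\mathcal O_M)$ be a real supermanifold of dimension $(p,q)$ (a sheaf of supercommutative real superalgebras on a Hausdorff, second countable space, locally isomorphic to $\mathbb R^{p|q}$). For a coordinate system $x=(u,\xi)$ on an open subspace $U$, write $\partial_x^j=\partial_{x_{p+q}}^{j_{p+q}}\circ\dots\circ\partial_{x_1}^{j_1}$ for $j\in\mathbb N^p\times\{0,1\}^q$. A differential operator on $M$ is a linear operator $A$ on $\mathcal O(M)$ which near each point of $M$ has, in some coordinate system $x$, the form of a finite sum $A=\sum_j a_j\,\partial_x^j$ with superfunctions $a_j$. A Berezin density $\omega$ is given on each coordinate neighbourhood by an expression $\omega|_U=|Dx|\,f$ with $f\in\mathcal O(U)$, where for coordinate systems $x=(u,\xi)$, $y=(v,\eta)$ $$|Dx|\,f=|Dy|\,\operatorname{sgn}\Bigl(\det\frac{\partial u}{\partial v}\Bigr)_{\!0}\,\operatorname{Ber}\Bigl(\frac{\partial x}{\partial y}\Bigr) f,\qquad \operatorname{Ber}\begin{pmatrix}R&S\\T&V\end{pmatrix}=\det(R-SV^{-1}T)\det V^{-1};$$ here the subscript $0$ denotes the underlying function on $M_0$.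 A Berezin form is defined in the same way, with $Dx$ in place of $|Dx|$ and without the sign factor. For an isomorphism $\varphi$ of supermanifolds, the pullback is $\varphi^*(|Dx|\,f)=|D\varphi^*(x)|\,\varphi^*(f)$, and analogously for forms. Differential operators act on Berezin densities and on Berezin forms from the right, compatibly with restrictions to open subspaces, by $\omega.f=\omega f$ for superfunctions $f$ and $\omega.X=-(-1)^{|X||\omega|}\mathcal L_X\omega$ for vector fields $X$. That is, if $\omega|_U=|Dx|\,f$ and $A|_U=\sum_j a_j\partial_x^j$, then $$(\omega.A)|_U=\sum_j\bigl(|Dx|\,fa_j\bigr).\partial_x^j ,\qquad (|Dx|\,g).\partial_{x_k}=-(-1)^{|g||x_k|}\,|Dx|\,\frac{\partial g}{\partial x_k},\qquad \omega.(A\circ B)=(\omega.A).B ,$$ and likewise for forms. **Proposition.** Let $\varphi\colon M\to M$ be an isomorphism of supermanifolds such that $\varphi^*\colon\mathcal O(M)\to\mathcal O(M)$ is a differential operator. Then for every Berezin density $\omega$ on $M$ there is exactly one Berezin density $\omega.\varphi^*$ on $M$ with the above local expressions, and $$\omega=\varphi^*(\omega.\varphi^*).$$ The same holds for every Berezin form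 $\omega$ on $M$ (in particular whenever $\varphi_0$ is orientation preserving). -/

import Mathlib

open CategoryTheory TopologicalSpace Opposite

universe u

noncomputable section

/-! ## Superspaces, morphisms and isomorphisms -/

/-- A (real) superspace: a topological space with a sheaf of supercommutative real superalgebras.
The `ℤ/2`-grading is encoded by the parity automorphism `σ` (`+1` on the even, `-1` on the odd
part): since `2` is invertible, gradings and involutive automorphisms are the same thing. -/
structure SuperSpace where
  /-- the underlying topological space `M₀` -/
  carrier : TopCat.{u}
  /-- the structure sheaf `𝒪_M` -/
  sheaf : TopCat.Sheaf (AlgCat.{u} ℝ) carrier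
  /-- the parity automorphism `f ↦ (-1)^{|f|} f` -/
  σ : ∀ W : Opens carrier, sheaf.presheaf.obj (op W) →ₐ[ℝ] sheaf.presheaf.obj (op W)
  σ_σ : ∀ W f, σ W (σ W f) = f
  σ_map : ∀ {U W : Opens carrier} (h : W ≤ U) (f : sheaf.presheaf.obj (op U)),
    σ W ((sheaf.presheaf.map (homOfLE h).op).hom f)
      = (sheaf.presheaf.map (homOfLE h).op).hom (σ U f)
  /-- even sections commute with everything -/
  even_comm : ∀ W f g, σ W f = f → f * g = g * f
  /-- odd sections anticommute -/
  odd_anticomm : ∀ W f g, σ W f = -f → σ W g = -g → f * g = -(g * f)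

namespace SuperSpace

/-- The superalgebra `𝒪(W)` of superfunctions on the open set `W`. -/
abbrev O (M : SuperSpace.{u}) (W : Opens M.carrier) : Type u := M.sheaf.presheaf.obj (op W)

/-- Restriction of superfunctions. -/
def res (M : SuperSpace.{u}) {U W : Opens M.carrier} (h : W ≤ U) : M.O U →ₐ[ℝ] M.O W :=
  (M.sheaf.presheaf.map (homOfLE h).op).hom

/-- A morphism of superspaces: a continuous map `φ₀` and a parity preserving morphism
`φ^* : 𝒪_N → φ₀_* 𝒪_M` of sheaves of real algebras. (On supermanifolds such a morphism is
automatically local on stalks, and `φ₀` is automatically smooth.) -/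
structure Hom (M N : SuperSpace.{u}) where
  base : C(M.carrier, N.carrier)
  pull : ∀ V : Opens N.carrier, N.O V →ₐ[ℝ] M.O (V.comap base)
  pull_res : ∀ {V V' : Opens N.carrier} (h : V' ≤ V) (f : N.O V),
    pull V' (N.res h f) = M.res (Opens.comap_mono base h) (pull V f)
  pull_σ : ∀ (V : Opens N.carrier) (f : N.O V), pull V (N.σ V f) = M.σ _ (pull V f)

/-- An isomorphism of superspaces: a pair of mutually inverse morphisms. -/
structure Iso (M N : SuperSpace.{u}) where
  hom : Hom M N
  inv : Hom N M
  inv_hom_base : ∀ m, inv.base (hom.base m) = m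
  hom_inv_base : ∀ n, hom.base (inv.base n) = n
  inv_hom_pull : ∀ (V : Opens N.carrier) (h : (V.comap hom.base).comap inv.base ≤ V)
    (f : N.O V), inv.pull (V.comap hom.base) (hom.pull V f) = N.res h f
  hom_inv_pull : ∀ (V : Opens M.carrier) (h : (V.comap inv.base).comap hom.base ≤ V)
    (f : M.O V), hom.pull (V.comap inv.base) (inv.pull V f) = M.res h f

/-- The underlying homeomorphism `φ₀`. -/
def Iso.homeo {M N : SuperSpace.{u}} (φ : Iso M N) : M.carrier ≃ₜ N.carrier where
  toFun := φ.hom.base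
  invFun := φ.inv.base
  left_inv := φ.inv_hom_base
  right_inv := φ.hom_inv_base
  continuous_toFun := φ.hom.base.continuous
  continuous_invFun := φ.inv.base.continuous

/-- The pullback `φ^* : 𝒪(N) → 𝒪(M)` on global superfunctions. -/
def Hom.pullGlobal {M N : SuperSpace.{u}} (φ : Hom M N) : N.O ⊤ →ₗ[ℝ] M.O ⊤ :=
  ((M.res (fun _ _ => trivial : (⊤ : Opens M.carrier) ≤ Opens.comap φ.base ⊤)).comp
    (φ.pull ⊤)).toLinearMap

end SuperSpace

/-! ## Smooth functions in a classical chart -/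

section SmoothFn

open scoped ContDiff

variable {X : Type u} [TopologicalSpace X] {p : ℕ}

open Classical in
/-- The expression in the chart `e` of a function `g` on `W` (extended by zero). -/
def readFn (e : OpenPartialHomeomorph X (EuclideanSpace ℝ (Fin p))) (W : Opens X) (g : W → ℝ) :
    EuclideanSpace ℝ (Fin p) → ℝ :=
  fun v => if h : e.symm v ∈ W then g ⟨e.symm v, h⟩ else 0

/-- The image of `W` in the chart `e` (for `W` contained in the domain of `e`). -/
def chartImage (e : OpenPartialHomeomorph X (EuclideanSpace ℝ (Fin p))) (W : Opens X) :
    Set (EuclideanSpace ℝ (Fin p)) :=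
  e.target ∩ e.symm ⁻¹' (W : Set X)

theorem readFn_eq (e : OpenPartialHomeomorph X (EuclideanSpace ℝ (Fin p))) (W : Opens X)
    (g : W → ℝ) {v : EuclideanSpace ℝ (Fin p)} (h : e.symm v ∈ W) :
    readFn e W g v = g ⟨e.symm v, h⟩ := dif_pos h

theorem isOpen_chartImage (e : OpenPartialHomeomorph X (EuclideanSpace ℝ (Fin p)))
    (W : Opens X) : IsOpen (chartImage e W) :=
  e.isOpen_inter_preimage_symm W.isOpen

/-- The algebra `C^∞(W)` of functions on `W` which are smooth in the chart `e`. -/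
def SmoothFn (e : OpenPartialHomeomorph X (EuclideanSpace ℝ (Fin p))) (W : Opens X) :
    Subalgebra ℝ (W → ℝ) where
  carrier := {g | ContDiffOn ℝ ∞ (readFn e W g) (chartImage e W)}
  mul_mem' {f g} hf hg := (hf.mul hg).congr fun v hv => by
    simp [readFn_eq e W _ hv.2]
  add_mem' {f g} hf hg := (hf.add hg).congr fun v hv => by
    simp [readFn_eq e W _ hv.2]
  algebraMap_mem' r := (contDiffOn_const (c := r)).congr fun v hv => by
    simp [readFn_eq e W _ hv.2]

/-- Restriction of smooth functions. -/
def SmoothFn.res {e : OpenPartialHomeomorph X (EuclideanSpace ℝ (Fin p))} {U W : Opens X}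
    (h : W ≤ U) (g : SmoothFn e U) : SmoothFn e W :=
  ⟨fun w => g.1 ⟨w.1, h w.2⟩, by
    have hg : ContDiffOn ℝ ∞ (readFn e U g.1) (chartImage e U) := g.2
    refine (hg.mono (fun v hv => ⟨hv.1, h hv.2⟩)).congr fun v hv => ?_
    rw [readFn_eq e W _ hv.2, readFn_eq e U _ (h hv.2)]⟩

/-- The `i`-th coordinate function of the chart `e`. -/
def SmoothFn.coord (e : OpenPartialHomeomorph X (EuclideanSpace ℝ (Fin p))) (W : Opens X)
    (i : Fin p) : SmoothFn e W :=
  ⟨fun w => e w.1 i, by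
    have h : ContDiffOn ℝ ∞ (fun v : EuclideanSpace ℝ (Fin p) => v i) (chartImage e W) := by
      fun_prop
    refine h.congr fun v hv => ?_
    rw [readFn_eq e W _ hv.2]
    simp [e.right_inv hv.1]⟩

/-- The partial derivative of a smooth function along the `i`-th coordinate of the chart `e`. -/
def SmoothFn.deriv {e : OpenPartialHomeomorph X (EuclideanSpace ℝ (Fin p))} {W : Opens X}
    (i : Fin p) (g : SmoothFn e W) : SmoothFn e W :=
  ⟨fun w => fderiv ℝ (readFn e W g.1) (e w.1) (EuclideanSpace.single i 1), by
    have hg : ContDiffOn ℝ ∞ (readFn e W g.1) (chartImage e W) := g.2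
    have h := (hg.fderiv_of_isOpen (isOpen_chartImage e W) (m := ∞) le_rfl).clm_apply
      (contDiffOn_const (c := (EuclideanSpace.single i 1 : EuclideanSpace ℝ (Fin p))))
    refine h.congr fun v hv => ?_
    rw [readFn_eq e W _ hv.2]
    simp [e.right_inv hv.1]⟩

end SmoothFn

/-! ## Coordinate systems and supermanifolds -/

namespace SuperSpace

/-- The ordered monomial `ξ^ν = ξ_1^{ν_1} ⋯ ξ_q^{ν_q}`, for `ν ∈ {0,1}^q` given as a finite set. -/
def oddMonomial {R : Type*} [Ring R] {q : ℕ} (ξ : Fin q → R) (ν : Finset (Fin q)) : R :=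
  (List.ofFn fun j => if j ∈ ν then ξ j else 1).prod

/-- A coordinate system `x = (u, ξ)` of dimension `(p,q)` on an open subspace `U` of `M`. It consists
of a classical chart `u₀` on `U₀`, a morphism `γ^*` of sheaves of algebras from the smooth
functions to the even superfunctions on `U` (the retraction associated with `u`, so `u = γ^*(u₀)`),
and odd superfunctions `ξ_1, …, ξ_q` such that every superfunction `f` has a unique decomposition
`f = ∑_ν γ^*(f_ν) ξ^ν`. Equivalently (as `𝒪_M` is supercommutative), it is an isomorphism of
`(U₀, 𝒪_M|_{U₀})` onto an open subspace of `ℝ^{p|q} = (ℝ^p, C^∞ ⊗ Λ(ℝ^q)^*)`. -/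
structure Coord (M : SuperSpace.{u}) (p q : ℕ) where
  chart : OpenPartialHomeomorph M.carrier (EuclideanSpace ℝ (Fin p))
  γ : ∀ W : Opens M.carrier, (W : Set M.carrier) ⊆ chart.source → SmoothFn chart W →ₐ[ℝ] M.O W
  γ_res : ∀ {U W : Opens M.carrier} (h : W ≤ U) (hU : (U : Set M.carrier) ⊆ chart.source)
    (hW : (W : Set M.carrier) ⊆ chart.source) (g : SmoothFn chart U),
    γ W hW (SmoothFn.res h g) = M.res h (γ U hU g)
  γ_even : ∀ W hW g, M.σ W (γ W hW g) = γ W hW g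
  ξ : Fin q → M.O ⟨chart.source, chart.open_source⟩
  ξ_odd : ∀ j, M.σ _ (ξ j) = - ξ j
  existsUnique_decomp : ∀ (W : Opens M.carrier) (hW : (W : Set M.carrier) ⊆ chart.source)
    (f : M.O W), ∃! a : Finset (Fin q) → SmoothFn chart W,
      f = ∑ ν, γ W hW (a ν) * oddMonomial
        (fun j => M.res (show W ≤ ⟨chart.source, chart.open_source⟩ from hW) (ξ j)) ν

namespace Coord

variable {M : SuperSpace.{u}} {p q : ℕ} (c : Coord M p q)

/-- The coordinate neighbourhood on which the coordinate system is defined. -/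
def dom : Opens M.carrier := ⟨c.chart.source, c.chart.open_source⟩

/-- The coordinates `x_k` (even ones `u_i`, indexed by `Fin p`, and odd ones `ξ_j`, indexed by
`Fin q`). -/
def x : Fin p ⊕ Fin q → M.O c.dom
  | .inl i => c.γ c.dom subset_rfl (SmoothFn.coord c.chart c.dom i)
  | .inr j => c.ξ j

/-- The monomial `ξ^ν` on `W`. -/
def monomial {W : Opens M.carrier} (hW : W ≤ c.dom) (ν : Finset (Fin q)) : M.O W :=
  oddMonomial (fun j => M.res hW (c.ξ j)) ν

/-- The coefficients `f_ν` in the decomposition `f = ∑_ν γ^*(f_ν) ξ^ν`. -/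
def coeff {W : Opens M.carrier} (hW : W ≤ c.dom) (f : M.O W) :
    Finset (Fin q) → SmoothFn c.chart W :=
  (c.existsUnique_decomp W hW f).choose

theorem coeff_spec {W : Opens M.carrier} (hW : W ≤ c.dom) (f : M.O W) :
    f = ∑ ν, c.γ W hW (c.coeff hW f ν) * c.monomial hW ν :=
  (c.existsUnique_decomp W hW f).choose_spec.1

/-- The underlying function `f₀ = j_M^*(f) = f_{(0,…,0)}` of a superfunction. -/
def body {W : Opens M.carrier} (hW : W ≤ c.dom) (f : M.O W) : W → ℝ := (c.coeff hW f ∅).1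

/-- The coordinate derivations `∂/∂x_k`:
`∂f/∂u_i = ∑_ν γ^*(∂f_ν/∂u_{i,0}) ξ^ν` and
`∂f/∂ξ_j = ∑_{ν, ν_j = 1} (-1)^{ν_1 + ⋯ + ν_{j-1}} γ^*(f_ν) ξ^{ν - e_j}`. -/
def pd {W : Opens M.carrier} (hW : W ≤ c.dom) : Fin p ⊕ Fin q → M.O W → M.O W
  | .inl i, f => ∑ ν, c.γ W hW (SmoothFn.deriv i (c.coeff hW f ν)) * c.monomial hW ν
  | .inr j, f => ∑ ν with j ∈ ν, (-1 : ℝ) ^ (ν.filter (· < j)).card •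
      (c.γ W hW (c.coeff hW f ν) * c.monomial hW (ν.erase j))

end Coord

end SuperSpace

/-- A supermanifold of dimension `(p,q)`: a superspace with Hausdorff, second countable underlying
space which is covered by coordinate systems, that is, locally isomorphic to `ℝ^{p|q}`. -/
structure Supermanifold (p q : ℕ) extends SuperSpace.{u} where
  t2 : T2Space carrier
  secondCountable : SecondCountableTopology carrier
  exists_coord : ∀ m : carrier, ∃ c : SuperSpace.Coord toSuperSpace p q, m ∈ c.dom

namespace SuperSpace

/-! ## The Berezinian -/

/-- The determinant of a square matrix with (commuting) entries in a ring that need not be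
commutative. -/
def ringDet {R : Type*} [Ring R] {n : ℕ} (A : Matrix (Fin n) (Fin n) R) : R :=
  ∑ τ : Equiv.Perm (Fin n), ((Equiv.Perm.sign τ : ℤˣ) : ℤ) • (List.ofFn fun i => A (τ i) i).prod

/-- The Berezinian `Ber (R S; T V) = det (R - S V⁻¹ T) det V⁻¹`. -/
def berezinian {A : Type*} [Ring A] {p q : ℕ} (J : Matrix (Fin p ⊕ Fin q) (Fin p ⊕ Fin q) A) : A :=
  ringDet (J.toBlocks₁₁ - J.toBlocks₁₂ * Ring.inverse J.toBlocks₂₂ * J.toBlocks₂₁) *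
    ringDet (Ring.inverse J.toBlocks₂₂)

/-- The Jacobian matrix `∂x/∂y` of two coordinate systems on an open set `W` contained in both
domains; the rows are indexed by the derivations `∂/∂y_k`, the columns by the coordinates `x_l`. -/
def jacobian {M : SuperSpace.{u}} {p q : ℕ} (x y : Coord M p q) {W : Opens M.carrier}
    (hx : W ≤ x.dom) (hy : W ≤ y.dom) : Matrix (Fin p ⊕ Fin q) (Fin p ⊕ Fin q) (M.O W) :=
  Matrix.of fun k l => y.pd hy k (M.res hx (x.x l))

/-! ## Berezin forms and Berezin densities -/

/-- A family of superfunctions `ω_x ∈ 𝒪(U)`, one for each coordinate system `(U, x)` on `M`. It is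
used to describe a Berezin form or density `ω` by its local expressions `ω|_U = Dx ω_x`, respectively
`ω|_U = |Dx| ω_x`, with the coefficient on the right. As Berezinians are even, the formulas
for the coefficients on the right do not involve the parity of `Dx` or `|Dx|`, which may be chosen
arbitrarily; the coefficient on the left is `(-1)^{|ω_x||Dx|} ω_x`. -/
abbrev LocalCoeffs (M : SuperSpace.{u}) (p q : ℕ) : Type u := ∀ x : Coord M p q, M.O x.dom

/-- Berezin forms: `Dx f = Dy (Ber (∂x/∂y) f)`. -/
def IsBerezinForm {M : SuperSpace.{u}} {p q : ℕ} (ω : LocalCoeffs M p q) : Prop :=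
  ∀ (x y : Coord M p q) (W : Opens M.carrier) (hx : W ≤ x.dom) (hy : W ≤ y.dom),
    M.res hy (ω y) = berezinian (jacobian x y hx hy) * M.res hx (ω x)

/-- Berezin densities: `|Dx| f = |Dy| (sgn (j_M^* det R) Ber (∂x/∂y) f)`, where `R = ∂u/∂v` is the
even-even block of `∂x/∂y`. The sign is locally constant, so it suffices to require this
on the open sets `W` on which it is a constant `ε`. -/
def IsBerezinDensity {M : SuperSpace.{u}} {p q : ℕ} (ω : LocalCoeffs M p q) : Prop :=
  ∀ (x y : Coord M p q) (W : Opens M.carrier) (hx : W ≤ x.dom) (hy : W ≤ y.dom) (ε : ℝ),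
    (∀ w, Real.sign (y.body hy (ringDet (jacobian x y hx hy).toBlocks₁₁) w) = ε) →
      M.res hy (ω y) = ε • (berezinian (jacobian x y hx hy) * M.res hx (ω x))

/-! ## Pullback along an isomorphism -/

section res

theorem res_res (M : SuperSpace.{u}) {U V W : Opens M.carrier} (h : V ≤ U) (h' : W ≤ V)
    (f : M.O U) : M.res h' (M.res h f) = M.res (h'.trans h) f := by
  have : (homOfLE (h'.trans h)).op = (homOfLE h).op ≫ (homOfLE h').op := rfl
  simp only [res, this, Functor.map_comp, AlgCat.hom_comp, AlgHom.comp_apply]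

theorem res_self (M : SuperSpace.{u}) {U : Opens M.carrier} (h : U ≤ U) (f : M.O U) :
    M.res h f = f := by
  have : (homOfLE h).op = 𝟙 (op U) := rfl
  rw [res, this, CategoryTheory.Functor.map_id]
  rfl

theorem res_σ (M : SuperSpace.{u}) {U W : Opens M.carrier} (h : W ≤ U) (f : M.O U) :
    M.σ W (M.res h f) = M.res h (M.σ U f) := M.σ_map h f

theorem map_oddMonomial {R S F : Type*} [Ring R] [Ring S] [FunLike F R S] [RingHomClass F R S]
    (Φ : F) {q : ℕ} (ξ : Fin q → R) (ν : Finset (Fin q)) :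
    Φ (oddMonomial ξ ν) = oddMonomial (fun j => Φ (ξ j)) ν := by
  simp only [oddMonomial, map_list_prod, List.map_ofFn]
  congr 2
  funext j
  simp only [Function.comp]
  split_ifs <;> simp

end res

namespace Iso

variable {M N : SuperSpace.{u}} (φ : Iso M N) {p : ℕ}

/-- Transport of smooth functions along the inverse of the underlying homeomorphism. -/
def pushFn (e : OpenPartialHomeomorph N.carrier (EuclideanSpace ℝ (Fin p)))
    (W : Opens M.carrier) :
    SmoothFn (φ.homeo.transOpenPartialHomeomorph e) W →ₐ[ℝ] SmoothFn e (W.comap φ.inv.base) where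
  toFun g := ⟨fun n => g.1 ⟨φ.inv.base n.1, n.2⟩, g.2⟩
  map_one' := rfl
  map_mul' _ _ := rfl
  map_zero' := rfl
  map_add' _ _ := rfl
  commutes' _ := rfl

theorem pushFn_bijective (e : OpenPartialHomeomorph N.carrier (EuclideanSpace ℝ (Fin p)))
    (W : Opens M.carrier) : Function.Bijective (φ.pushFn e W) := by
  have hmem : ∀ m : M.carrier, m ∈ W → φ.inv.base (φ.hom.base m) ∈ W := fun m hm => by
    rwa [φ.inv_hom_base]
  constructor
  · intro g g' h
    ext w
    have h1 := congrFun (congrArg Subtype.val h) ⟨φ.hom.base w.1, hmem _ w.2⟩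
    have h2 : (⟨φ.inv.base (φ.hom.base w.1), hmem _ w.2⟩ : W) = w :=
      Subtype.ext (φ.inv_hom_base _)
    change g.1 ⟨φ.inv.base (φ.hom.base w.1), hmem _ w.2⟩
      = g'.1 ⟨φ.inv.base (φ.hom.base w.1), hmem _ w.2⟩ at h1
    rwa [h2] at h1
  · intro g
    have key : ∀ n : W.comap φ.inv.base,
        g.1 ⟨φ.hom.base (φ.inv.base n.1), hmem _ n.2⟩ = g.1 n := fun n => by
      exact congrArg g.1 (Subtype.ext (φ.hom_inv_base n.1))
    refine ⟨⟨fun w => g.1 ⟨φ.hom.base w.1, hmem _ w.2⟩, ?_⟩, ?_⟩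
    · have hg := g.2
      refine ContDiffOn.congr hg fun v hv => ?_
      rw [readFn_eq _ W _ hv.2]
      refine Eq.trans ?_ (readFn_eq e (W.comap φ.inv.base) g.1 (v := v) hv.2).symm
      exact key ⟨e.symm v, hv.2⟩
    · ext n
      exact key n

theorem le_comap_comap (W : Opens M.carrier) :
    W ≤ (W.comap φ.inv.base).comap φ.hom.base := by
  intro m hm
  change φ.inv.base (φ.hom.base m) ∈ W
  rwa [φ.inv_hom_base]

/-- The isomorphism `φ^* : 𝒪_N(φ₀(W)) → 𝒪_M(W)`. -/
def pullTo (W : Opens M.carrier) : N.O (W.comap φ.inv.base) →ₐ[ℝ] M.O W :=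
  (M.res (φ.le_comap_comap W)).comp (φ.hom.pull (W.comap φ.inv.base))

theorem pullTo_inv (W : Opens M.carrier) (f : M.O W) : φ.pullTo W (φ.inv.pull W f) = f := by
  have h : (W.comap φ.inv.base).comap φ.hom.base ≤ W := by
    intro m hm
    change φ.inv.base (φ.hom.base m) ∈ W at hm
    rwa [φ.inv_hom_base] at hm
  simp only [pullTo, AlgHom.comp_apply]
  rw [φ.hom_inv_pull W h f, res_res, res_self]

theorem inv_pullTo (W : Opens M.carrier) (f : N.O (W.comap φ.inv.base)) :
    φ.inv.pull W (φ.pullTo W f) = f := by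
  have h : ((W.comap φ.inv.base).comap φ.hom.base).comap φ.inv.base ≤ W.comap φ.inv.base := by
    intro n hn
    change φ.inv.base (φ.hom.base (φ.inv.base n)) ∈ W at hn
    change φ.inv.base n ∈ W
    rwa [φ.inv_hom_base] at hn
  simp only [pullTo, AlgHom.comp_apply]
  rw [φ.inv.pull_res, φ.inv_hom_pull _ h, res_res, res_self]

theorem eq_pullTo_iff (W : Opens M.carrier) (f : M.O W) (g : N.O (W.comap φ.inv.base)) :
    f = φ.pullTo W g ↔ φ.inv.pull W f = g :=
  ⟨fun h => h ▸ φ.inv_pullTo W g, fun h => h ▸ (φ.pullTo_inv W f).symm⟩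

theorem comap_subset_source {e : OpenPartialHomeomorph N.carrier (EuclideanSpace ℝ (Fin p))}
    {W : Opens M.carrier}
    (hW : (W : Set M.carrier) ⊆ (φ.homeo.transOpenPartialHomeomorph e).source) :
    ((W.comap φ.inv.base : Opens N.carrier) : Set N.carrier) ⊆ e.source := by
  intro n hn
  have h : φ.hom.base (φ.inv.base n) ∈ e.source := hW hn
  rwa [φ.hom_inv_base] at h

theorem pullTo_σ (W : Opens M.carrier) (f : N.O (W.comap φ.inv.base)) :
    M.σ W (φ.pullTo W f) = φ.pullTo W (N.σ _ f) := by
  simp only [pullTo, AlgHom.comp_apply]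
  rw [res_σ, ← φ.hom.pull_σ]

theorem pullTo_res {V : Opens N.carrier} (W : Opens M.carrier) (h : W.comap φ.inv.base ≤ V)
    (h' : W ≤ V.comap φ.hom.base) (f : N.O V) :
    φ.pullTo W (N.res h f) = M.res h' (φ.hom.pull V f) := by
  simp only [pullTo, AlgHom.comp_apply]
  rw [φ.hom.pull_res, res_res]

theorem res_pullTo {U W : Opens M.carrier} (h : W ≤ U) (f : N.O (U.comap φ.inv.base)) :
    M.res h (φ.pullTo U f) = φ.pullTo W (N.res (Opens.comap_mono φ.inv.base h) f) := by
  simp only [pullTo, AlgHom.comp_apply]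
  rw [φ.hom.pull_res, res_res, res_res]

/-- The coordinate system `φ^*(x) = (φ^*(x_1), …, φ^*(x_{p+q}))` on `φ^{-1}(U)`, for a coordinate
system `x` on `U ⊆ N`. -/
def pullCoord {q : ℕ} (c : Coord N p q) : Coord M p q where
  chart := φ.homeo.transOpenPartialHomeomorph c.chart
  γ W hW := (φ.pullTo W).comp
    ((c.γ (W.comap φ.inv.base) (φ.comap_subset_source hW)).comp (φ.pushFn c.chart W))
  γ_res {U W} h hU hW g := by
    have h1 := c.γ_res (Opens.comap_mono φ.inv.base h) (φ.comap_subset_source hU)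
      (φ.comap_subset_source hW) (φ.pushFn c.chart U g)
    exact (congrArg (φ.pullTo W) h1).trans (φ.res_pullTo h _).symm
  γ_even W hW g := (φ.pullTo_σ W _).trans (congrArg (φ.pullTo W) (c.γ_even _ _ _))
  ξ j := φ.hom.pull c.dom (c.ξ j)
  ξ_odd j :=
    (φ.hom.pull_σ c.dom (c.ξ j)).symm.trans
      ((congrArg (φ.hom.pull c.dom) (c.ξ_odd j)).trans (map_neg _ _))
  existsUnique_decomp W hW f := by
    have hW' := φ.comap_subset_source hW
    have hmono : ∀ ν : Finset (Fin q),
        oddMonomial (fun j => M.res (show W ≤ c.dom.comap φ.hom.base from hW)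
          (φ.hom.pull c.dom (c.ξ j))) ν
        = φ.pullTo W (oddMonomial (fun j => N.res (show _ ≤ c.dom from hW') (c.ξ j)) ν) := by
      intro ν
      rw [map_oddMonomial]
      congr 1
      funext j
      exact (φ.pullTo_res W _ _ _).symm
    obtain ⟨a, ha, hau⟩ := c.existsUnique_decomp (W.comap φ.inv.base) hW' (φ.inv.pull W f)
    have hsum : ∀ b : Finset (Fin q) →
          SmoothFn (φ.homeo.transOpenPartialHomeomorph c.chart) W,
        (∑ ν, ((φ.pullTo W).comp ((c.γ (W.comap φ.inv.base) hW').comp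
            (φ.pushFn c.chart W))) (b ν) *
          oddMonomial (fun j => M.res (show W ≤ c.dom.comap φ.hom.base from hW)
            (φ.hom.pull c.dom (c.ξ j))) ν)
        = φ.pullTo W (∑ ν, c.γ (W.comap φ.inv.base) hW' (φ.pushFn c.chart W (b ν)) *
            oddMonomial (fun j => N.res (show _ ≤ c.dom from hW') (c.ξ j)) ν) := by
      intro b
      rw [map_sum]
      refine Finset.sum_congr rfl fun ν _ => ?_
      rw [hmono, map_mul]
      rfl
    choose b hb using fun ν => (φ.pushFn_bijective c.chart W).2 (a ν)
    refine ⟨b, ?_, ?_⟩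
    · refine Eq.trans ?_ (hsum b).symm
      rw [eq_pullTo_iff]
      simp only [hb]
      exact ha
    · intro b' hb'
      have h1 := hb'.trans (hsum b')
      rw [eq_pullTo_iff] at h1
      have h2 := hau (fun ν => φ.pushFn c.chart W (b' ν)) h1
      funext ν
      apply (φ.pushFn_bijective c.chart W).1
      rw [hb, ← h2]

end Iso

/-- `ω = φ^*η` for a Berezin form or density `η` on `N`: if `η|_U = |Dx| f`, then
`(φ^*η)|_{φ^{-1}(U)} = |Dφ^*(x)| φ^*(f)`, and analogously for forms. -/
def IsPullback {M N : SuperSpace.{u}} (φ : Iso M N) {p q : ℕ} (η : LocalCoeffs N p q)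
    (ω : LocalCoeffs M p q) : Prop :=
  ∀ x : Coord N p q, ω (φ.pullCoord x) = φ.hom.pull x.dom (η x)

/-! ## Differential operators and their action on Berezin forms and densities -/

/-- Multi-indices `j ∈ ℕ^p × {0,1}^q`. -/
abbrev MultiIndex (p q : ℕ) : Type := (Fin p → ℕ) × Finset (Fin q)

/-- The nondecreasing list of coordinate indices in which each `k` occurs `j_k` times. -/
def MultiIndex.toList {p q : ℕ} (j : MultiIndex p q) : List (Fin p ⊕ Fin q) :=
  (List.ofFn fun i => List.replicate (j.1 i) (Sum.inl i)).flatten ++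
    ((List.finRange q).filter (· ∈ j.2)).map Sum.inr

namespace Coord

variable {M : SuperSpace.{u}} {p q : ℕ} (x : Coord M p q)

/-- `∂_x^j = ∂_{x_{p+q}}^{j_{p+q}} ∘ ⋯ ∘ ∂_{x_1}^{j_1}`. -/
def iteratedPd (j : MultiIndex p q) (f : M.O x.dom) : M.O x.dom :=
  j.toList.foldl (fun g k => x.pd le_rfl k g) f

/-- The right action of a coordinate derivation, `(|Dx| f).∂_{x_k} = |Dx| g` with
`g = -(-1)^{|f||x_k|} ∂f/∂x_k`. This is `ω.X = -(-1)^{|X||ω|} ℒ_X ω` for `X = ∂_{x_k}`, because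
`ℒ_X |Dx| = 0` and hence `ℒ_X (|Dx| f) = (-1)^{|X||Dx|} |Dx| X(f)`. -/
def rightPd : Fin p ⊕ Fin q → M.O x.dom → M.O x.dom
  | .inl i, f => -(x.pd le_rfl (.inl i) f)
  | .inr j, f => -(x.pd le_rfl (.inr j) (M.σ _ f))

/-- The right action of `∂_x^j`: `ω.(∂_{x_{k_n}} ∘ ⋯ ∘ ∂_{x_{k_1}})
= ((ω.∂_{x_{k_n}}).⋯).∂_{x_{k_1}}`. -/
def rightIteratedPd (j : MultiIndex p q) (f : M.O x.dom) : M.O x.dom :=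
  j.toList.foldr (fun k g => x.rightPd k g) f

/-- `A|_U = ∑_j a_j ∂_x^j` on the coordinate neighbourhood `U` of `x`, for a (finite) family of
superfunctions `a_j`. -/
def Represents (a : MultiIndex p q →₀ M.O x.dom) (A : M.O ⊤ →ₗ[ℝ] M.O ⊤) : Prop :=
  ∀ f : M.O ⊤, M.res le_top (A f) = a.sum fun j aj => aj * x.iteratedPd j (M.res le_top f)

end Coord

/-- Differential operators on `M`: operators on `𝒪(M)` which are, near each point, of the form
`∑_j a_j ∂_x^j` (a finite sum) in some coordinate system. -/
def IsDiffOp (M : SuperSpace.{u}) (p q : ℕ) (A : M.O ⊤ →ₗ[ℝ] M.O ⊤) : Prop :=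
  ∀ m : M.carrier, ∃ x : Coord M p q, m ∈ x.dom ∧ ∃ a, x.Represents a A

/-- `η = ω.A` for the right action of differential operators on Berezin forms or densities, that is,
the right action of the algebra of differential operators, compatible with restrictions,
with `ω.f = ωf` for superfunctions `f` and `ω.X = -(-1)^{|X||ω|} ℒ_X ω` for vector fields `X`. In
terms of the local expressions `ω|_U = |Dx| f` and `A|_U = ∑_j a_j ∂_x^j`, this says
`η|_U = ∑_j (|Dx| f a_j).∂_x^j`. -/
def IsRightAction {M : SuperSpace.{u}} {p q : ℕ} (A : M.O ⊤ →ₗ[ℝ] M.O ⊤)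
    (ω η : LocalCoeffs M p q) : Prop :=
  ∀ (x : Coord M p q) (a : MultiIndex p q →₀ M.O x.dom), x.Represents a A →
    η x = a.sum fun j aj => x.rightIteratedPd j (ω x * aj)

end SuperSpace

end

noncomputable section

namespace SuperSpace

/-! ## Monomials in anticommuting variables -/

section Monomials

variable {R : Type*} [Ring R] {q : ℕ} {ξ : Fin q → R}

/-! A differential operator does not enlarge supports, so comparing with a bump function forces `φ₀`
to be the identity (`base_eq_of_isDiffOp`). Over each coordinate domain, `φ^*` thus becomes an
algebra automorphism `ψ`. It preserves underlying functions, because it preserves invertibility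
(`Iso.bodyHom_pullSelf`).

Integration by parts identifies the right action with the formal adjoint `P` for the Berezin
integral: `∫ f ψ(g) = ∫ P(f) g` for compactly supported `g`. The pairing is nondegenerate
(`Coord.eq_zero_of_integral_mul`), so this relation alone determines `P`.

The heart is `f = Ber(J) ψ(P f)`, where `J` is the Jacobian matrix of `ψ`
(`Coord.berezinian_mul_apply_adjoint`). No change of variables theorem is used. As `P(f ψ(h)) = P(f)
h`, it is enough that `C = ψ(P 1) Ber(J)` equals 1. The adjoint of the chain rule is a divergence
identity for `P(J)`; it says that the logarithmic `ξ_j`-derivative of `ψ(P 1)` is opposite to that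
of `Ber(J)`. Hence every `∂C/∂ξ_j` vanishes and `C` is an ordinary function of `u`. On `ξ_1 ⋯ ξ_q`
only underlying functions matter, and there `C` acts as 1. The even derivatives of `C` are never
needed.

Now `f = Ber(J) ψ(h)` is the transformation law between the coordinate systems `φ^*(x)` and `x`. The
sign in the law for densities is 1, since the even block of `J` has underlying matrix 1. So the
family `η` with `φ^*η = ω`, which exists because `φ` is invertible, is `ω.φ^*`. Uniqueness holds
because the local formula fixes `η` in coordinate systems covering `M`, and the transformation law
carries it to all others. -/

theorem oddMonomial_eq_finRange (ξ : Fin q → R) (ν : Finset (Fin q)) :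
    oddMonomial ξ ν = ((List.finRange q).map fun j => if j ∈ ν then ξ j else 1).prod := by
  rw [oddMonomial, List.ofFn_eq_map]

@[simp] theorem oddMonomial_empty (ξ : Fin q → R) : oddMonomial ξ ∅ = 1 := by
  rw [oddMonomial_eq_finRange]
  exact List.prod_eq_one (by simp)

/-- The factor `ξ k` moves right past exactly the factors with smaller index, each costing a sign.
Sorted lists containing `k` replace the full list of indices so that induction on the list is
possible. -/
theorem mul_listMonomial [Algebra ℝ R] (hξ : ∀ i j, ξ i * ξ j = -(ξ j * ξ i)) (hξ' : ∀ i, ξ i * ξ i = 0)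
    (k : Fin q) (ν : Finset (Fin q)) : ∀ l : List (Fin q), l.Pairwise (· < ·) → k ∈ l →
    ξ k * (l.map fun j => if j ∈ ν then ξ j else 1).prod =
      if k ∈ ν then 0 else (-1 : ℝ) ^ (l.countP fun j => decide (j ∈ ν ∧ j < k)) •
        (l.map fun j => if j ∈ insert k ν then ξ j else 1).prod := by
  intro l
  induction l with
  | nil => simp
  | cons a l ih =>
    intro hl hk
    rw [List.pairwise_cons] at hl
    rcases List.mem_cons.1 hk with rfl | hk
    · have h0 : (k :: l).countP (fun j => decide (j ∈ ν ∧ j < k)) = 0 := by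
        rw [List.countP_eq_zero]
        intro j hj
        rcases List.mem_cons.1 hj with rfl | hj
        · simp
        · simpa using fun _ => (hl.1 j hj).le
      rw [h0]
      by_cases hkν : k ∈ ν
      · simp [hkν, ← mul_assoc, hξ']
      · have : (l.map fun j => if j ∈ ν then ξ j else 1)
            = l.map fun j => if j ∈ insert k ν then ξ j else 1 := by
          refine List.map_congr_left fun j hj => ?_
          have : j ≠ k := (hl.1 j hj).ne'
          simp [this]
        simp [hkν, this]
    · have hak : a < k := hl.1 k hk
      specialize ih hl.2 hk
      have hak' : a ≠ k := hak.ne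
      rw [List.map_cons, List.prod_cons, List.map_cons, List.prod_cons, List.countP_cons]
      by_cases haν : a ∈ ν
      · rw [if_pos haν, ← mul_assoc, hξ, neg_mul, mul_assoc, ih]
        by_cases hkν : k ∈ ν
        · simp [hkν]
        · simp [hkν, haν, hak, pow_succ]
      · rw [if_neg haν, one_mul, ih]
        simp [haν, hak']

theorem mul_oddMonomial [Algebra ℝ R] (hξ : ∀ i j, ξ i * ξ j = -(ξ j * ξ i)) (hξ' : ∀ i, ξ i * ξ i = 0)
    (k : Fin q) (ν : Finset (Fin q)) :
    ξ k * oddMonomial ξ ν = if k ∈ ν then 0 else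
      (-1 : ℝ) ^ (ν.filter (· < k)).card • oddMonomial ξ (insert k ν) := by
  simp only [oddMonomial_eq_finRange]
  rw [mul_listMonomial hξ hξ' k ν _ (List.sortedLT_finRange q).pairwise (List.mem_finRange k)]
  have : (List.finRange q).countP (fun j => decide (j ∈ ν ∧ j < k))
      = (ν.filter (· < k)).card := by
    rw [List.countP_eq_length_filter, ← List.toFinset_card_of_nodup
      ((List.nodup_finRange q).filter _)]
    congr 1
    ext j
    simp
  rw [this]

end Monomials

/-! ## Parity -/

section Parity

variable (M : SuperSpace.{u})

theorem odd_mul_self {W : Opens M.carrier} {f : M.O W} (hf : M.σ W f = -f) : f * f = 0 := by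
  have h := M.odd_anticomm W f f hf hf
  have h2 : (2 : ℝ) • (f * f) = 0 := by
    rw [two_smul]
    exact add_eq_zero_iff_eq_neg.2 h
  simpa using h2

end Parity

/-! ### Coefficients with respect to the odd coordinates -/

namespace Coord

variable {M : SuperSpace.{u}} {p q : ℕ} (c : Coord M p q) {W : Opens M.carrier} (hW : W ≤ c.dom)

/-- The odd coordinates restricted to `W`. -/
def odd (j : Fin q) : M.O W := M.res hW (c.ξ j)

theorem σ_odd (j : Fin q) : M.σ W (c.odd hW j) = -c.odd hW j := by
  exact (M.res_σ hW (c.ξ j)).trans ((congrArg (M.res hW) (c.ξ_odd j)).trans (map_neg _ _))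

theorem odd_mul_odd (i j : Fin q) : c.odd hW i * c.odd hW j = -(c.odd hW j * c.odd hW i) :=
  M.odd_anticomm W _ _ (c.σ_odd hW i) (c.σ_odd hW j)

theorem odd_mul_self (i : Fin q) : c.odd hW i * c.odd hW i = 0 :=
  M.odd_mul_self (c.σ_odd hW i)

theorem γ_comm (a : SmoothFn c.chart W) (f : M.O W) : c.γ W hW a * f = f * c.γ W hW a :=
  M.even_comm W _ _ (c.γ_even W hW a)

/-- The superfunction with given coefficients. -/
def ofCoeff (a : Finset (Fin q) → SmoothFn c.chart W) : M.O W :=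
  ∑ ν, c.γ W hW (a ν) * c.monomial hW ν

theorem coeff_ofCoeff (a : Finset (Fin q) → SmoothFn c.chart W) :
    c.coeff hW (c.ofCoeff hW a) = a :=
  (c.existsUnique_decomp W hW (c.ofCoeff hW a)).unique (c.coeff_spec hW _) rfl

theorem ofCoeff_coeff (f : M.O W) : c.ofCoeff hW (c.coeff hW f) = f :=
  (c.coeff_spec hW f).symm

theorem coeff_injective : Function.Injective (c.coeff hW) :=
  Function.LeftInverse.injective (c.ofCoeff_coeff hW)

theorem coeff_add (f g : M.O W) : c.coeff hW (f + g) = c.coeff hW f + c.coeff hW g := by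
  conv_lhs => rw [← c.ofCoeff_coeff hW f, ← c.ofCoeff_coeff hW g]
  have : c.ofCoeff hW (c.coeff hW f) + c.ofCoeff hW (c.coeff hW g)
      = c.ofCoeff hW (c.coeff hW f + c.coeff hW g) := by
    simp only [ofCoeff, Pi.add_apply, map_add, add_mul, Finset.sum_add_distrib]
  rw [this, coeff_ofCoeff]

theorem coeff_γ_mul (g : SmoothFn c.chart W) (f : M.O W) :
    c.coeff hW (c.γ W hW g * f) = fun ν => g * c.coeff hW f ν := by
  conv_lhs => rw [← c.ofCoeff_coeff hW f]
  have : c.γ W hW g * c.ofCoeff hW (c.coeff hW f)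
      = c.ofCoeff hW (fun ν => g * c.coeff hW f ν) := by
    simp only [ofCoeff, map_mul, Finset.mul_sum, mul_assoc]
  rw [this, coeff_ofCoeff]

theorem coeff_smul (r : ℝ) (f : M.O W) : c.coeff hW (r • f) = r • c.coeff hW f := by
  have h := c.coeff_γ_mul hW (algebraMap ℝ _ r) f
  rw [AlgHom.commutes, ← Algebra.smul_def] at h
  rw [h]
  funext ν
  rw [← Algebra.smul_def]
  rfl

/-- The decomposition into coefficients, as a linear equivalence. -/
def coeffEquiv : M.O W ≃ₗ[ℝ] (Finset (Fin q) → SmoothFn c.chart W) where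
  toFun := c.coeff hW
  invFun := c.ofCoeff hW
  map_add' := c.coeff_add hW
  map_smul' := c.coeff_smul hW
  left_inv := c.ofCoeff_coeff hW
  right_inv := c.coeff_ofCoeff hW

theorem coeff_zero : c.coeff hW 0 = 0 := (c.coeffEquiv hW).map_zero
theorem coeff_neg (f : M.O W) : c.coeff hW (-f) = -c.coeff hW f := (c.coeffEquiv hW).map_neg f
theorem coeff_sub (f g : M.O W) : c.coeff hW (f - g) = c.coeff hW f - c.coeff hW g :=
  (c.coeffEquiv hW).map_sub f g
theorem coeff_sum {ι : Type*} (s : Finset ι) (f : ι → M.O W) :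
    c.coeff hW (∑ i ∈ s, f i) = ∑ i ∈ s, c.coeff hW (f i) := map_sum (c.coeffEquiv hW) f s

theorem coeff_γ_mul_monomial (g : SmoothFn c.chart W) (ν : Finset (Fin q)) :
    c.coeff hW (c.γ W hW g * c.monomial hW ν) = Pi.single ν g := by
  rw [← c.coeff_ofCoeff hW (Pi.single ν g)]
  congr 1
  rw [ofCoeff, Finset.sum_eq_single ν]
  · simp
  · intro μ _ hμ
    simp [hμ]
  · simp

@[simp] theorem monomial_empty : c.monomial hW ∅ = 1 := oddMonomial_empty _

theorem coeff_γ (g : SmoothFn c.chart W) : c.coeff hW (c.γ W hW g) = Pi.single ∅ g := by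
  simpa using c.coeff_γ_mul_monomial hW g ∅

theorem coeff_one : c.coeff hW 1 = Pi.single ∅ 1 := by
  simpa using c.coeff_γ hW 1

theorem coeff_monomial (ν : Finset (Fin q)) : c.coeff hW (c.monomial hW ν) = Pi.single ν 1 := by
  simpa using c.coeff_γ_mul_monomial hW 1 ν

theorem odd_mul_monomial (k : Fin q) (ν : Finset (Fin q)) :
    c.odd hW k * c.monomial hW ν = if k ∈ ν then 0 else
      (-1 : ℝ) ^ (ν.filter (· < k)).card • c.monomial hW (insert k ν) :=
  mul_oddMonomial (c.odd_mul_odd hW) (c.odd_mul_self hW) k ν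

theorem monomial_singleton (k : Fin q) : c.monomial hW {k} = c.odd hW k := by
  have := c.odd_mul_monomial hW k ∅
  simpa using this.symm

/-- Induction on superfunctions: it is enough to treat sums and monomials. -/
theorem induction_monomial {P : M.O W → Prop} (f : M.O W) (hadd : ∀ f g, P f → P g → P (f + g))
    (hmon : ∀ g ν, P (c.γ W hW g * c.monomial hW ν)) : P f := by
  rw [c.coeff_spec hW f]
  refine Finset.sum_induction_nonempty _ P hadd ⟨∅, Finset.mem_univ _⟩ fun ν _ => hmon _ ν

/-- Induction on superfunctions: they are generated by the functions `γ^*(g)` and the `ξ_k`. -/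
theorem induction_mul {P : M.O W → Prop} (f : M.O W) (hadd : ∀ f g, P f → P g → P (f + g))
    (hmul : ∀ f g, P f → P g → P (f * g)) (hγ : ∀ g, P (c.γ W hW g))
    (hodd : ∀ k, P (c.odd hW k)) : P f := by
  refine c.induction_monomial hW f hadd fun g ν => hmul _ _ (hγ g) ?_
  have h1 : P 1 := by simpa using hγ 1
  refine List.prod_induction P hmul h1 fun x hx => ?_
  obtain ⟨j, rfl⟩ := (List.mem_ofFn' _ _).1 hx
  dsimp only
  split_ifs
  exacts [hodd j, h1]

/-- With `coeff_γ_mul` this describes multiplication by generators in coefficients; the general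
product formula is avoided by inducting over generators. -/
theorem coeff_odd_mul (k : Fin q) (h : M.O W) (ν : Finset (Fin q)) :
    c.coeff hW (c.odd hW k * h) ν =
      if k ∈ ν then (-1 : ℝ) ^ (ν.filter (· < k)).card • c.coeff hW h (ν.erase k) else 0 := by
  induction h using c.induction_monomial hW with
  | hadd f g hf hg =>
    rw [mul_add, coeff_add, coeff_add, Pi.add_apply, hf, hg]
    split_ifs <;> simp
  | hmon g μ =>
    rw [← mul_assoc, ← c.γ_comm hW, mul_assoc, odd_mul_monomial, coeff_γ_mul_monomial]
    by_cases hμ : k ∈ μ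
    · rw [if_pos hμ, mul_zero, coeff_zero]
      split_ifs with hν
      · have : ν.erase k ≠ μ := fun h => Finset.notMem_erase k ν (h ▸ hμ)
        simp [this]
      · rfl
    · rw [if_neg hμ, mul_smul_comm, coeff_smul, coeff_γ_mul_monomial, Pi.smul_apply,
        Pi.single_apply, Pi.single_apply]
      by_cases h : ν = insert k μ
      · subst h
        have h1 : (insert k μ).filter (· < k) = μ.filter (· < k) := by
          rw [Finset.filter_insert, if_neg (lt_irrefl k)]
        simp [Finset.erase_insert hμ, h1]
      · rw [if_neg h, smul_zero]
        split_ifs with h1 h2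
        · exact absurd (by rw [← h2, Finset.insert_erase h1]) h
        · simp
        · rfl

end Coord
end SuperSpace

/-! ### Calculus of smooth functions in a classical chart -/

section SmoothFn
open scoped ContDiff

variable {X : Type u} [TopologicalSpace X] {p : ℕ}
  {e : OpenPartialHomeomorph X (EuclideanSpace ℝ (Fin p))} {W : Opens X}

namespace SmoothFn

theorem mem_chartImage {x : X} (hx : x ∈ e.source) (hW : x ∈ W) : e x ∈ chartImage e W :=
  ⟨e.map_source hx, by simpa [e.left_inv hx] using hW⟩

theorem differentiableAt (g : SmoothFn e W) {v : EuclideanSpace ℝ (Fin p)}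
    (hv : v ∈ chartImage e W) : DifferentiableAt ℝ (readFn e W g.1) v :=
  (show ContDiffOn ℝ ∞ (readFn e W g.1) (chartImage e W) from g.2).differentiableOn (by simp)
    |>.differentiableAt ((isOpen_chartImage e W).mem_nhds hv)

theorem deriv_apply (i : Fin p) (g : SmoothFn e W) (w : W) :
    (deriv i g).1 w = fderiv ℝ (readFn e W g.1) (e w.1) (EuclideanSpace.single i 1) := rfl

theorem readFn_eventuallyEq {g : SmoothFn e W} {F : EuclideanSpace ℝ (Fin p) → ℝ}
    (h : ∀ v (hv : v ∈ chartImage e W), g.1 ⟨e.symm v, hv.2⟩ = F v)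
    {v : EuclideanSpace ℝ (Fin p)} (hv : v ∈ chartImage e W) : readFn e W g.1 =ᶠ[nhds v] F := by
  filter_upwards [(isOpen_chartImage e W).mem_nhds hv] with v' hv'
  rw [readFn_eq e W _ hv'.2, h v' hv']

/-- The derivative, computed from any expression of the function in the chart. -/
theorem deriv_eq {i : Fin p} {g : SmoothFn e W} {F : EuclideanSpace ℝ (Fin p) → ℝ}
    (h : ∀ v (hv : v ∈ chartImage e W), g.1 ⟨e.symm v, hv.2⟩ = F v) (w : W)
    (hw : w.1 ∈ e.source) :
    (deriv i g).1 w = fderiv ℝ F (e w.1) (EuclideanSpace.single i 1) := by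
  rw [deriv_apply, (readFn_eventuallyEq h (mem_chartImage hw w.2)).fderiv_eq]

theorem ext_of_subset {f g : SmoothFn e W} (h : ∀ w, f.1 w = g.1 w) : f = g :=
  Subtype.ext (funext h)

variable (hW : (W : Set X) ⊆ e.source)
include hW

theorem deriv_add (i : Fin p) (f g : SmoothFn e W) : deriv i (f + g) = deriv i f + deriv i g := by
  refine ext_of_subset fun w => ?_
  have hw := mem_chartImage (hW w.2) w.2
  rw [deriv_eq (F := readFn e W f.1 + readFn e W g.1) _ w (hW w.2)]
  · rw [fderiv_add (differentiableAt f hw) (differentiableAt g hw)]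
    rfl
  · intro v hv
    simp [readFn_eq e W _ hv.2]

theorem deriv_mul (i : Fin p) (f g : SmoothFn e W) :
    deriv i (f * g) = deriv i f * g + f * deriv i g := by
  refine ext_of_subset fun w => ?_
  have hw := mem_chartImage (hW w.2) w.2
  rw [deriv_eq (F := readFn e W f.1 * readFn e W g.1) _ w (hW w.2)]
  · rw [fderiv_mul (differentiableAt f hw) (differentiableAt g hw)]
    have hf : ∀ f : SmoothFn e W, readFn e W f.1 (e w.1) = f.1 w := fun f => by
      rw [readFn_eq e W _ hw.2]
      exact congrArg f.1 (Subtype.ext (e.left_inv (hW w.2)))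
    simp only [hf]
    simp only [_root_.add_apply, _root_.smul_apply, smul_eq_mul]
    change _ = (deriv i f).1 w * g.1 w + f.1 w * (deriv i g).1 w
    rw [deriv_apply, deriv_apply]
    ring
  · intro v hv
    simp [readFn_eq e W _ hv.2]

theorem deriv_algebraMap (i : Fin p) (r : ℝ) : deriv i (algebraMap ℝ (SmoothFn e W) r) = 0 := by
  refine ext_of_subset fun w => ?_
  rw [deriv_eq (F := fun _ => r) (fun v hv => rfl) w (hW w.2)]
  simp

theorem deriv_smul (i : Fin p) (r : ℝ) (g : SmoothFn e W) : deriv i (r • g) = r • deriv i g := by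
  rw [Algebra.smul_def, deriv_mul hW, deriv_algebraMap hW, zero_mul, zero_add,
    ← Algebra.smul_def]

theorem deriv_coord (i j : Fin p) : deriv i (coord e W j) = if i = j then 1 else 0 := by
  refine ext_of_subset fun w => ?_
  rw [deriv_eq (F := fun v => EuclideanSpace.proj (𝕜 := ℝ) j v) _ w (hW w.2)]
  · rw [ContinuousLinearMap.fderiv]
    by_cases h : i = j
    · simp [h]
    · simp [h, Ne.symm h]
  · intro v hv
    simp [coord, e.right_inv hv.1]

theorem deriv_comm (i j : Fin p) (g : SmoothFn e W) :
    deriv i (deriv j g) = deriv j (deriv i g) := by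
  refine ext_of_subset fun w => ?_
  have hg : ContDiffOn ℝ ∞ (readFn e W g.1) (chartImage e W) := g.2
  have hw := mem_chartImage (hW w.2) w.2
  have h1 : DifferentiableAt ℝ (fderiv ℝ (readFn e W g.1)) (e w.1) :=
    ((hg.fderiv_of_isOpen (isOpen_chartImage e W) (m := ∞) le_rfl).differentiableOn (by simp)
      ).differentiableAt ((isOpen_chartImage e W).mem_nhds hw)
  have key : ∀ i j : Fin p, (deriv i (deriv j g)).1 w
      = fderiv ℝ (fderiv ℝ (readFn e W g.1)) (e w.1) (EuclideanSpace.single i 1)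
          (EuclideanSpace.single j 1) := by
    intro i j
    rw [deriv_eq (F := fun v => fderiv ℝ (readFn e W g.1) v (EuclideanSpace.single j 1)) _ w
      (hW w.2)]
    · rw [fderiv_clm_apply h1 (by fun_prop)]
      simp
    · intro v hv
      rw [deriv_apply]
      simp [e.right_inv hv.1]
  rw [key, key]
  have hs : IsSymmSndFDerivAt ℝ (readFn e W g.1) (e w.1) := by
    refine ContDiffAt.isSymmSndFDerivAt (n := ∞)
      (hg.contDiffAt ((isOpen_chartImage e W).mem_nhds hw)) ?_
    simp only [minSmoothness_of_isRCLikeNormedField]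
    exact WithTop.coe_le_coe.2 le_top
  exact hs _ _

omit hW in
theorem deriv_res {U : Opens X} (hWU : W ≤ U) (hU : (U : Set X) ⊆ e.source) (i : Fin p)
    (g : SmoothFn e U) : deriv i (res hWU g) = res hWU (deriv i g) := by
  refine ext_of_subset fun w => ?_
  rw [deriv_eq (F := readFn e U g.1) _ w (hU (hWU w.2))]
  · rfl
  · intro v hv
    rw [readFn_eq e U _ (hWU hv.2)]
    rfl

omit hW in
theorem continuous (hW : (W : Set X) ⊆ e.source) (g : SmoothFn e W) : Continuous g.1 := by
  have hg : ContDiffOn ℝ ∞ (readFn e W g.1) (chartImage e W) := g.2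
  have h1 : ContinuousOn (fun x : X => readFn e W g.1 (e x)) W :=
    hg.continuousOn.comp (e.continuousOn.mono hW) fun x hx => mem_chartImage (hW hx) hx
  have h2 := h1.domRestrict
  refine h2.congr fun w => ?_
  have := (mem_chartImage (hW w.2) w.2).2
  simp only [Set.domRestrict_apply]
  rw [readFn_eq e W _ this]
  exact congrArg g.1 (Subtype.ext (e.left_inv (hW w.2)))

end SmoothFn
end SmoothFn

/-! ### Coordinate derivations in terms of coefficients -/

namespace SuperSpace
namespace Coord

variable {M : SuperSpace.{u}} {p q : ℕ} (c : Coord M p q) {W : Opens M.carrier} (hW : W ≤ c.dom)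

theorem coeff_pd_inl (i : Fin p) (f : M.O W) (ν : Finset (Fin q)) :
    c.coeff hW (c.pd hW (.inl i) f) ν = SmoothFn.deriv i (c.coeff hW f ν) :=
  congrFun (c.coeff_ofCoeff hW fun ν => SmoothFn.deriv i (c.coeff hW f ν)) ν

/-- With `coeff_pd_inl` and `coeff_injective`, identities between coordinate derivations reduce to
identities of smooth functions and of signs. -/
theorem coeff_pd_inr (j : Fin q) (f : M.O W) (ν : Finset (Fin q)) :
    c.coeff hW (c.pd hW (.inr j) f) ν = if j ∈ ν then 0 else
      (-1 : ℝ) ^ (ν.filter (· < j)).card • c.coeff hW f (insert j ν) := by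
  rw [pd, coeff_sum, Finset.sum_apply]
  simp only [coeff_smul, coeff_γ_mul_monomial, Pi.smul_apply, Pi.single_apply]
  by_cases hj : j ∈ ν
  · rw [if_pos hj]
    refine Finset.sum_eq_zero fun μ _ => ?_
    rw [if_neg (fun h : ν = μ.erase j => Finset.notMem_erase j μ (h ▸ hj)), smul_zero]
  · rw [if_neg hj, Finset.sum_eq_single (insert j ν)]
    · rw [Finset.erase_insert hj, if_pos rfl, Finset.filter_insert, if_neg (lt_irrefl j)]
    · intro μ hμ hne
      rw [if_neg, smul_zero]
      rintro rfl
      exact hne (Finset.insert_erase (Finset.mem_filter.1 hμ).2).symm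
    · intro h
      simp at h

theorem pd_add (k : Fin p ⊕ Fin q) (f g : M.O W) :
    c.pd hW k (f + g) = c.pd hW k f + c.pd hW k g := by
  apply c.coeff_injective hW
  funext ν
  rcases k with i | j
  · simp only [coeff_add, Pi.add_apply, coeff_pd_inl, SmoothFn.deriv_add hW]
  · simp only [coeff_add, Pi.add_apply, coeff_pd_inr]
    split_ifs <;> simp

theorem pd_smul (k : Fin p ⊕ Fin q) (r : ℝ) (f : M.O W) :
    c.pd hW k (r • f) = r • c.pd hW k f := by
  apply c.coeff_injective hW
  funext ν
  rcases k with i | j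
  · simp only [coeff_smul, Pi.smul_apply, coeff_pd_inl, SmoothFn.deriv_smul hW]
  · simp only [coeff_smul, Pi.smul_apply, coeff_pd_inr]
    split_ifs
    · simp
    · rw [smul_comm]

/-- The coordinate derivation as a linear map. -/
def pdₗ (k : Fin p ⊕ Fin q) : M.O W →ₗ[ℝ] M.O W where
  toFun := c.pd hW k
  map_add' := c.pd_add hW k
  map_smul' := c.pd_smul hW k

theorem pd_neg (k : Fin p ⊕ Fin q) (f : M.O W) : c.pd hW k (-f) = -c.pd hW k f :=
  (c.pdₗ hW k).map_neg f
theorem pd_zero (k : Fin p ⊕ Fin q) : c.pd hW k (0 : M.O W) = 0 := (c.pdₗ hW k).map_zero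

theorem σ_γ (g : SmoothFn c.chart W) : M.σ W (c.γ W hW g) = c.γ W hW g := c.γ_even W hW g

theorem σ_γ_mul_monomial (g : SmoothFn c.chart W) (ν : Finset (Fin q)) :
    M.σ W (c.γ W hW g * c.monomial hW ν)
      = (-1 : ℝ) ^ ν.card • (c.γ W hW g * c.monomial hW ν) := by
  rw [map_mul, c.σ_γ, ← mul_smul_comm]
  congr 1
  induction ν using Finset.induction_on with
  | empty => simp
  | insert k ν hk ih =>
    have h := c.odd_mul_monomial hW k ν
    rw [if_neg hk] at h
    have h1 : c.monomial hW (insert k ν)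
        = (-1 : ℝ) ^ (ν.filter (· < k)).card • (c.odd hW k * c.monomial hW ν) := by
      rw [h, smul_smul, ← mul_pow]
      simp
    rw [h1, map_smul, map_mul, ih, c.σ_odd, Finset.card_insert_of_notMem hk, pow_succ]
    simp only [mul_smul_comm, smul_smul, neg_mul, mul_neg, mul_one, smul_neg, neg_smul]
    rw [mul_comm]

theorem coeff_σ (f : M.O W) (ν : Finset (Fin q)) :
    c.coeff hW (M.σ W f) ν = (-1 : ℝ) ^ ν.card • c.coeff hW f ν := by
  induction f using c.induction_monomial hW with
  | hadd f g hf hg => simp only [map_add, coeff_add, Pi.add_apply, hf, hg, smul_add]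
  | hmon g μ =>
    rw [σ_γ_mul_monomial, coeff_smul, coeff_γ_mul_monomial, Pi.smul_apply, Pi.single_apply]
    split_ifs with h
    · rw [h]
    · simp

theorem pd_inl_σ (i : Fin p) (f : M.O W) :
    c.pd hW (.inl i) (M.σ W f) = M.σ W (c.pd hW (.inl i) f) := by
  apply c.coeff_injective hW
  funext ν
  simp only [coeff_σ, coeff_pd_inl, SmoothFn.deriv_smul hW]

theorem pd_inr_σ (j : Fin q) (f : M.O W) :
    c.pd hW (.inr j) (M.σ W f) = -M.σ W (c.pd hW (.inr j) f) := by
  apply c.coeff_injective hW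
  funext ν
  simp only [coeff_neg, Pi.neg_apply, coeff_σ, coeff_pd_inr]
  split_ifs with h
  · simp
  · rw [Finset.card_insert_of_notMem h, pow_succ, smul_comm]
    simp

theorem pd_γ_mul_inl (i : Fin p) (g : SmoothFn c.chart W) (f : M.O W) :
    c.pd hW (.inl i) (c.γ W hW g * f)
      = c.γ W hW (SmoothFn.deriv i g) * f + c.γ W hW g * c.pd hW (.inl i) f := by
  apply c.coeff_injective hW
  funext ν
  simp only [coeff_add, Pi.add_apply, coeff_pd_inl, coeff_γ_mul, SmoothFn.deriv_mul hW]

theorem pd_γ_mul_inr (j : Fin q) (g : SmoothFn c.chart W) (f : M.O W) :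
    c.pd hW (.inr j) (c.γ W hW g * f) = c.γ W hW g * c.pd hW (.inr j) f := by
  apply c.coeff_injective hW
  funext ν
  simp only [coeff_pd_inr, coeff_γ_mul]
  split_ifs
  · simp
  · rw [mul_smul_comm]

theorem pd_odd_mul_inl (i : Fin p) (k : Fin q) (f : M.O W) :
    c.pd hW (.inl i) (c.odd hW k * f) = c.odd hW k * c.pd hW (.inl i) f := by
  apply c.coeff_injective hW
  funext ν
  simp only [coeff_pd_inl, coeff_odd_mul]
  split_ifs
  · rw [SmoothFn.deriv_smul hW]
  · simpa using SmoothFn.deriv_algebraMap (W := W) (e := c.chart) hW i 0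

theorem neg_one_pow_filter_insert {k j : Fin q} {ν : Finset (Fin q)} (hk : k ∉ ν) :
    (-1 : ℝ) ^ ((insert k ν).filter (· < j)).card
      = (if k < j then -1 else 1) * (-1) ^ (ν.filter (· < j)).card := by
  rw [Finset.filter_insert]
  split_ifs with h
  · rw [Finset.card_insert_of_notMem (by simp [hk]), pow_succ, mul_comm]
  · simp

theorem neg_one_pow_filter_erase {k j : Fin q} {ν : Finset (Fin q)} (hk : k ∈ ν) :
    (-1 : ℝ) ^ ((ν.erase k).filter (· < j)).card
      = (if k < j then -1 else 1) * (-1) ^ (ν.filter (· < j)).card := by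
  conv_rhs => rw [← Finset.insert_erase hk, neg_one_pow_filter_insert (Finset.notMem_erase k ν)]
  split_ifs <;> simp

/-- The canonical anticommutation relation between `∂/∂ξ_j` and multiplication by `ξ_k`; it is the
Leibniz rule for an odd generator. -/
theorem pd_odd_mul_inr (j k : Fin q) (f : M.O W) :
    c.pd hW (.inr j) (c.odd hW k * f)
      = (if j = k then f else 0) - c.odd hW k * c.pd hW (.inr j) f := by
  apply c.coeff_injective hW
  funext ν
  simp only [coeff_sub, Pi.sub_apply, coeff_odd_mul, coeff_pd_inr]
  by_cases hjk : j = k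
  · subst hjk
    by_cases hj : j ∈ ν
    · simp [hj, smul_smul, ← mul_pow, Finset.filter_erase]
    · simp [hj, Finset.filter_insert, smul_smul, ← mul_pow]
  · have hkj : k ≠ j := Ne.symm hjk
    by_cases hj : j ∈ ν
    · simp [hj, hjk, coeff_zero]
    · by_cases hk : k ∈ ν
      · simp only [hj, hjk, hk, if_true, if_false, coeff_zero, Pi.zero_apply, zero_sub,
          Finset.mem_insert, or_true, Finset.mem_erase, ne_eq, and_false,
          smul_smul, neg_one_pow_filter_insert hj, neg_one_pow_filter_erase hk,
          Finset.erase_insert_of_ne hjk]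
        -- Whichever of `j`, `k` is smaller, exactly one of the two counts sees the other index,
        -- which produces the single minus sign.
        rcases lt_or_gt_of_ne hjk with h | h
        · rw [if_pos h, if_neg h.not_gt, ← neg_smul]
          congr 1
          ring
        · rw [if_neg h.not_gt, if_pos h, ← neg_smul]
          congr 1
          ring
      · simp [hj, hjk, hk, hkj, coeff_zero]

end Coord
end SuperSpace

/-! ### Sign rules, the Leibniz rule and commuting derivations -/

namespace SuperSpace

section Parity

variable (M : SuperSpace.{u}) {p q : ℕ}

/-- Twice `h` is the sum of `h + σ h`, which is even, and `h - σ h`, which is odd; `f` commutes with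
the first and anticommutes with the second. -/
theorem odd_mul {W : Opens M.carrier} {f : M.O W} (hf : M.σ W f = -f) (h : M.O W) :
    f * h = M.σ W h * f := by
  have h1 : M.σ W (h + M.σ W h) = h + M.σ W h := by rw [map_add, M.σ_σ, add_comm]
  have h2 : M.σ W (h - M.σ W h) = -(h - M.σ W h) := by rw [map_sub, M.σ_σ, neg_sub]
  have e1 := M.even_comm W _ f h1
  have e2 := M.odd_anticomm W f _ hf h2
  have h3 : (2 : ℝ) • (f * h) = (2 : ℝ) • (M.σ W h * f) := by
    rw [add_mul, mul_add] at e1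
    rw [mul_sub, sub_mul] at e2
    calc (2 : ℝ) • (f * h) = (f * h + f * M.σ W h) + (f * h - f * M.σ W h) := by
          rw [two_smul]; abel
      _ = (2 : ℝ) • (M.σ W h * f) := by rw [← e1, e2, two_smul]; abel
  exact smul_right_injective _ (two_ne_zero' ℝ) h3

/-- The automorphism `f ↦ (-1)^{|f||x_k|} f`. -/
def twist (W : Opens M.carrier) : Fin p ⊕ Fin q → (M.O W →ₐ[ℝ] M.O W)
  | .inl _ => AlgHom.id ℝ _
  | .inr _ => M.σ W

variable {M} {W : Opens M.carrier}

@[simp] theorem twist_inl (i : Fin p) (f : M.O W) : M.twist (q := q) W (.inl i) f = f := rfl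
@[simp] theorem twist_inr (j : Fin q) (f : M.O W) : M.twist (p := p) W (.inr j) f = M.σ W f := rfl

theorem twist_twist (k : Fin p ⊕ Fin q) (f : M.O W) : M.twist W k (M.twist W k f) = f := by
  rcases k with i | j
  · rfl
  · exact M.σ_σ W f

end Parity

namespace Coord

variable {M : SuperSpace.{u}} {p q : ℕ} (c : Coord M p q) {W : Opens M.carrier} (hW : W ≤ c.dom)

theorem pd_one (k : Fin p ⊕ Fin q) : c.pd hW k (1 : M.O W) = 0 := by
  apply c.coeff_injective hW
  funext ν
  rcases k with i | j
  · rw [coeff_pd_inl, coeff_one, coeff_zero, Pi.single_apply]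
    split_ifs
    · simpa using SmoothFn.deriv_algebraMap (W := W) (e := c.chart) hW i 1
    · simpa using SmoothFn.deriv_algebraMap (W := W) (e := c.chart) hW i 0
  · rw [coeff_pd_inr, coeff_one, coeff_zero, Pi.single_apply]
    simp

theorem pd_γ_inl (i : Fin p) (g : SmoothFn c.chart W) :
    c.pd hW (.inl i) (c.γ W hW g) = c.γ W hW (SmoothFn.deriv i g) := by
  simpa [pd_one] using c.pd_γ_mul_inl hW i g 1

theorem pd_γ_inr (j : Fin q) (g : SmoothFn c.chart W) :
    c.pd hW (.inr j) (c.γ W hW g) = 0 := by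
  simpa [pd_one] using c.pd_γ_mul_inr hW j g 1

theorem pd_odd_inl (i : Fin p) (k : Fin q) : c.pd hW (.inl i) (c.odd hW k) = 0 := by
  simpa [pd_one] using c.pd_odd_mul_inl hW i k 1

theorem pd_odd_inr (j k : Fin q) :
    c.pd hW (.inr j) (c.odd hW k) = if j = k then 1 else 0 := by
  simpa [pd_one] using c.pd_odd_mul_inr hW j k 1

theorem twist_γ (k : Fin p ⊕ Fin q) (g : SmoothFn c.chart W) :
    M.twist W k (c.γ W hW g) = c.γ W hW g := by
  rcases k with i | j
  · rfl
  · exact c.σ_γ hW g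

/-- The Leibniz rule for the coordinate derivations. -/
theorem pd_mul (k : Fin p ⊕ Fin q) (f g : M.O W) :
    c.pd hW k (f * g) = c.pd hW k f * g + M.twist W k f * c.pd hW k g := by
  induction f using c.induction_mul hW generalizing g with
  | hadd f f' hf hf' => rw [add_mul, pd_add, hf, hf', pd_add, map_add]; noncomm_ring
  | hmul f f' hf hf' => rw [mul_assoc, hf, hf', hf f', map_mul]; noncomm_ring
  | hγ a =>
    rw [twist_γ]
    rcases k with i | j
    · rw [pd_γ_mul_inl, pd_γ_inl]
    · rw [pd_γ_mul_inr, pd_γ_inr, zero_mul, zero_add]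
  | hodd l =>
    rcases k with i | j
    · rw [pd_odd_mul_inl, pd_odd_inl, zero_mul, zero_add, twist_inl]
    · rw [pd_odd_mul_inr, pd_odd_inr, twist_inr, σ_odd, neg_mul, ite_mul, one_mul, zero_mul,
        sub_eq_add_neg]

theorem pd_inl_comm (i : Fin p) (k : Fin p ⊕ Fin q) (f : M.O W) :
    c.pd hW (.inl i) (c.pd hW k f) = c.pd hW k (c.pd hW (.inl i) f) := by
  apply c.coeff_injective hW
  funext ν
  rcases k with i' | j
  · simp only [coeff_pd_inl]
    exact SmoothFn.deriv_comm hW i i' _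
  · simp only [coeff_pd_inl, coeff_pd_inr]
    split_ifs
    · simpa using SmoothFn.deriv_algebraMap (W := W) (e := c.chart) hW i 0
    · rw [SmoothFn.deriv_smul hW]

theorem pd_inr_comm (j k : Fin q) (f : M.O W) :
    c.pd hW (.inr j) (c.pd hW (.inr k) f) = -c.pd hW (.inr k) (c.pd hW (.inr j) f) := by
  apply c.coeff_injective hW
  funext ν
  simp only [coeff_neg, Pi.neg_apply, coeff_pd_inr]
  by_cases hj : j ∈ ν
  · simp [hj]
  by_cases hk : k ∈ ν
  · simp [hk]
  rcases lt_trichotomy j k with h | rfl | h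
  · simp [hj, hk, h.ne, h.ne', smul_smul, neg_one_pow_filter_insert, h, h.not_gt, mul_comm,
      Finset.insert_comm j k]
  · simp
  · simp [hj, hk, h.ne, h.ne', smul_smul, neg_one_pow_filter_insert, h, h.not_gt, mul_comm,
      Finset.insert_comm j k]

/-! ### The underlying function -/

theorem coeff_odd_mul_empty (k : Fin q) (f : M.O W) : c.coeff hW (c.odd hW k * f) ∅ = 0 := by
  simp [coeff_odd_mul]

/-- The underlying function, as a morphism of algebras. -/
def bodyHom : M.O W →ₐ[ℝ] SmoothFn c.chart W where
  toFun f := c.coeff hW f ∅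
  map_one' := by simp [coeff_one]
  map_mul' f g := by
    induction f using c.induction_mul hW generalizing g with
    | hadd f f' hf hf' =>
      rw [add_mul, coeff_add, Pi.add_apply, hf, hf', coeff_add, Pi.add_apply, add_mul]
    | hmul f f' hf hf' => rw [mul_assoc, hf, hf', hf f', mul_assoc]
    | hγ a => rw [coeff_γ_mul, coeff_γ, Pi.single_eq_same]
    | hodd l =>
      have h := c.coeff_odd_mul_empty hW l 1
      rw [mul_one] at h
      rw [coeff_odd_mul_empty, h, zero_mul]
  map_zero' := by simp [coeff_zero]
  map_add' f g := by rw [coeff_add]; rfl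
  commutes' r := by
    rw [← (c.γ W hW).commutes, coeff_γ, Pi.single_eq_same]

theorem bodyHom_apply (f : M.O W) : c.bodyHom hW f = c.coeff hW f ∅ := rfl

theorem body_eq (f : M.O W) : c.body hW f = (c.bodyHom hW f).1 := rfl

theorem bodyHom_γ (g : SmoothFn c.chart W) : c.bodyHom hW (c.γ W hW g) = g := by
  rw [bodyHom_apply, coeff_γ, Pi.single_eq_same]

theorem bodyHom_odd {f : M.O W} (hf : M.σ W f = -f) : c.bodyHom hW f = 0 := by
  have h := c.coeff_σ hW f ∅
  rw [hf, coeff_neg, Finset.card_empty, pow_zero, one_smul, Pi.neg_apply] at h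
  have h2 : (2 : ℝ) • c.coeff hW f ∅ = 0 := by
    rw [two_smul]
    nth_rewrite 1 [← h]
    simp
  simpa [bodyHom_apply] using h2

/-! ### Restrictions -/

section Res

variable {V : Opens M.carrier} (h : V ≤ W)

theorem res_odd (j : Fin q) : M.res h (c.odd hW j) = c.odd (h.trans hW) j := M.res_res _ _ _

theorem res_monomial (ν : Finset (Fin q)) :
    M.res h (c.monomial hW ν) = c.monomial (h.trans hW) ν := by
  refine (map_oddMonomial (M.res h) _ ν).trans ?_
  exact congrArg (fun ξ => oddMonomial ξ ν) (funext fun j => c.res_odd hW h j)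

theorem res_γ (g : SmoothFn c.chart W) :
    M.res h (c.γ W hW g) = c.γ V (h.trans hW) (SmoothFn.res h g) := (c.γ_res h hW _ g).symm

theorem coeff_res (f : M.O W) (ν : Finset (Fin q)) :
    c.coeff (h.trans hW) (M.res h f) ν = SmoothFn.res h (c.coeff hW f ν) := by
  have : M.res h f = c.ofCoeff (h.trans hW) (fun ν => SmoothFn.res h (c.coeff hW f ν)) := by
    conv_lhs => rw [← c.ofCoeff_coeff hW f]
    simp only [ofCoeff, map_sum, map_mul, res_γ, res_monomial]
  rw [this, coeff_ofCoeff]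

theorem bodyHom_res (f : M.O W) :
    c.bodyHom (h.trans hW) (M.res h f) = SmoothFn.res h (c.bodyHom hW f) :=
  c.coeff_res hW h f ∅

theorem pd_res (k : Fin p ⊕ Fin q) (f : M.O W) :
    M.res h (c.pd hW k f) = c.pd (h.trans hW) k (M.res h f) := by
  apply c.coeff_injective (h.trans hW)
  funext ν
  rcases k with i | j
  · rw [c.coeff_res hW, coeff_pd_inl, coeff_pd_inl, c.coeff_res hW, SmoothFn.deriv_res h hW]
  · rw [c.coeff_res hW, coeff_pd_inr, coeff_pd_inr, c.coeff_res hW]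
    split_ifs <;> rfl

end Res

/-! ### The filtration by order at a point -/

/-- The coefficients of degree less than `n` vanish at the point `m`. -/
def VanishesToOrder (m : W) (n : ℕ) (f : M.O W) : Prop :=
  ∀ ν : Finset (Fin q), ν.card < n → (c.coeff hW f ν).1 m = 0

variable {c hW} {m : W} {n s : ℕ}

theorem VanishesToOrder.add {f g : M.O W} (hf : c.VanishesToOrder hW m n f)
    (hg : c.VanishesToOrder hW m n g) : c.VanishesToOrder hW m n (f + g) := fun ν hν => by
  rw [coeff_add]
  simp [hf ν hν, hg ν hν]

theorem VanishesToOrder.zero : c.VanishesToOrder hW m n 0 := fun ν _ => by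
  rw [coeff_zero]; rfl

theorem VanishesToOrder.sum {ι : Type*} {t : Finset ι} {f : ι → M.O W}
    (hf : ∀ i ∈ t, c.VanishesToOrder hW m n (f i)) :
    c.VanishesToOrder hW m n (∑ i ∈ t, f i) :=
  Finset.sum_induction _ _ (fun _ _ => VanishesToOrder.add) VanishesToOrder.zero hf

theorem VanishesToOrder.γ_mul {f : M.O W} (hf : c.VanishesToOrder hW m n f)
    (g : SmoothFn c.chart W) : c.VanishesToOrder hW m n (c.γ W hW g * f) := fun ν hν => by
  rw [coeff_γ_mul]
  simp [hf ν hν]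

theorem VanishesToOrder.odd_mul {f : M.O W} (hf : c.VanishesToOrder hW m n f) (k : Fin q) :
    c.VanishesToOrder hW m (n + 1) (c.odd hW k * f) := fun ν hν => by
  rw [coeff_odd_mul]
  split_ifs with h
  · have h1 := hf (ν.erase k) (by
      have := Finset.card_erase_lt_of_mem h
      omega)
    change _ * (c.coeff hW f (ν.erase k)).1 m = 0
    rw [h1, mul_zero]
  · rfl

theorem VanishesToOrder.of_le {f : M.O W} (hf : c.VanishesToOrder hW m n f) (h : s ≤ n) :
    c.VanishesToOrder hW m s f := fun ν hν => hf ν (hν.trans_le h)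

theorem VanishesToOrder.smul {f : M.O W} (hf : c.VanishesToOrder hW m n f) (r : ℝ) :
    c.VanishesToOrder hW m n (r • f) := fun ν hν => by
  rw [coeff_smul]
  change r * (c.coeff hW f ν).1 m = 0
  rw [hf ν hν, mul_zero]

theorem VanishesToOrder.monomial_mul {f : M.O W} (hf : c.VanishesToOrder hW m n f)
    (ν : Finset (Fin q)) : c.VanishesToOrder hW m (n + ν.card) (c.monomial hW ν * f) := by
  induction ν using Finset.induction_on with
  | empty => simpa using hf
  | insert k ν hk ih =>
    have h := c.odd_mul_monomial hW k ν
    rw [if_neg hk] at h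
    have h1 : c.monomial hW (insert k ν)
        = (-1 : ℝ) ^ (ν.filter (· < k)).card • (c.odd hW k * c.monomial hW ν) := by
      rw [h, smul_smul, ← mul_pow]
      simp
    rw [h1, Finset.card_insert_of_notMem hk, smul_mul_assoc, mul_assoc, ← add_assoc]
    exact (ih.odd_mul k).smul _

/-- Evaluating the coefficients at `m` maps superfunctions to an exterior algebra, and the condition
of order `n` says that the value has degree at least `n`. This filtration is multiplicative. It does
not record vanishing of derivatives in the even directions. -/
theorem VanishesToOrder.mul {f g : M.O W} (hf : c.VanishesToOrder hW m s f)
    (hg : c.VanishesToOrder hW m n g) : c.VanishesToOrder hW m (s + n) (f * g) := by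
  rw [c.coeff_spec hW f, Finset.sum_mul]
  refine .sum fun ν _ => ?_
  rw [mul_assoc]
  by_cases hν : ν.card < s
  · intro μ _
    rw [coeff_γ_mul]
    change (c.coeff hW f ν).1 m * _ = 0
    rw [hf ν hν, zero_mul]
  · exact ((hg.monomial_mul ν).of_le (by omega)).γ_mul _

/-- There are only `q` odd coordinates, so a large order at `m` already kills every coefficient at
`m`; points are then varied. -/
theorem eq_zero_of_vanishesToOrder {f : M.O W} (h : ∀ m n, c.VanishesToOrder hW m n f) :
    f = 0 := by
  apply c.coeff_injective hW
  rw [coeff_zero]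
  funext ν
  exact SmoothFn.ext_of_subset fun w => h w (ν.card + 1) ν (Nat.lt_succ_self _)

theorem vanishesToOrder_one_iff {f : M.O W} :
    c.VanishesToOrder hW m 1 f ↔ (c.bodyHom hW f).1 m = 0 := by
  constructor
  · exact fun h => h ∅ (by simp)
  · intro h ν hν
    rw [Finset.card_eq_zero.1 (Nat.lt_one_iff.1 hν)]
    exact h

end Coord
end SuperSpace

section SmoothFn
open scoped ContDiff

variable {X : Type u} [TopologicalSpace X] {p : ℕ}
  {e : OpenPartialHomeomorph X (EuclideanSpace ℝ (Fin p))}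

/-- The smooth function on `W` with a given expression in the chart. -/
def SmoothFn.ofChart (W : Opens X) (F : EuclideanSpace ℝ (Fin p) → ℝ)
    (hF : ContDiffOn ℝ ∞ F (chartImage e W)) : SmoothFn e W :=
  ⟨fun w => F (e w.1), by
    refine hF.congr fun v hv => ?_
    rw [readFn_eq e W _ hv.2]
    simp [e.right_inv hv.1]⟩

theorem SmoothFn.isUnit {W : Opens X} {g : SmoothFn e W} (hg : ∀ w, g.1 w ≠ 0) : IsUnit g := by
  refine .of_mul_eq_one ⟨fun w => (g.1 w)⁻¹, ?_⟩ ?_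
  · have h : ContDiffOn ℝ ∞ (readFn e W g.1) (chartImage e W) := g.2
    refine (h.inv fun v hv => ?_).congr fun v hv => ?_
    · rw [readFn_eq e W _ hv.2]
      exact hg _
    · rw [readFn_eq e W _ hv.2, Pi.inv_apply, readFn_eq e W _ hv.2]
  · exact SmoothFn.ext_of_subset fun w => mul_inv_cancel₀ (hg w)

end SmoothFn

namespace SuperSpace

variable {M : SuperSpace.{u}}

/-! ## Gluing -/

theorem eq_of_locally_eq {W : Opens M.carrier} {f g : M.O W}
    (h : ∀ m ∈ W, ∃ V : Opens M.carrier, ∃ hV : V ≤ W, m ∈ V ∧ M.res hV f = M.res hV g) :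
    f = g := by
  choose V hV hm hfg using h
  refine M.sheaf.eq_of_locally_eq' (fun i : W => V i.1 i.2) W (fun i => homOfLE (hV i.1 i.2)) ?_
    f g fun i => hfg i.1 i.2
  intro m hmW
  exact Opens.mem_iSup.2 ⟨⟨m, hmW⟩, hm m hmW⟩

/-- Extension by zero of a superfunction. -/
theorem exists_extension {U : Opens M.carrier} (f : M.O U) {K : Set M.carrier} (hK : IsClosed K)
    (hKU : K ⊆ U) (h0 : ∀ V (h : V ≤ U), Disjoint (V : Set M.carrier) K → M.res h f = 0) :
    ∃ G : M.O ⊤, M.res le_top G = f ∧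
      ∀ V : Opens M.carrier, Disjoint (V : Set M.carrier) K → M.res (le_top : V ≤ ⊤) G = 0 := by
  -- Glue `f` on `U` with zero on the complement of `K`; the hypothesis `h0` is the compatibility on
  -- the overlap.
  let C : Opens M.carrier := ⟨Kᶜ, hK.isOpen_compl⟩
  let S : Bool → Opens M.carrier := fun b => Bool.rec C U b
  let sf : ∀ b, M.O (S b) := fun b => Bool.rec (0 : M.O C) f b
  have hcompat : TopCat.Presheaf.IsCompatible M.sheaf.1 S sf := by
    have key : ∀ (V : Opens M.carrier) (h : V ≤ U) (_ : V ≤ C), M.res h f = 0 := fun V h h' =>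
      h0 V h (Set.disjoint_left.2 fun x hx => h' hx)
    rintro (_ | _) (_ | _)
    · rfl
    · exact (map_zero (M.res (inf_le_left : C ⊓ U ≤ C))).trans
        (key (C ⊓ U) inf_le_right inf_le_left).symm
    · exact (key (U ⊓ C) inf_le_left inf_le_right).trans
        (map_zero (M.res (inf_le_right : U ⊓ C ≤ C))).symm
    · rfl
  obtain ⟨G, hG, -⟩ := M.sheaf.existsUnique_gluing' S ⊤ (fun b => homOfLE le_top) (by
    intro x _
    rw [Opens.mem_iSup]
    by_cases hx : x ∈ K
    · exact ⟨true, hKU hx⟩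
    · exact ⟨false, hx⟩) sf hcompat
  refine ⟨G, hG true, fun V hV => ?_⟩
  have hVC : V ≤ C := fun x hx => Set.disjoint_left.1 hV hx
  have h1 : M.res (le_top : C ≤ ⊤) G = 0 := hG false
  rw [← M.res_res (le_top : C ≤ ⊤) hVC, h1, map_zero]

/-- Superfunctions with compact support in `U`. -/
def HasCompactSupp {U : Opens M.carrier} (f : M.O U) : Prop :=
  ∃ K : Set M.carrier, IsCompact K ∧ K ⊆ U ∧
    ∀ V (h : V ≤ U), Disjoint (V : Set M.carrier) K → M.res h f = 0

theorem HasCompactSupp.exists_extension [T2Space M.carrier] {U : Opens M.carrier} {f : M.O U}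
    (hf : HasCompactSupp f) : ∃ G : M.O ⊤, M.res le_top G = f := by
  obtain ⟨K, hK, hKU, h0⟩ := hf
  obtain ⟨G, hG, -⟩ := SuperSpace.exists_extension f hK.isClosed hKU h0
  exact ⟨G, hG⟩

theorem HasCompactSupp.mul_left {U : Opens M.carrier} {f : M.O U} (hf : HasCompactSupp f)
    (g : M.O U) : HasCompactSupp (g * f) := by
  obtain ⟨K, hK, hKU, h0⟩ := hf
  exact ⟨K, hK, hKU, fun V h hV => by rw [map_mul, h0 V h hV, mul_zero]⟩

theorem HasCompactSupp.add {U : Opens M.carrier} {f g : M.O U} (hf : HasCompactSupp f)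
    (hg : HasCompactSupp g) : HasCompactSupp (f + g) := by
  obtain ⟨K, hK, hKU, h0⟩ := hf
  obtain ⟨K', hK', hKU', h0'⟩ := hg
  refine ⟨K ∪ K', hK.union hK', Set.union_subset hKU hKU', fun V h hV => ?_⟩
  rw [Set.disjoint_union_right] at hV
  rw [map_add, h0 V h hV.1, h0' V h hV.2, add_zero]

theorem HasCompactSupp.zero {U : Opens M.carrier} : HasCompactSupp (0 : M.O U) :=
  ⟨∅, isCompact_empty, Set.empty_subset _, fun _ _ _ => map_zero _⟩

theorem HasCompactSupp.sum {U : Opens M.carrier} {ι : Type*} {s : Finset ι} {f : ι → M.O U}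
    (hf : ∀ i ∈ s, HasCompactSupp (f i)) : HasCompactSupp (∑ i ∈ s, f i) :=
  Finset.sum_induction _ _ (fun _ _ => HasCompactSupp.add) HasCompactSupp.zero hf

theorem HasCompactSupp.σ {U : Opens M.carrier} {f : M.O U} (hf : HasCompactSupp f) :
    HasCompactSupp (M.σ U f) := by
  obtain ⟨K, hK, hKU, h0⟩ := hf
  exact ⟨K, hK, hKU, fun V h hV => by rw [← res_σ, h0 V h hV, map_zero]⟩

/-! ### Supports, bump functions and invertible superfunctions -/

namespace Coord

variable {p q : ℕ} (c : Coord M p q) {W : Opens M.carrier} (hW : W ≤ c.dom)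

theorem hasCompactSupp_pd {f : M.O W} (hf : HasCompactSupp f) (k : Fin p ⊕ Fin q) :
    HasCompactSupp (c.pd hW k f) := by
  obtain ⟨K, hK, hKU, h0⟩ := hf
  exact ⟨K, hK, hKU, fun V h hV => by rw [pd_res, h0 V h hV, pd_zero]⟩

include hW in
/-- A bump function near `m`. -/
theorem exists_bump {m : M.carrier} (hm : m ∈ W) :
    ∃ (g : SmoothFn c.chart W) (K : Set M.carrier) (V : Opens M.carrier) (hV : V ≤ W),
      IsCompact K ∧ K ⊆ W ∧ (∀ w : W, w.1 ∉ K → g.1 w = 0) ∧ m ∈ V ∧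
      SmoothFn.res hV g = 1 := by
  have hem := SmoothFn.mem_chartImage (e := c.chart) (hW hm) hm
  obtain ⟨r, hr, hball⟩ := Metric.isOpen_iff.1 (isOpen_chartImage c.chart W) _ hem
  -- Equal to 1 on the ball of radius `r / 3`, which gives `V`, and supported in the closed ball of
  -- radius `r / 2`, which gives `K` and still lies in the chart image of `W`.
  let χ : ContDiffBump (c.chart m) := ⟨r / 3, r / 2, by linarith, by linarith⟩
  have hcl : Metric.closedBall (c.chart m) (r / 2) ⊆ chartImage c.chart W :=
    (Metric.closedBall_subset_ball (by linarith)).trans hball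
  let V : Opens M.carrier := ⟨c.chart.source ∩ c.chart ⁻¹' Metric.ball (c.chart m) (r / 3),
    c.chart.isOpen_inter_preimage Metric.isOpen_ball⟩
  have hsub : ∀ x ∈ c.chart.source, c.chart x ∈ Metric.ball (c.chart m) r → x ∈ W := by
    intro x hx hxr
    have := (hball hxr).2
    rwa [Set.mem_preimage, c.chart.left_inv hx] at this
  have hV : V ≤ W := fun x hx =>
    hsub x hx.1 (Metric.ball_subset_ball (by linarith) hx.2)
  refine ⟨SmoothFn.ofChart W χ χ.contDiff.contDiffOn,
    c.chart.symm '' Metric.closedBall (c.chart m) (r / 2), V, hV, ?_, ?_, ?_, ?_, ?_⟩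
  · exact (isCompact_closedBall _ _).image_of_continuousOn
      (c.chart.symm.continuousOn.mono fun v hv => (hcl hv).1)
  · rintro _ ⟨v, hv, rfl⟩
    exact (hcl hv).2
  · intro w hw
    refine χ.zero_of_le_dist ?_
    by_contra hlt
    rw [not_le] at hlt
    exact hw ⟨c.chart w.1, hlt.le, c.chart.left_inv (hW w.2)⟩
  · exact ⟨hW hm, Metric.mem_ball_self (by linarith)⟩
  · refine SmoothFn.ext_of_subset fun w => ?_
    exact χ.one_of_mem_closedBall (Metric.ball_subset_closedBall w.2.2)

theorem res_γ_eq_zero {g : SmoothFn c.chart W} {K : Set M.carrier}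
    (hg : ∀ w : W, w.1 ∉ K → g.1 w = 0) {V : Opens M.carrier} (h : V ≤ W)
    (hV : Disjoint (V : Set M.carrier) K) : M.res h (c.γ W hW g) = 0 := by
  have : SmoothFn.res h g = 0 := SmoothFn.ext_of_subset fun w =>
    hg ⟨w.1, h w.2⟩ (Set.disjoint_left.1 hV w.2)
  rw [res_γ, this, map_zero]

/-- The difference between `f` and its underlying function is nilpotent, since its powers climb the
filtration by odd degree. -/
theorem isUnit_of_bodyHom {f : M.O W} (hf : ∀ w, (c.bodyHom hW f).1 w ≠ 0) : IsUnit f := by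
  have hn : IsNilpotent (f - c.γ W hW (c.bodyHom hW f)) := by
    refine ⟨q + 1, ?_⟩
    apply c.coeff_injective hW
    rw [coeff_zero]
    funext ν
    refine SmoothFn.ext_of_subset fun w => ?_
    have h1 : c.VanishesToOrder hW w 1 (f - c.γ W hW (c.bodyHom hW f)) := by
      rw [vanishesToOrder_one_iff, map_sub, bodyHom_γ, sub_self]
      rfl
    have h2 : ∀ n, c.VanishesToOrder hW w n ((f - c.γ W hW (c.bodyHom hW f)) ^ n) := by
      intro n
      induction n with
      | zero => exact fun ν hν => absurd hν (Nat.not_lt_zero _)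
      | succ n ih => rw [pow_succ]; exact ih.mul h1
    exact h2 (q + 1) ν (Nat.lt_succ_of_le (by simpa using Finset.card_le_univ ν))
  have hu : IsUnit (c.γ W hW (c.bodyHom hW f)) := (SmoothFn.isUnit hf).map (c.γ W hW)
  have := hn.isUnit_add_left_of_commute hu (c.γ_comm hW _ _).symm
  simpa using this

theorem res_iteratedPd_eq_zero (j : MultiIndex p q) (h : W ≤ c.dom) (f : M.O c.dom)
    (hf : M.res h f = 0) : M.res h (c.iteratedPd j f) = 0 := by
  unfold iteratedPd
  induction j.toList generalizing f with
  | nil => exact hf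
  | cons k l ih => exact ih _ (by rw [pd_res, hf, pd_zero])

end Coord

/-- An isomorphism whose pullback is a differential operator induces the identity on `M₀`. -/
theorem base_eq_of_isDiffOp {p q : ℕ} [T2Space M.carrier]
    (hM : ∀ m : M.carrier, ∃ c : Coord M p q, m ∈ c.dom) (φ : Hom M M)
    (hφ : IsDiffOp M p q φ.pullGlobal) (m : M.carrier) : φ.base m = m := by
  by_contra hne
  obtain ⟨A, B, hA, hB, hmA, hmB, hAB⟩ := t2_separation hne
  obtain ⟨c, hc⟩ := hM (φ.base m)
  -- Intersecting with `A` keeps the bump function around `φ₀(m)` away from the neighbourhood `B` of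
  -- `m`.
  let U : Opens M.carrier := ⟨A, hA⟩ ⊓ c.dom
  have hU : U ≤ c.dom := inf_le_right
  obtain ⟨g, K, V, hV, hK, hKU, hg, hmV, hg1⟩ :=
    c.exists_bump hU (m := φ.base m) ⟨hmA, hc⟩
  obtain ⟨G, hG, hG0⟩ := exists_extension (c.γ U hU g) hK.isClosed hKU fun V h hV =>
    c.res_γ_eq_zero hU hg h hV
  obtain ⟨x, hx, a, ha⟩ := hφ m
  let Z : Opens M.carrier := x.dom ⊓ (⟨B, hB⟩ ⊓ V.comap φ.base)
  have hZx : Z ≤ x.dom := inf_le_left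
  have hmZ : m ∈ Z := ⟨hx, hmB, hmV⟩
  have h0 : M.res (le_top : Z ≤ ⊤) G = 0 := hG0 Z <|
    Set.disjoint_left.2 fun y hy hyK => Set.disjoint_left.1 hAB (hKU hyK).1 hy.2.1
  -- Locality of the differential operator: `G` vanishes near `m`, hence so does its image.
  have e1 : M.res (le_top : Z ≤ ⊤) (φ.pullGlobal G) = 0 := by
    rw [← M.res_res le_top hZx, ha G, Finsupp.sum, map_sum]
    refine Finset.sum_eq_zero fun j _ => ?_
    rw [map_mul, x.res_iteratedPd_eq_zero j hZx _ (by rwa [M.res_res]), mul_zero]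
  -- Multiplicativity of the pullback: `G` is 1 near `φ₀(m)`, so its image is 1 near `m`.
  have e2 : M.res (le_top : Z ≤ ⊤) (φ.pullGlobal G) = 1 := by
    have h1 : M.res (le_top : V ≤ ⊤) G = 1 := by
      rw [← M.res_res le_top hV, hG, c.res_γ, hg1, map_one]
    have h2 := φ.pull_res (le_top : V ≤ ⊤) G
    rw [h1, map_one] at h2
    have h3 := congrArg (M.res (show Z ≤ V.comap φ.base from inf_le_right.trans inf_le_right)) h2
    rw [map_one, M.res_res] at h3
    rw [h3]
    exact M.res_res _ _ _
  have h3 : x.coeff hZx (1 : M.O Z) ∅ = 0 := by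
    rw [← e2, e1, x.coeff_zero]; rfl
  rw [x.coeff_one, Pi.single_eq_same] at h3
  exact one_ne_zero (congrFun (congrArg Subtype.val h3) ⟨m, hmZ⟩)

/-! ## Automorphisms over the identity -/

namespace Iso

variable (φ : Iso M M) (h : ∀ m, φ.hom.base m = m)
include h

theorem inv_base_eq (m : M.carrier) : φ.inv.base m = m := by
  conv_lhs => rw [← h m]
  exact φ.inv_hom_base m

theorem le_comap_hom (W : Opens M.carrier) : W ≤ W.comap φ.hom.base := fun m hm => by
  change φ.hom.base m ∈ W
  rwa [h]

theorem le_comap_inv (W : Opens M.carrier) : W ≤ W.comap φ.inv.base := fun m hm => by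
  change φ.inv.base m ∈ W
  rwa [φ.inv_base_eq h]

/-- The pullback of superfunctions on `W`, if `φ₀` is the identity. -/
def pullSelf (W : Opens M.carrier) : M.O W ≃ₐ[ℝ] M.O W :=
  AlgEquiv.ofAlgHom ((M.res (φ.le_comap_hom h W)).comp (φ.hom.pull W))
    ((M.res (φ.le_comap_inv h W)).comp (φ.inv.pull W))
    (by
      ext f
      have h1 : (W.comap φ.inv.base).comap φ.hom.base ≤ W := fun m hm => by
        change φ.inv.base (φ.hom.base m) ∈ W at hm
        rwa [φ.inv_hom_base] at hm
      simp only [AlgHom.comp_apply, AlgHom.id_apply]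
      rw [φ.hom.pull_res, φ.hom_inv_pull W h1, res_res, res_res, res_self])
    (by
      ext f
      have h1 : (W.comap φ.hom.base).comap φ.inv.base ≤ W := fun m hm => by
        change φ.hom.base (φ.inv.base m) ∈ W at hm
        rwa [φ.hom_inv_base] at hm
      simp only [AlgHom.comp_apply, AlgHom.id_apply]
      rw [φ.inv.pull_res, φ.inv_hom_pull W h1, res_res, res_res, res_self])

theorem pullSelf_apply (W : Opens M.carrier) (f : M.O W) :
    φ.pullSelf h W f = M.res (φ.le_comap_hom h W) (φ.hom.pull W f) := rfl

theorem res_pullSelf {U W : Opens M.carrier} (hWU : W ≤ U) (f : M.O U) :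
    M.res hWU (φ.pullSelf h U f) = φ.pullSelf h W (M.res hWU f) := by
  rw [pullSelf_apply, pullSelf_apply, φ.hom.pull_res, res_res, res_res]

theorem pullSelf_σ (W : Opens M.carrier) (f : M.O W) :
    φ.pullSelf h W (M.σ W f) = M.σ W (φ.pullSelf h W f) := by
  rw [pullSelf_apply, φ.hom.pull_σ, ← res_σ]
  rfl

theorem res_pullGlobal (W : Opens M.carrier) (f : M.O ⊤) :
    M.res (le_top : W ≤ ⊤) (φ.hom.pullGlobal f)
      = φ.pullSelf h W (M.res le_top f) := by
  rw [pullSelf_apply, φ.hom.pull_res, res_res]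
  exact M.res_res _ _ _

theorem hasCompactSupp_pullSelf {W : Opens M.carrier} {f : M.O W} (hf : HasCompactSupp f) :
    HasCompactSupp (φ.pullSelf h W f) := by
  obtain ⟨K, hK, hKU, h0⟩ := hf
  exact ⟨K, hK, hKU, fun V hV hVK => by rw [res_pullSelf, h0 V hV hVK, map_zero]⟩

/-- Suppose the value of `ψ(f)` at `m` differs from the value `lam` of `f`. Then `ψ(f - lam)` is
invertible near `m`, hence so is `f - lam`, although its underlying function vanishes at `m`. -/
theorem bodyHom_pullSelf {p q : ℕ} (c : Coord M p q) {W : Opens M.carrier} (hW : W ≤ c.dom)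
    (f : M.O W) : c.bodyHom hW (φ.pullSelf h W f) = c.bodyHom hW f := by
  refine SmoothFn.ext_of_subset fun m => ?_
  by_contra hne
  set lam : ℝ := (c.bodyHom hW f).1 m with hlam
  set f' : M.O W := f - algebraMap ℝ _ lam with hf'
  have hb : ∀ w, (c.bodyHom hW (φ.pullSelf h W f')).1 w
      = (c.bodyHom hW (φ.pullSelf h W f)).1 w - lam := by
    intro w
    rw [hf', map_sub, map_sub, AlgEquiv.commutes, AlgHom.commutes]
    rfl
  have hcont : Continuous (c.bodyHom hW (φ.pullSelf h W f')).1 := SmoothFn.continuous hW _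
  -- By continuity the underlying function of `ψ(f - lam)` is nonzero on a whole neighbourhood of
  -- `m`, which is what invertibility requires.
  obtain ⟨V₀, hV₀, hVeq⟩ := isOpen_induced_iff.1 (isOpen_ne_fun hcont (continuous_const (y := (0 : ℝ))))
  let V : Opens M.carrier := ⟨V₀, hV₀⟩ ⊓ W
  have hVW : V ≤ W := inf_le_right
  have hmV : m.1 ∈ V := ⟨by
    have : m ∈ (Subtype.val ⁻¹' V₀ : Set W) := by
      rw [hVeq]
      change (c.bodyHom hW (φ.pullSelf h W f')).1 m ≠ 0
      rw [hb]
      exact sub_ne_zero.2 hne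
    exact this, m.2⟩
  have hu : IsUnit (M.res hVW (φ.pullSelf h W f')) := by
    refine c.isUnit_of_bodyHom (hVW.trans hW) fun w => ?_
    rw [c.bodyHom_res hW]
    have : (⟨w.1, hVW w.2⟩ : W) ∈ (Subtype.val ⁻¹' V₀ : Set W) := w.2.1
    rw [hVeq] at this
    exact this
  rw [res_pullSelf] at hu
  have hu2 : IsUnit (M.res hVW f') := by
    have := hu.map (φ.pullSelf h V).symm
    rwa [AlgEquiv.symm_apply_apply] at this
  have hu3 := (hu2.map (c.bodyHom (hVW.trans hW))).map
    ((Pi.evalAlgHom ℝ (fun _ : V => ℝ) ⟨m.1, hmV⟩).comp (SmoothFn c.chart V).val)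
  refine hu3.ne_zero ?_
  rw [c.bodyHom_res hW, hf', map_sub, AlgHom.commutes]
  change (c.bodyHom hW f).1 m - lam = 0
  exact sub_self _

end Iso

end SuperSpace

/-! ## Hadamard's lemma -/

section Hadamard
open scoped ContDiff
open MeasureTheory

/-- Differentiation under the integral sign, repeated. The induction varies the target space,
because the derivative takes values in linear maps. -/
theorem contDiff_intervalIntegral_param {E : Type} [NormedAddCommGroup E] [NormedSpace ℝ E]
    [FiniteDimensional ℝ E] (n : ℕ) : ∀ {F : Type} [NormedAddCommGroup F] [NormedSpace ℝ F]
    [CompleteSpace F] {f : E × ℝ → F}, ContDiff ℝ n f →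
      ContDiff ℝ n fun x => ∫ t in (0 : ℝ)..1, f (x, t) := by
  have : ProperSpace E := FiniteDimensional.proper ℝ E
  induction n with
  | zero =>
    intro F _ _ _ f hf
    rw [Nat.cast_zero, contDiff_zero] at hf ⊢
    exact intervalIntegral.continuous_parametric_intervalIntegral_of_continuous'
      (f := fun x t => f (x, t)) hf _ _
  | succ n ih =>
    intro F _ _ _ f hf
    have hf' : ContDiff ℝ ((n : WithTop ℕ∞) + 1) f := by exact_mod_cast hf
    let f' : E × ℝ → (E →L[ℝ] F) := fun z =>
      (fderiv ℝ f z).comp (ContinuousLinearMap.inl ℝ E ℝ)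
    have hf1 : ContDiff ℝ n f' :=
      (hf'.fderiv_right le_rfl).clm_comp contDiff_const
    have hd : ∀ x t, HasFDerivAt (fun x => f (x, t)) (f' (x, t)) x := fun x t => by
      have h1 : HasFDerivAt f (fderiv ℝ f (x, t)) (x, t) :=
        (hf'.differentiable (by simp)).differentiableAt.hasFDerivAt
      exact h1.comp x (hasFDerivAt_prodMk_left x t)
    have hgoal : ContDiff ℝ ((n : WithTop ℕ∞) + 1) fun x => ∫ t in (0 : ℝ)..1, f (x, t) := by
      rw [contDiff_succ_iff_hasFDerivAt]
      refine ⟨fun x => ∫ t in (0 : ℝ)..1, f' (x, t), ih hf1, fun x₀ => ?_⟩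
      obtain ⟨C, hC⟩ := ((isCompact_closedBall x₀ 1).prod
        (isCompact_Icc (a := (0 : ℝ)) (b := 1))).exists_bound_of_continuousOn
        hf1.continuous.continuousOn
      have hc : ∀ x, Continuous fun t => f (x, t) := fun x =>
        hf'.continuous.comp (Continuous.prodMk_right x)
      refine (intervalIntegral.hasFDerivAt_integral_of_dominated_of_fderiv_le
        (F' := fun x t => f' (x, t)) (bound := fun _ => C)
        (Metric.ball_mem_nhds x₀ one_pos) ?_ ?_ ?_ ?_ ?_ ?_)
      · exact Filter.Eventually.of_forall fun x => (hc x).aestronglyMeasurable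
      · exact (hc x₀).intervalIntegrable _ _
      · exact (hf1.continuous.comp (Continuous.prodMk_right x₀)).aestronglyMeasurable
      · refine Filter.Eventually.of_forall fun t ht x hx => hC (x, t) ⟨?_, ?_⟩
        · exact Metric.ball_subset_closedBall hx
        · rw [Set.uIoc_of_le zero_le_one] at ht
          exact Set.Ioc_subset_Icc_self ht
      · exact intervalIntegrable_const
      · exact Filter.Eventually.of_forall fun t _ x _ => hd x t
    exact_mod_cast hgoal

/-- Integrate the derivative of `F` along the segment from `a` to `v`. -/
theorem exists_hadamard {p : ℕ} {F : EuclideanSpace ℝ (Fin p) → ℝ} (hF : ContDiff ℝ ∞ F)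
    (a : EuclideanSpace ℝ (Fin p)) :
    ∃ H : Fin p → EuclideanSpace ℝ (Fin p) → ℝ, (∀ i, ContDiff ℝ ∞ (H i)) ∧
      ∀ v, F v = F a + ∑ i, (v i - a i) * H i v := by
  have hF' : ContDiff ℝ ∞ (fderiv ℝ F) := hF.fderiv_right le_rfl
  refine ⟨fun i v => ∫ t in (0 : ℝ)..1, fderiv ℝ F (a + t • (v - a)) (EuclideanSpace.single i 1),
    fun i => ?_, fun v => ?_⟩
  · rw [contDiff_infty]
    intro n
    refine contDiff_intervalIntegral_param n
      (f := fun z => fderiv ℝ F (a + z.2 • (z.1 - a)) (EuclideanSpace.single i 1)) ?_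
    refine ContDiff.clm_apply (ContDiff.comp (hF'.of_le (by exact_mod_cast le_top)) ?_)
      contDiff_const
    fun_prop
  · have hline : ∀ t : ℝ, HasDerivAt (fun t : ℝ => F (a + t • (v - a)))
        (fderiv ℝ F (a + t • (v - a)) (v - a)) t := fun t => by
      have h1 : HasFDerivAt F (fderiv ℝ F (a + t • (v - a))) (a + t • (v - a)) :=
        (hF.differentiable (by simp)).differentiableAt.hasFDerivAt
      have h2 : HasDerivAt (fun t : ℝ => a + t • (v - a)) (v - a) t := by
        simpa using ((hasDerivAt_id t).smul_const (v - a)).const_add a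
      exact h1.comp_hasDerivAt t h2
    have hc : ∀ w, Continuous fun t : ℝ => fderiv ℝ F (a + t • (v - a)) w := fun w => by
      have := hF'.continuous
      fun_prop
    have hint := intervalIntegral.integral_eq_sub_of_hasDerivAt (a := 0) (b := 1)
      (fun t _ => hline t) ((hc _).intervalIntegrable _ _)
    have hsum : v - a = ∑ i, (v i - a i) • EuclideanSpace.single i (1 : ℝ) := by
      ext j
      simp [Finset.sum_apply, Pi.single_apply]
    have hlin : ∀ t : ℝ, fderiv ℝ F (a + t • (v - a)) (v - a)
        = ∑ i, (v i - a i) * fderiv ℝ F (a + t • (v - a)) (EuclideanSpace.single i 1) := by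
      intro t
      conv_lhs => rw [hsum]
      rw [map_sum]
      refine Finset.sum_congr rfl fun i _ => ?_
      rw [map_smul, smul_eq_mul]
      rw [← hsum]
    simp only [hlin] at hint
    rw [intervalIntegral.integral_finsetSum
      (fun i _ => ((hc _).const_mul _).intervalIntegrable _ _)] at hint
    simp only [intervalIntegral.integral_const_mul, one_smul, zero_smul, add_zero,
      add_sub_cancel] at hint
    rw [hint]
    ring

variable {X : Type u} [TopologicalSpace X] {p : ℕ}
  {e : OpenPartialHomeomorph X (EuclideanSpace ℝ (Fin p))} {W : Opens X}

/-- The chart image need not be star-shaped, so the formula on the whole space is used only after a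
cutoff near `m`; away from `m` one can divide by the squared distance. -/
theorem SmoothFn.exists_hadamard (hW : (W : Set X) ⊆ e.source) (g : SmoothFn e W) (m : W) :
    ∃ h : Fin p → SmoothFn e W, g = algebraMap ℝ _ (g.1 m) +
      ∑ i, (coord e W i - algebraMap ℝ _ (e m.1 i)) * h i := by
  set Ω := chartImage e W
  set a := e m.1
  have hΩ : IsOpen Ω := isOpen_chartImage e W
  have ha : a ∈ Ω := mem_chartImage (hW m.2) m.2
  set G := readFn e W g.1
  have hG : ContDiffOn ℝ ∞ G Ω := g.2
  have hG' : ∀ w : W, G (e w.1) = g.1 w := fun w => by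
    refine (readFn_eq e W _ (mem_chartImage (hW w.2) w.2).2).trans ?_
    exact congrArg g.1 (Subtype.ext (e.left_inv (hW w.2)))
  obtain ⟨r, hr, hball⟩ := Metric.isOpen_iff.1 hΩ _ ha
  let χ : ContDiffBump a := ⟨r / 3, r / 2, by linarith, by linarith⟩
  have hsupp : tsupport χ ⊆ Ω := by
    rw [χ.tsupport_eq]
    exact (Metric.closedBall_subset_ball (by change r / 2 < r; linarith)).trans hball
  -- The cutoff makes this function globally smooth, so that Hadamard's lemma on the whole space
  -- applies.
  have hF : ContDiff ℝ ∞ fun v => χ v * (G v - G a) := by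
    rw [contDiff_iff_contDiffAt]
    intro v
    by_cases hv : v ∈ tsupport χ
    · exact χ.contDiff.contDiffAt.mul
        ((hG.contDiffAt (hΩ.mem_nhds (hsupp hv))).sub contDiffAt_const)
    · refine (contDiffAt_const (c := (0 : ℝ))).congr_of_eventuallyEq ?_
      filter_upwards [notMem_tsupport_iff_eventuallyEq.1 hv] with v' hv'
      rw [hv', Pi.zero_apply, zero_mul]
  have hρ : ContDiff ℝ ∞ fun v => (1 - χ v) / ‖v - a‖ ^ 2 := by
    rw [contDiff_iff_contDiffAt]
    intro v
    by_cases hv : v = a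
    · refine (contDiffAt_const (c := (0 : ℝ))).congr_of_eventuallyEq ?_
      rw [hv]
      filter_upwards [χ.eventuallyEq_one] with v' hv'
      rw [hv', Pi.one_apply, sub_self, zero_div]
    · refine (contDiffAt_const.sub χ.contDiff.contDiffAt).div ?_ ?_
      · exact ((contDiff_id.sub contDiff_const).norm_sq ℝ).contDiffAt
      · exact pow_ne_zero 2 (norm_ne_zero_iff.2 (sub_ne_zero.2 hv))
  obtain ⟨H, hH, hHF⟩ := _root_.exists_hadamard hF a
  -- The first summand accounts for `χ (G - G a)`. The second accounts for `(1 - χ) (G - G a)`,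
  -- because `∑ (v i - a i)² = ‖v - a‖²`; it is smooth at `a`, where `1 - χ` vanishes identically
  -- nearby.
  refine ⟨fun i => ofChart W
    (fun v => H i v + (v i - a i) * ((1 - χ v) / ‖v - a‖ ^ 2 * (G v - G a))) ?_, ?_⟩
  · refine (hH i).contDiffOn.add (ContDiffOn.mul (by fun_prop) (hρ.contDiffOn.mul ?_))
    exact hG.sub contDiffOn_const
  · refine ext_of_subset fun w => ?_
    have hsum : ((∑ i, (coord e W i - algebraMap ℝ (SmoothFn e W) (a i)) * ofChart W
        (fun v => H i v + (v i - a i) * ((1 - χ v) / ‖v - a‖ ^ 2 * (G v - G a))) (by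
          refine (hH i).contDiffOn.add (ContDiffOn.mul (by fun_prop) (hρ.contDiffOn.mul ?_))
          exact hG.sub contDiffOn_const) : SmoothFn e W)).1 w
        = ∑ i, (e w.1 i - a i) * (H i (e w.1) + (e w.1 i - a i) *
          ((1 - χ (e w.1)) / ‖e w.1 - a‖ ^ 2 * (G (e w.1) - G a))) := by
      rw [AddSubmonoidClass.coe_finsetSum, Finset.sum_apply]
      rfl
    refine Eq.trans ?_ (congrArg (g.1 m + ·) hsum.symm)
    have h1 := hHF (e w.1)
    have h2 : ∑ i, (e w.1 i - a i) * (e w.1 i - a i) = ‖e w.1 - a‖ ^ 2 := by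
      rw [EuclideanSpace.norm_sq_eq]
      refine Finset.sum_congr rfl fun i _ => ?_
      rw [Real.norm_eq_abs, sq_abs]
      simp [sq]
    simp only [mul_add, Finset.sum_add_distrib, ← mul_assoc]
    simp only [← Finset.sum_mul, h2]
    rw [sub_self, mul_zero, zero_add] at h1
    have hGm : g.1 m = G a := (hG' m).symm
    rw [← h1, ← hG' w, hGm]
    by_cases hw : e w.1 = a
    · rw [hw]
      simp [a]
    · have : ‖e w.1 - a‖ ^ 2 ≠ 0 := pow_ne_zero 2 (norm_ne_zero_iff.2 (sub_ne_zero.2 hw))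
      generalize ‖e w.1 - a‖ ^ 2 = N at this ⊢
      field_simp
      ring

end Hadamard

/-! ## The Berezin integral in a coordinate system -/

section Extend
open scoped ContDiff
open MeasureTheory

variable {X : Type u} [TopologicalSpace X] {p : ℕ}
  {e : OpenPartialHomeomorph X (EuclideanSpace ℝ (Fin p))} {W : Opens X}

namespace SmoothFn

/-- The expression of a smooth function in the chart, extended by zero. -/
def extend (g : SmoothFn e W) : EuclideanSpace ℝ (Fin p) → ℝ :=
  (chartImage e W).indicator (readFn e W g.1)

theorem extend_of_mem (g : SmoothFn e W) {v : EuclideanSpace ℝ (Fin p)}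
    (hv : v ∈ chartImage e W) : extend g v = g.1 ⟨e.symm v, hv.2⟩ := by
  rw [extend, Set.indicator_of_mem hv, readFn_eq e W _ hv.2]

theorem extend_of_notMem (g : SmoothFn e W) {v : EuclideanSpace ℝ (Fin p)}
    (hv : v ∉ chartImage e W) : extend g v = 0 := Set.indicator_of_notMem hv _

theorem extend_add (f g : SmoothFn e W) : extend (f + g) = extend f + extend g := by
  funext v
  by_cases hv : v ∈ chartImage e W
  · rw [Pi.add_apply, extend_of_mem _ hv, extend_of_mem _ hv, extend_of_mem _ hv]
    rfl
  · rw [Pi.add_apply, extend_of_notMem _ hv, extend_of_notMem _ hv, extend_of_notMem _ hv,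
      add_zero]

theorem extend_smul (r : ℝ) (g : SmoothFn e W) : extend (r • g) = r • extend g := by
  funext v
  by_cases hv : v ∈ chartImage e W
  · rw [Pi.smul_apply, extend_of_mem _ hv, extend_of_mem _ hv]
    rfl
  · rw [Pi.smul_apply, extend_of_notMem _ hv, extend_of_notMem _ hv, smul_zero]

theorem extend_contDiffOn (g : SmoothFn e W) : ContDiffOn ℝ ∞ (extend g) (chartImage e W) :=
  (show ContDiffOn ℝ ∞ (readFn e W g.1) (chartImage e W) from g.2).congr
    fun _ hv => Set.indicator_of_mem hv _

section Compact

variable {g : SmoothFn e W} {K : Set X} (hW : (W : Set X) ⊆ e.source) (hK : IsCompact K)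
  (hKW : K ⊆ W) (hg : ∀ w : W, w.1 ∉ K → g.1 w = 0)
include hg

theorem extend_eq_zero {v : EuclideanSpace ℝ (Fin p)} (hv : v ∉ e '' K) : extend g v = 0 := by
  by_cases h : v ∈ chartImage e W
  · rw [extend_of_mem _ h]
    refine hg _ fun hK' => hv ⟨_, hK', e.right_inv h.1⟩
  · exact extend_of_notMem _ h

include hW hK hKW

omit hg in
theorem isCompact_image : IsCompact (e '' K) :=
  hK.image_of_continuousOn (e.continuousOn.mono (hKW.trans hW))

/-- The image of `K` is compact, hence closed, so a point outside the chart image has a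
neighbourhood missing it. This makes the extension by zero smooth. -/
theorem extend_eventuallyEq_zero {v : EuclideanSpace ℝ (Fin p)} (hv : v ∉ chartImage e W) :
    extend g =ᶠ[nhds v] 0 := by
  have h1 : v ∉ e '' K := by
    rintro ⟨x, hx, rfl⟩
    exact hv (mem_chartImage (hW (hKW hx)) (hKW hx))
  filter_upwards [(isCompact_image hW hK hKW).isClosed.isOpen_compl.mem_nhds h1] with v' hv'
  exact extend_eq_zero hg hv'

theorem contDiff_extend : ContDiff ℝ ∞ (extend g) := by
  rw [contDiff_iff_contDiffAt]
  intro v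
  by_cases hv : v ∈ chartImage e W
  · exact (extend_contDiffOn g).contDiffAt ((isOpen_chartImage e W).mem_nhds hv)
  · exact (contDiffAt_const (c := (0 : ℝ))).congr_of_eventuallyEq
      (extend_eventuallyEq_zero hW hK hKW hg hv)

theorem hasCompactSupport_extend : HasCompactSupport (extend g) :=
  HasCompactSupport.intro (isCompact_image hW hK hKW) fun _ hv => extend_eq_zero hg hv

theorem integrable_extend : Integrable (extend g) :=
  (contDiff_extend hW hK hKW hg).continuous.integrable_of_hasCompactSupport
    (hasCompactSupport_extend hW hK hKW hg)

theorem extend_deriv (i : Fin p) :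
    extend (deriv i g) = fun v => fderiv ℝ (extend g) v (EuclideanSpace.single i 1) := by
  funext v
  by_cases hv : v ∈ chartImage e W
  · rw [extend_of_mem _ hv, deriv_apply, e.right_inv hv.1]
    congr 1
    refine Filter.EventuallyEq.fderiv_eq ?_
    filter_upwards [(isOpen_chartImage e W).mem_nhds hv] with v' hv'
    exact (Set.indicator_of_mem hv' _).symm
  · rw [extend_of_notMem _ hv, (extend_eventuallyEq_zero hW hK hKW hg hv).fderiv_eq]
    simp

theorem integral_extend_deriv (i : Fin p) : ∫ v, extend (deriv i g) v = 0 := by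
  have hF := contDiff_extend hW hK hKW hg
  have hs := hasCompactSupport_extend hW hK hKW hg
  rw [extend_deriv hW hK hKW hg]
  -- Integration by parts against the constant function 1.
  have h := integral_mul_fderiv_eq_neg_fderiv_mul_of_integrable (𝕜 := ℝ)
    (μ := (volume : Measure (EuclideanSpace ℝ (Fin p))))
    (f := fun _ => (1 : ℝ)) (g := extend g) (v := EuclideanSpace.single i 1)
    (by simp) ?_ ?_ (by fun_prop)
    (fun v _ => (hF.differentiable (by simp)).differentiableAt)
  · simpa using h
  · simp only [one_mul]
    refine Continuous.integrable_of_hasCompactSupport ?_ ?_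
    · have := (hF.fderiv_right (m := ∞) le_rfl).continuous
      fun_prop
    · exact (hs.fderiv ℝ).comp_left (g := fun L => L (EuclideanSpace.single i 1)) rfl
  · simpa using integrable_extend hW hK hKW hg

end Compact

/-- The fundamental lemma of the calculus of variations, followed by continuity to pass from almost
everywhere to everywhere. -/
theorem eq_zero_of_integral (hW : (W : Set X) ⊆ e.source) (g : SmoothFn e W)
    (h : ∀ (χ : SmoothFn e W) (K : Set X), IsCompact K → K ⊆ W →
      (∀ w : W, w.1 ∉ K → χ.1 w = 0) → ∫ v, extend (χ * g) v = 0) : g = 0 := by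
  have hΩ : IsOpen (chartImage e W) := isOpen_chartImage e W
  have hcont : ContinuousOn (extend g) (chartImage e W) := (extend_contDiffOn g).continuousOn
  have hae : ∀ᵐ v, v ∈ chartImage e W → extend g v = 0 := by
    refine hΩ.ae_eq_zero_of_integral_contDiff_smul_eq_zero
      (hcont.locallyIntegrableOn hΩ.measurableSet) fun χ hχ hχc hχs => ?_
    have hsub : ∀ v ∈ tsupport χ, v ∈ e.target := fun v hv => (hχs hv).1
    have h1 := h (ofChart W χ hχ.contDiffOn) (e.symm '' tsupport χ)
      (hχc.isCompact.image_of_continuousOn (e.symm.continuousOn.mono hsub)) ?_ ?_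
    · rw [← h1]
      congr 1
      funext v
      by_cases hv : v ∈ chartImage e W
      · rw [extend_of_mem _ hv, extend_of_mem _ hv]
        change _ = χ (e (e.symm v)) * _
        rw [e.right_inv hv.1, smul_eq_mul]
      · rw [extend_of_notMem _ hv, extend_of_notMem _ hv, smul_zero]
    · rintro _ ⟨v, hv, rfl⟩
      exact (hχs hv).2
    · intro w hw
      refine image_eq_zero_of_notMem_tsupport (f := χ) fun hw' => hw ?_
      exact ⟨e w.1, hw', e.left_inv (hW w.2)⟩
  have heq : Set.EqOn (extend g) (fun _ => 0) (chartImage e W) :=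
    Measure.eqOn_open_of_ae_eq ((ae_restrict_iff' hΩ.measurableSet).2 hae) hΩ hcont
      continuousOn_const
  refine ext_of_subset fun w => ?_
  have hw := mem_chartImage (hW w.2) w.2
  have := heq hw
  rw [extend_of_mem _ hw] at this
  refine Eq.trans ?_ this
  exact congrArg g.1 (Subtype.ext (e.left_inv (hW w.2)).symm)

end SmoothFn
end Extend

/-! ### Integration by parts and nondegeneracy for the Berezin integral -/

namespace SuperSpace
namespace Coord
open MeasureTheory

variable {M : SuperSpace.{u}} {p q : ℕ} (c : Coord M p q) {W : Opens M.carrier} (hW : W ≤ c.dom)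

/-- The Berezin integral of a superfunction with respect to the coordinates. -/
def integral (f : M.O W) : ℝ := ∫ v, SmoothFn.extend (c.coeff hW f Finset.univ) v

theorem integral_smul (r : ℝ) (f : M.O W) : c.integral hW (r • f) = r * c.integral hW f := by
  rw [integral, coeff_smul, Pi.smul_apply, SmoothFn.extend_smul]
  exact integral_const_mul _ _

theorem integral_neg (f : M.O W) : c.integral hW (-f) = -c.integral hW f := by
  simpa using c.integral_smul hW (-1) f

theorem integral_zero : c.integral hW (0 : M.O W) = 0 := by
  simpa using c.integral_smul hW 0 0

theorem integral_σ (f : M.O W) :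
    c.integral hW (M.σ W f) = (-1) ^ q * c.integral hW f := by
  rw [← integral_smul, integral, integral, coeff_σ, coeff_smul, Finset.card_univ,
    Fintype.card_fin]
  rfl

variable [T2Space M.carrier]

theorem exists_coeff_eq_zero {f : M.O W} (hf : HasCompactSupp f) :
    ∃ K : Set M.carrier, IsCompact K ∧ K ⊆ W ∧
      ∀ ν, ∀ w : W, w.1 ∉ K → (c.coeff hW f ν).1 w = 0 := by
  obtain ⟨K, hK, hKW, h0⟩ := hf
  refine ⟨K, hK, hKW, fun ν w hw => ?_⟩
  let V : Opens M.carrier := W ⊓ ⟨Kᶜ, hK.isClosed.isOpen_compl⟩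
  have hV : V ≤ W := inf_le_left
  have h1 := c.coeff_res hW hV f ν
  rw [h0 V hV (Set.disjoint_left.2 fun x hx => hx.2), coeff_zero] at h1
  exact (congrFun (congrArg Subtype.val h1) ⟨w.1, w.2, hw⟩).symm

theorem integral_add {f g : M.O W} (hf : HasCompactSupp f) (hg : HasCompactSupp g) :
    c.integral hW (f + g) = c.integral hW f + c.integral hW g := by
  obtain ⟨K, hK, hKW, h0⟩ := c.exists_coeff_eq_zero hW hf
  obtain ⟨K', hK', hKW', h0'⟩ := c.exists_coeff_eq_zero hW hg
  simp only [integral, coeff_add, Pi.add_apply, SmoothFn.extend_add]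
  exact MeasureTheory.integral_add (SmoothFn.integrable_extend hW hK hKW (h0 _))
    (SmoothFn.integrable_extend hW hK' hKW' (h0' _))

theorem integral_sum {ι : Type*} {s : Finset ι} {f : ι → M.O W}
    (hf : ∀ i ∈ s, HasCompactSupp (f i)) :
    c.integral hW (∑ i ∈ s, f i) = ∑ i ∈ s, c.integral hW (f i) := by
  classical
  induction s using Finset.induction_on with
  | empty => simpa using c.integral_zero hW
  | insert a s ha ih =>
    rw [Finset.sum_insert ha, Finset.sum_insert ha, c.integral_add hW (hf a (by simp)),
      ih fun i hi => hf i (by simp [hi])]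
    exact HasCompactSupp.sum fun i hi => hf i (by simp [hi])

/-- For even coordinates the derivative of a compactly supported function has integral zero; for odd
ones the derivative has no component on `ξ_1 ⋯ ξ_q`. -/
theorem integral_pd {f : M.O W} (hf : HasCompactSupp f) (k : Fin p ⊕ Fin q) :
    c.integral hW (c.pd hW k f) = 0 := by
  rcases k with i | j
  · obtain ⟨K, hK, hKW, h0⟩ := c.exists_coeff_eq_zero hW hf
    rw [integral, coeff_pd_inl]
    exact SmoothFn.integral_extend_deriv hW hK hKW (h0 _) i
  · have : c.integral hW (c.pd hW (.inr j) f) = c.integral hW (0 : M.O W) := by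
      rw [integral, integral, coeff_pd_inr, if_pos (Finset.mem_univ j), coeff_zero]
      rfl
    rw [this, integral_zero]

/-- Integration by parts. -/
theorem integral_mul_pd (f : M.O W) {g : M.O W} (hg : HasCompactSupp g) (k : Fin p ⊕ Fin q) :
    c.integral hW (f * c.pd hW k g)
      = c.integral hW (-c.pd hW k (M.twist W k f) * g) := by
  -- Twisting `f` beforehand cancels the sign of the Leibniz rule, so the second term is exactly `f`
  -- times the derivative of `g`.
  have h1 := c.integral_pd hW (hg.mul_left (M.twist W k f)) k
  rw [pd_mul, twist_twist, c.integral_add hW (hg.mul_left _) ((c.hasCompactSupp_pd hW hg k).mul_left _)] at h1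
  rw [neg_mul, integral_neg]
  linarith

omit [T2Space M.carrier] in
theorem hasCompactSupp_γ {χ : SmoothFn c.chart W} {K : Set M.carrier} (hK : IsCompact K)
    (hKW : K ⊆ W) (hχ : ∀ w : W, w.1 ∉ K → χ.1 w = 0) : HasCompactSupp (c.γ W hW χ) :=
  ⟨K, hK, hKW, fun _ h hV => c.res_γ_eq_zero hW hχ h hV⟩

omit [T2Space M.carrier] in
/-- The Berezin integral is a nondegenerate pairing. -/
theorem eq_zero_of_integral_mul {f : M.O W}
    (hf : ∀ g, HasCompactSupp g → c.integral hW (f * g) = 0) : f = 0 := by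
  -- Induction on the number of odd coordinates missing from `ν`. Test functions detect the top
  -- coefficient, and multiplication by `ξ_k` with `k ∉ ν` moves the coefficient at `ν` one step
  -- towards the top.
  have key : ∀ (n : ℕ) (ν : Finset (Fin q)), νᶜ.card = n → ∀ f : M.O W,
      (∀ g, HasCompactSupp g → c.integral hW (f * g) = 0) → c.coeff hW f ν = 0 := by
    intro n
    induction n with
    | zero =>
      intro ν hν f hf
      have : ν = Finset.univ := by simpa using hν
      subst this
      refine SmoothFn.eq_zero_of_integral hW _ fun χ K hK hKW hχ => ?_
      have h1 := hf _ (c.hasCompactSupp_γ hW hK hKW hχ)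
      rwa [← c.γ_comm, integral, coeff_γ_mul] at h1
    | succ n ih =>
      intro ν hν f hf
      obtain ⟨k, hk⟩ : νᶜ.Nonempty := Finset.card_pos.1 (by omega)
      have hkν : k ∉ ν := by simpa using hk
      have h1 := ih (insert k ν) (by
        rw [Finset.compl_insert, Finset.card_erase_of_mem hk]; omega) (c.odd hW k * f) ?_
      · rw [coeff_odd_mul, if_pos (Finset.mem_insert_self k ν),
          Finset.erase_insert hkν] at h1
        exact (smul_eq_zero.1 h1).resolve_left (pow_ne_zero _ (by norm_num))
      · intro g hg
        -- The factor `ξ_k` moves to the right of `f`, into the test function; the parity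
        -- automorphism that appears changes the integral only by a sign.
        rw [M.odd_mul (c.σ_odd hW k)]
        have h2 := hf (M.σ W (c.odd hW k * g)) (hg.mul_left _).σ
        have h3 : M.σ W f * c.odd hW k * g
            = M.σ W (f * M.σ W (c.odd hW k * g)) := by
          rw [map_mul, M.σ_σ, mul_assoc]
        rw [h3, integral_σ, h2, mul_zero]
  apply c.coeff_injective hW
  rw [coeff_zero]
  funext ν
  exact key _ ν rfl f hf

end Coord
end SuperSpace

/-! ## Derivatives of determinants -/

section Det

theorem Derivation.map_prod {A E R ι : Type*} [CommRing A] [CommRing E] [Algebra A E]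
    [AddCommGroup R] [Module A R] [Module E R] [DecidableEq ι]
    (D : Derivation A E R) (s : Finset ι) (f : ι → E) :
    D (∏ i ∈ s, f i) = ∑ i ∈ s, (∏ j ∈ s.erase i, f j) • D (f i) := by
  induction s using Finset.induction_on with
  | empty => simp
  | insert a s ha ih =>
    rw [Finset.prod_insert ha, D.leibniz, ih, Finset.sum_insert ha, Finset.erase_insert ha,
      Finset.smul_sum, add_comm]
    congr 1
    refine Finset.sum_congr rfl fun i hi => ?_
    have hia : a ≠ i := fun h => ha (h ▸ hi)
    rw [Finset.erase_insert_of_ne hia, Finset.prod_insert (by simp [ha]), mul_smul]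

/-- The cofactors in the shape in which they arise when the Leibniz formula for the determinant is
differentiated factor by factor. -/
theorem Matrix.adjugate_eq_sum {E : Type*} [CommRing E] {n : Type*} [Fintype n] [DecidableEq n]
    (X : Matrix n n E) (i r : n) :
    X.adjugate i r = ∑ τ : Equiv.Perm n, if τ i = r then
      Equiv.Perm.sign τ • ∏ j ∈ Finset.univ.erase i, X (τ j) j else 0 := by
  rw [Matrix.adjugate_apply, Matrix.det_apply]
  refine Finset.sum_congr rfl fun τ _ => ?_
  split_ifs with h
  · congr 1
    rw [← Finset.mul_prod_erase _ _ (Finset.mem_univ i), h, Matrix.updateRow_self,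
      Pi.single_eq_same, one_mul]
    refine Finset.prod_congr rfl fun j hj => ?_
    rw [Matrix.updateRow_ne]
    rw [← h]
    exact fun hτ => (Finset.mem_erase.1 hj).1 (τ.injective hτ)
  · rw [Finset.prod_eq_zero (Finset.mem_univ (τ.symm r)), smul_zero]
    rw [τ.apply_symm_apply, Matrix.updateRow_self, Pi.single_eq_of_ne]
    rintro rfl
    exact h (τ.apply_symm_apply r)

/-- Jacobi's formula for derivations. -/
theorem Derivation.map_det {A E R : Type*} [CommRing A] [CommRing E] [Algebra A E]
    [AddCommGroup R] [Module A R] [Module E R]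
    {n : Type*} [Fintype n] [DecidableEq n] (D : Derivation A E R) {X Y : Matrix n n E}
    (hYX : Y * X = 1) : D X.det = X.det • ∑ i, ∑ r, Y i r • D (X r i) := by
  have hadj : X.adjugate = X.det • Y := by
    have h1 : X * Y = 1 := mul_eq_one_comm.1 hYX
    calc X.adjugate = X.adjugate * (X * Y) := by rw [h1, mul_one]
      _ = X.det • Y := by rw [← mul_assoc, Matrix.adjugate_mul, Matrix.smul_mul, one_mul]
  have h2 : X.det • ∑ i, ∑ r, Y i r • D (X r i) = ∑ i, ∑ r, X.adjugate i r • D (X r i) := by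
    simp only [hadj, Finset.smul_sum, Matrix.smul_apply, smul_assoc]
  rw [h2, Matrix.det_apply, map_sum]
  have h3 : ∀ τ : Equiv.Perm n, D (Equiv.Perm.sign τ • ∏ i, X (τ i) i)
      = ∑ i, ∑ r, (if τ i = r then
      Equiv.Perm.sign τ • ∏ j ∈ Finset.univ.erase i, X (τ j) j else 0) • D (X r i) := by
    intro τ
    have h4 : D (Equiv.Perm.sign τ • ∏ i, X (τ i) i)
        = Equiv.Perm.sign τ • D (∏ i, X (τ i) i) := by
      rcases Int.units_eq_one_or (Equiv.Perm.sign τ) with h | h <;> simp [h]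
    rw [h4, D.map_prod, Finset.smul_sum]
    refine Finset.sum_congr rfl fun i _ => ?_
    simp only [ite_smul, zero_smul, Finset.sum_ite_eq, Finset.mem_univ, if_true]
    rcases Int.units_eq_one_or (Equiv.Perm.sign τ) with h | h <;> simp [h]
  simp only [h3, Matrix.adjugate_eq_sum, Finset.sum_smul]
  rw [Finset.sum_comm]
  refine Finset.sum_congr rfl fun i _ => ?_
  rw [Finset.sum_comm]

/-- Modulo the nilradical the matrix is 1, so its determinant is 1 plus a nilpotent element. -/
theorem Matrix.isUnit_det_one_sub {E : Type*} [CommRing E] {n : Type*} [Fintype n]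
    [DecidableEq n] {Z : Matrix n n E} (hZ : ∀ i j, IsNilpotent (Z i j)) :
    IsUnit (1 - Z).det := by
  let π := Ideal.Quotient.mk (nilradical E)
  have h1 : (1 - Z).map π = 1 := by
    ext i j
    have : π (Z i j) = 0 := Ideal.Quotient.eq_zero_iff_mem.2 (hZ i j)
    rw [Matrix.map_apply, Matrix.sub_apply, map_sub, this, sub_zero, Matrix.one_apply,
      Matrix.one_apply]
    split_ifs <;> simp
  have h2 : π ((1 - Z).det - 1) = 0 := by
    rw [map_sub, RingHom.map_det, RingHom.mapMatrix_apply, h1, Matrix.det_one, map_one, sub_self]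
  have h3 : IsNilpotent ((1 - Z).det - 1) := Ideal.Quotient.eq_zero_iff_mem.1 h2
  simpa using h3.isUnit_add_one

end Det

/-! ### Determinants and traces over even superfunctions -/

namespace SuperSpace

variable (M : SuperSpace.{u}) (W : Opens M.carrier)

/-- The commutative algebra of even superfunctions. -/
def even : Subalgebra ℝ (M.O W) := AlgHom.equalizer (M.σ W) (AlgHom.id ℝ _)

/-- Commutativity opens the way to determinants, inverse matrices and the nilradical for matrices
with even entries. -/
instance : CommRing (M.even W) :=
  { (inferInstance : Ring (M.even W)) with
    mul_comm := fun a b => Subtype.ext (M.even_comm W a.1 b.1 a.2) }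

variable {M W}

theorem ringDet_map_val {n : ℕ} (X : Matrix (Fin n) (Fin n) (M.even W)) :
    ringDet (X.map Subtype.val) = (X.det).1 := by
  rw [ringDet, Matrix.det_apply, AddSubmonoidClass.coe_finsetSum]
  refine Finset.sum_congr rfl fun τ _ => ?_
  have h : (List.ofFn fun i => (X.map Subtype.val) (τ i) i).prod
      = ((∏ i, X (τ i) i : M.even W)).1 := by
    rw [← List.prod_ofFn]
    change _ = (M.even W).val _
    rw [map_list_prod, List.map_ofFn]
    rfl
  rw [h]
  rcases Int.units_eq_one_or (Equiv.Perm.sign τ) with h | h <;> simp [h]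

section Matrix

variable {m n l : Type*} [Fintype m] [Fintype n] [Fintype l]

/-- Lift of a matrix with even entries. -/
def liftEven (X : Matrix m n (M.O W)) (hX : X.map (M.σ W) = X) : Matrix m n (M.even W) :=
  Matrix.of fun i j => ⟨X i j, congrFun (congrFun hX i) j⟩

omit [Fintype l] [Fintype n] in
theorem map_val_mul (X : Matrix l m (M.even W)) (Y : Matrix m n (M.even W)) :
    (X * Y).map Subtype.val = X.map Subtype.val * Y.map Subtype.val :=
  Matrix.map_mul (f := (M.even W).val.toRingHom)

omit [Fintype m] [Fintype n] in
theorem map_val_injective : Function.Injective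
    (fun X : Matrix m n (M.even W) => X.map Subtype.val) :=
  Matrix.map_injective Subtype.val_injective

theorem trace_mul_comm_even {X : Matrix m n (M.O W)} (hX : X.map (M.σ W) = X)
    (Y : Matrix n m (M.O W)) : (X * Y).trace = (Y * X).trace := by
  simp only [Matrix.trace, Matrix.diag, Matrix.mul_apply]
  rw [Finset.sum_comm]
  refine Finset.sum_congr rfl fun j _ => Finset.sum_congr rfl fun i _ => ?_
  exact M.even_comm W _ _ (congrFun (congrFun hX i) j)

variable {D : M.O W →ₗ[ℝ] M.O W} (hD : ∀ f g, D (f * g) = D f * g + M.σ W f * D g)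
include hD

omit [Fintype l] [Fintype n] in
theorem map_mul_derivation (X : Matrix l m (M.O W)) (Y : Matrix m n (M.O W)) :
    (X * Y).map D = X.map D * Y + X.map (M.σ W) * Y.map D := by
  ext i j
  simp only [Matrix.map_apply, Matrix.mul_apply, map_sum, hD, Matrix.add_apply,
    Finset.sum_add_distrib]

/-- On the even subalgebra the signed Leibniz rule has no sign, so `D` becomes an ordinary
derivation with values in the module of all superfunctions, and Jacobi's formula applies. -/
theorem derivation_det {n : ℕ} {X Y : Matrix (Fin n) (Fin n) (M.O W)}
    (hX : X.map (M.σ W) = X) (hY : Y.map (M.σ W) = Y) (hYX : Y * X = 1) :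
    D (ringDet X) = ringDet X * (Y * X.map D).trace := by
  let D' : Derivation ℝ (M.even W) (M.O W) := Derivation.mk' (D ∘ₗ (M.even W).val.toLinearMap)
    (by
      intro a b
      have h1 : M.σ W a.1 = a.1 := a.2
      have h2 : D a.1 * b.1 = b.1 * D a.1 := (M.even_comm W _ _ b.2).symm
      have := hD a.1 b.1
      rw [h1, h2, add_comm] at this
      exact this)
  have h := D'.map_det (X := liftEven X hX) (Y := liftEven Y hY)
    (map_val_injective ((map_val_mul _ _).trans (hYX.trans (by
      ext i j
      simp only [Matrix.map_apply, Matrix.one_apply]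
      split_ifs <;> rfl))))
  have e1 : ringDet X = ((liftEven X hX).det).1 := ringDet_map_val (liftEven X hX)
  rw [e1]
  refine Eq.trans h ?_
  change _ * _ = _
  congr 1

end Matrix

/-- Even supermatrices. -/
structure IsEvenSupermatrix {p q : ℕ} (J : Matrix (Fin p ⊕ Fin q) (Fin p ⊕ Fin q) (M.O W)) :
    Prop where
  map₁₁ : J.toBlocks₁₁.map (M.σ W) = J.toBlocks₁₁
  map₁₂ : J.toBlocks₁₂.map (M.σ W) = -J.toBlocks₁₂
  map₂₁ : J.toBlocks₂₁.map (M.σ W) = -J.toBlocks₂₁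
  map₂₂ : J.toBlocks₂₂.map (M.σ W) = J.toBlocks₂₂

/-! ### Invertible even supermatrices and the Berezinian -/

section Berezinian

variable {p q : ℕ} {J K : Matrix (Fin p ⊕ Fin q) (Fin p ⊕ Fin q) (M.O W)}

theorem map_σ_mul {l m n : Type*} [Fintype m] (X : Matrix l m (M.O W)) (Y : Matrix m n (M.O W)) :
    (X * Y).map (M.σ W) = X.map (M.σ W) * Y.map (M.σ W) :=
  Matrix.map_mul (f := (M.σ W).toRingHom)

theorem blocks_of_mul_eq_one (h : J * K = 1) :
    J.toBlocks₁₁ * K.toBlocks₁₁ + J.toBlocks₁₂ * K.toBlocks₂₁ = 1 ∧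
    J.toBlocks₁₁ * K.toBlocks₁₂ + J.toBlocks₁₂ * K.toBlocks₂₂ = 0 ∧
    J.toBlocks₂₁ * K.toBlocks₁₁ + J.toBlocks₂₂ * K.toBlocks₂₁ = 0 ∧
    J.toBlocks₂₁ * K.toBlocks₁₂ + J.toBlocks₂₂ * K.toBlocks₂₂ = 1 := by
  rw [← Matrix.fromBlocks_toBlocks J, ← Matrix.fromBlocks_toBlocks K, Matrix.fromBlocks_multiply,
    ← Matrix.fromBlocks_one, Matrix.fromBlocks_inj] at h
  simpa using h

/-- The odd-odd block of an invertible even supermatrix is invertible. -/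
theorem isUnit_toBlocks₂₂ (hJ : IsEvenSupermatrix J) (hK : IsEvenSupermatrix K)
    (hJK : J * K = 1) :
    ∃ U : Matrix (Fin q) (Fin q) (M.O W), U.map (M.σ W) = U ∧ J.toBlocks₂₂ * U = 1 ∧
      U * J.toBlocks₂₂ = 1 := by
  have h := (blocks_of_mul_eq_one hJK).2.2.2
  set T := J.toBlocks₂₁
  set V := J.toBlocks₂₂
  have hZ : (T * K.toBlocks₁₂).map (M.σ W) = T * K.toBlocks₁₂ := by
    rw [map_σ_mul, hJ.map₂₁, hK.map₁₂, Matrix.neg_mul, Matrix.mul_neg, neg_neg]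
  -- The lower right block of `J K = 1` reads `V K₂₂ = 1 - T K₁₂`.
  have h1 : liftEven V hJ.map₂₂ * liftEven K.toBlocks₂₂ hK.map₂₂
      = 1 - liftEven _ hZ := by
    apply map_val_injective
    refine (map_val_mul _ _).trans ?_
    change V * K.toBlocks₂₂ = _
    rw [eq_sub_of_add_eq' h]
    ext i j
    simp only [Matrix.map_apply, Matrix.sub_apply, Matrix.one_apply]
    split_ifs <;> rfl
  -- Each entry is a sum of products of two odd elements; such a product is even and has square
  -- zero.
  have hnil : ∀ i j, IsNilpotent (liftEven _ hZ i j) := by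
    intro i j
    have hodd : ∀ k, M.σ W (T i k) = -T i k := fun k => congrFun (congrFun hJ.map₂₁ i) k
    have hodd' : ∀ k, M.σ W (K.toBlocks₁₂ k j) = -K.toBlocks₁₂ k j :=
      fun k => congrFun (congrFun hK.map₁₂ k) j
    let t : Fin p → M.even W := fun k => ⟨T i k * K.toBlocks₁₂ k j, by
      change M.σ W _ = _
      rw [map_mul, hodd, hodd', neg_mul_neg]; rfl⟩
    have ht : liftEven _ hZ i j = ∑ k, t k := Subtype.ext (by
      rw [AddSubmonoidClass.coe_finsetSum]; rfl)
    rw [ht]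
    refine Ideal.sum_mem (nilradical (M.even W)) fun k _ => ⟨2, Subtype.ext ?_⟩
    change (T i k * K.toBlocks₁₂ k j) ^ 2 = 0
    rw [sq, mul_assoc, ← mul_assoc _ (T i k), M.odd_anticomm W _ _ (hodd' k) (hodd k), neg_mul,
      mul_neg, mul_assoc (T i k), ← mul_assoc (T i k) (T i k), M.odd_mul_self (hodd k), zero_mul,
      neg_zero]
  have hdet : IsUnit (liftEven V hJ.map₂₂).det := by
    have := Matrix.isUnit_det_one_sub hnil
    rw [← h1, Matrix.det_mul] at this
    exact isUnit_of_mul_isUnit_left this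
  have hone : (1 : Matrix (Fin q) (Fin q) (M.even W)).map Subtype.val
      = (1 : Matrix (Fin q) (Fin q) (M.O W)) := by
    ext i j
    simp only [Matrix.map_apply, Matrix.one_apply]
    split_ifs <;> rfl
  refine ⟨(liftEven V hJ.map₂₂)⁻¹.map Subtype.val, ?_, ?_, ?_⟩
  · ext i j
    exact ((liftEven V hJ.map₂₂)⁻¹ i j).2
  · rw [← hone, ← Matrix.mul_nonsing_inv _ hdet, map_val_mul]
    rfl
  · rw [← hone, ← Matrix.nonsing_inv_mul _ hdet, map_val_mul]
    rfl

theorem ringDet_mul_even {n : ℕ} {X Y : Matrix (Fin n) (Fin n) (M.O W)}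
    (hX : X.map (M.σ W) = X) (hY : Y.map (M.σ W) = Y) :
    ringDet (X * Y) = ringDet X * ringDet Y := by
  have h := ringDet_map_val (liftEven X hX * liftEven Y hY)
  rw [map_val_mul, Matrix.det_mul] at h
  refine h.trans ?_
  change (liftEven X hX).det.1 * (liftEven Y hY).det.1 = _
  rw [← ringDet_map_val, ← ringDet_map_val]
  rfl

theorem ringDet_one {n : ℕ} : ringDet (1 : Matrix (Fin n) (Fin n) (M.O W)) = 1 := by
  have h := ringDet_map_val (1 : Matrix (Fin n) (Fin n) (M.even W))
  rw [Matrix.det_one] at h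
  refine Eq.trans ?_ h
  congr 1
  ext i j
  simp only [Matrix.map_apply, Matrix.one_apply]
  split_ifs <;> rfl

theorem σ_ringDet {n : ℕ} {X : Matrix (Fin n) (Fin n) (M.O W)} (hX : X.map (M.σ W) = X) :
    M.σ W (ringDet X) = ringDet X := by
  have h : ringDet X = _ := ringDet_map_val (liftEven X hX)
  rw [h]
  exact (liftEven X hX).det.2

theorem schur_even (hJ : IsEvenSupermatrix J) {U : Matrix (Fin q) (Fin q) (M.O W)}
    (hU : U.map (M.σ W) = U) :
    (J.toBlocks₁₁ - J.toBlocks₁₂ * U * J.toBlocks₂₁).map (M.σ W)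
      = J.toBlocks₁₁ - J.toBlocks₁₂ * U * J.toBlocks₂₁ := by
  rw [Matrix.map_sub _ (map_sub _), map_σ_mul, map_σ_mul, hJ.map₁₁, hJ.map₁₂, hJ.map₂₁, hU,
    Matrix.neg_mul, Matrix.mul_neg, Matrix.neg_mul, neg_neg]

theorem berezinian_eq {U : Matrix (Fin q) (Fin q) (M.O W)}
    (hVU : J.toBlocks₂₂ * U = 1) (hUV : U * J.toBlocks₂₂ = 1) :
    berezinian J = ringDet (J.toBlocks₁₁ - J.toBlocks₁₂ * U * J.toBlocks₂₁) * ringDet U := by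
  have : Ring.inverse J.toBlocks₂₂ = U :=
    Ring.inverse_unit (⟨J.toBlocks₂₂, U, hVU, hUV⟩ : (Matrix (Fin q) (Fin q) (M.O W))ˣ)
  rw [berezinian, this]

theorem σ_berezinian (hJ : IsEvenSupermatrix J) (hK : IsEvenSupermatrix K) (hJK : J * K = 1) :
    M.σ W (berezinian J) = berezinian J := by
  obtain ⟨U, hU, hVU, hUV⟩ := isUnit_toBlocks₂₂ hJ hK hJK
  rw [berezinian_eq hVU hUV, map_mul, σ_ringDet hU, σ_ringDet (schur_even hJ hU)]

/-- The logarithmic derivative of the Berezinian along an odd derivation. -/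
theorem derivation_berezinian {D : M.O W →ₗ[ℝ] M.O W}
    (hD : ∀ f g, D (f * g) = D f * g + M.σ W f * D g) (hDσ : ∀ f, D (M.σ W f) = -M.σ W (D f))
    (hJ : IsEvenSupermatrix J) (hK : IsEvenSupermatrix K) (hJK : J * K = 1) (hKJ : K * J = 1) :
    D (berezinian J) = berezinian J *
      ((K.toBlocks₁₁ * J.toBlocks₁₁.map D).trace - (K.toBlocks₁₂ * J.toBlocks₂₁.map D).trace
        + (K.toBlocks₂₁ * J.toBlocks₁₂.map D).trace
        - (K.toBlocks₂₂ * J.toBlocks₂₂.map D).trace) := by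
  obtain ⟨U, hU, hVU, hUV⟩ := isUnit_toBlocks₂₂ hJ hK hJK
  obtain ⟨-, -, e3, e4⟩ := blocks_of_mul_eq_one hJK
  obtain ⟨f1, f2, -, -⟩ := blocks_of_mul_eq_one hKJ
  have hNe := schur_even hJ hU
  rw [berezinian_eq hVU hUV]
  obtain ⟨j11, j12, j21, j22⟩ := hJ
  set A := J.toBlocks₁₁
  set S := J.toBlocks₁₂
  set T := J.toBlocks₂₁
  set V := J.toBlocks₂₂
  set K₁ := K.toBlocks₁₁
  -- Block inversion: the blocks of `K` are expressed through `U = V⁻¹` and `K₁`, which is the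
  -- inverse of the Schur complement `A - S U T`.
  have hK12 : K.toBlocks₁₂ = -(K₁ * S * U) := by
    have h := congrArg (fun X => X * U) f2
    simp only [Matrix.add_mul, Matrix.zero_mul] at h
    rw [Matrix.mul_assoc K.toBlocks₁₂, hVU, Matrix.mul_one] at h
    exact eq_neg_of_add_eq_zero_right h
  have hK21 : K.toBlocks₂₁ = -(U * T * K₁) := by
    have h := congrArg (fun X => U * X) e3
    simp only [Matrix.mul_add, Matrix.mul_zero] at h
    rw [← Matrix.mul_assoc U V, hUV, Matrix.one_mul, ← Matrix.mul_assoc] at h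
    exact eq_neg_of_add_eq_zero_right h
  have hK22 : K.toBlocks₂₂ = U + U * T * K₁ * S * U := by
    have h := congrArg (fun X => U * X) e4
    simp only [Matrix.mul_add, Matrix.mul_one] at h
    rw [← Matrix.mul_assoc U V, hUV, Matrix.one_mul, hK12] at h
    rw [eq_sub_of_add_eq' h]
    simp only [Matrix.mul_neg, Matrix.mul_assoc, sub_neg_eq_add]
  have hK1N : K₁ * (A - S * U * T) = 1 := by
    rw [← f1, hK12]
    simp only [Matrix.mul_sub, Matrix.neg_mul, Matrix.mul_assoc]
    abel
  have hDU : U.map D = -(U * V.map D * U) := by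
    have h := map_mul_derivation hD U V
    rw [hUV, hU] at h
    have h0 : (1 : Matrix (Fin q) (Fin q) (M.O W)).map D = 0 := by
      have hD1 : D 1 = 0 := by
        have := hD 1 1
        simpa using this
      ext i j
      simp only [Matrix.map_apply, Matrix.one_apply, Matrix.zero_apply]
      split_ifs <;> simp [hD1]
    rw [h0] at h
    have h' := congrArg (fun X => X * U) h
    simp only [Matrix.add_mul, Matrix.zero_mul] at h'
    rw [Matrix.mul_assoc (U.map D), hVU, Matrix.mul_one] at h'
    exact eq_neg_of_add_eq_zero_left h'.symm
  have hDN : (A - S * U * T).map D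
      = A.map D - S.map D * (U * T) - S * U * V.map D * (U * T) + S * U * T.map D := by
    rw [Matrix.map_sub _ (map_sub _), map_mul_derivation hD, map_mul_derivation hD, map_σ_mul,
      j12, hU, hDU]
    simp only [Matrix.neg_mul, Matrix.mul_neg, Matrix.add_mul, Matrix.mul_assoc]
    abel
  have hσD : ∀ {m n : Type} (X : Matrix m n (M.O W)),
      (X.map D).map (M.σ W) = -((X.map (M.σ W)).map D) := by
    intro m n X
    ext i j
    simp only [Matrix.map_apply, Matrix.neg_apply]
    rw [hDσ, neg_neg]
  -- Cyclicity of the trace is available only if one factor has even entries. Here `D` is odd and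
  -- `S` is odd, so `S.map D` is even.
  have t1 : (K₁ * S.map D * (U * T)).trace = (U * T * (K₁ * S.map D)).trace := by
    refine trace_mul_comm_even ?_ _
    rw [map_σ_mul, hK.map₁₁, hσD, j12, Matrix.map_neg _ (map_neg D), neg_neg]
  have t2 : (K₁ * S * U * V.map D * (U * T)).trace
      = (U * T * (K₁ * S * U * V.map D)).trace := by
    refine trace_mul_comm_even ?_ _
    rw [map_σ_mul, map_σ_mul, map_σ_mul, hK.map₁₁, hσD, j12, j22, hU]
    simp [K₁]
  have t3 : (V * U.map D).trace = -(U * V.map D).trace := by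
    rw [hDU, Matrix.mul_neg, Matrix.trace_neg, ← Matrix.mul_assoc, ← Matrix.mul_assoc, hVU, Matrix.one_mul,
      trace_mul_comm_even hU]
  -- Leibniz for `det(A - S U T) det U`, with the logarithmic derivative of each factor; the trace
  -- identities then match the result with the blocks of `K`.
  rw [hD, σ_ringDet hNe, derivation_det hD hNe hK.map₁₁ hK1N,
    derivation_det hD hU j22 hVU, t3, mul_assoc (ringDet (A - S * U * T)),
    M.even_comm W (ringDet U) _ (σ_ringDet hU) |>.symm, ← mul_assoc, ← mul_assoc, ← mul_add]
  congr 1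
  rw [hDN, hK12, hK21, hK22]
  simp only [Matrix.mul_add, Matrix.mul_sub, Matrix.add_mul, Matrix.neg_mul, Matrix.trace_add, Matrix.trace_sub,
    Matrix.trace_neg]
  simp only [← Matrix.mul_assoc] at t1 t2 ⊢
  rw [t1, t2]
  abel

end Berezinian

end SuperSpace

namespace SuperSpace
namespace Coord

variable {M : SuperSpace.{u}} {p q : ℕ} (c : Coord M p q) {W : Opens M.carrier} (hW : W ≤ c.dom)

/-! ## Coordinates and Jacobian matrices -/

theorem res_x_inl (i : Fin p) :
    M.res hW (c.x (.inl i)) = c.γ W hW (SmoothFn.coord c.chart W i) :=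
  c.res_γ le_rfl hW _

theorem res_x_inr (j : Fin q) : M.res hW (c.x (.inr j)) = c.odd hW j := rfl

theorem pd_res_x (k l : Fin p ⊕ Fin q) :
    c.pd hW k (M.res hW (c.x l)) = if k = l then 1 else 0 := by
  rcases l with i | j
  · rw [res_x_inl]
    rcases k with i' | j'
    · rw [pd_γ_inl, SmoothFn.deriv_coord hW]
      simp only [Sum.inl.injEq]
      split_ifs <;> simp
    · rw [pd_γ_inr]
      simp
  · rw [res_x_inr]
    rcases k with i' | j'
    · rw [pd_odd_inl]
      simp
    · rw [pd_odd_inr]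
      simp only [Sum.inr.injEq]

theorem σ_res_x_inl (i : Fin p) : M.σ W (M.res hW (c.x (.inl i))) = M.res hW (c.x (.inl i)) := by
  rw [res_x_inl, σ_γ]

theorem σ_res_x_inr (j : Fin q) :
    M.σ W (M.res hW (c.x (.inr j))) = -M.res hW (c.x (.inr j)) := c.σ_odd hW j

/-- The Jacobian matrix `∂ψ(x)/∂x` of an endomorphism `ψ`. -/
def jac (ψ : M.O W →ₐ[ℝ] M.O W) : Matrix (Fin p ⊕ Fin q) (Fin p ⊕ Fin q) (M.O W) :=
  Matrix.of fun k l => c.pd hW k (ψ (M.res hW (c.x l)))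

theorem jac_apply (ψ : M.O W →ₐ[ℝ] M.O W) (k l : Fin p ⊕ Fin q) :
    c.jac hW ψ k l = c.pd hW k (ψ (M.res hW (c.x l))) := rfl

section Parity

variable {hW} {ψ : M.O W →ₐ[ℝ] M.O W} (hσ : ∀ f, ψ (M.σ W f) = M.σ W (ψ f))
include hσ

theorem isEvenSupermatrix_jac : IsEvenSupermatrix (c.jac hW ψ) where
  map₁₁ := by
    ext i j
    change M.σ W (c.pd hW (.inl i) (ψ _)) = c.pd hW (.inl i) (ψ _)
    rw [← pd_inl_σ, ← hσ, σ_res_x_inl]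
  map₁₂ := by
    ext i j
    change M.σ W (c.pd hW (.inl i) (ψ _)) = -c.pd hW (.inl i) (ψ _)
    rw [← pd_inl_σ, ← hσ, σ_res_x_inr, map_neg, pd_neg]
  map₂₁ := by
    ext i j
    change M.σ W (c.pd hW (.inr i) (ψ _)) = -c.pd hW (.inr i) (ψ _)
    rw [eq_neg_iff_add_eq_zero, ← neg_eq_iff_add_eq_zero, ← pd_inr_σ, ← hσ, σ_res_x_inl]
  map₂₂ := by
    ext i j
    change M.σ W (c.pd hW (.inr i) (ψ _)) = c.pd hW (.inr i) (ψ _)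
    rw [← neg_inj, ← pd_inr_σ, ← hσ, σ_res_x_inr, map_neg, pd_neg]

/-- The entry `(k, l)` has parity `|x_k| + |x_l|`. -/
theorem jac_mul (k l : Fin p ⊕ Fin q) (h : M.O W) :
    c.jac hW ψ k l * h = M.twist W k (M.twist W l h) * c.jac hW ψ k l := by
  have hJ := c.isEvenSupermatrix_jac (hW := hW) hσ
  rcases k with i | i <;> rcases l with j | j
  · exact M.even_comm W _ _ (congrFun (congrFun hJ.map₁₁ i) j)
  · exact M.odd_mul (congrFun (congrFun hJ.map₁₂ i) j) h
  · exact M.odd_mul (congrFun (congrFun hJ.map₂₁ i) j) h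
  · rw [twist_inr, twist_inr, M.σ_σ]
    exact M.even_comm W _ _ (congrFun (congrFun hJ.map₂₂ i) j)

variable (hbody : ∀ f, c.bodyHom hW (ψ f) = c.bodyHom hW f)
include hbody

/-! ### The chain rule -/

/-- The difference `D` of the two sides is a derivation along `ψ ∘ γ` that kills constants and
coordinates. Hadamard's lemma shows that it vanishes at each point to every order in the odd
filtration. -/
theorem chain_rule_γ (k : Fin p ⊕ Fin q) (g : SmoothFn c.chart W) :
    c.pd hW k (ψ (c.γ W hW g)) =
      ∑ i, c.jac hW ψ k (.inl i) * ψ (c.γ W hW (SmoothFn.deriv i g)) := by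
  have hev : ∀ a, M.σ W (ψ (c.γ W hW a)) = ψ (c.γ W hW a) := fun a => by rw [← hσ, σ_γ]
  have htw : ∀ a, M.twist W k (ψ (c.γ W hW a)) = ψ (c.γ W hW a) := fun a => by
    rcases k with i | j
    · rfl
    · exact hev a
  let D : SmoothFn c.chart W → M.O W := fun g => c.pd hW k (ψ (c.γ W hW g)) -
    ∑ i, c.jac hW ψ k (.inl i) * ψ (c.γ W hW (SmoothFn.deriv i g))
  have hadd : ∀ a b, D (a + b) = D a + D b := fun a b => by
    simp only [D, map_add, pd_add, SmoothFn.deriv_add hW, mul_add, Finset.sum_add_distrib]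
    abel
  have hmul : ∀ a b, D (a * b) = D a * ψ (c.γ W hW b) + ψ (c.γ W hW a) * D b := fun a b => by
    have h1 : ∀ i, c.jac hW ψ k (.inl i) * ψ (c.γ W hW (SmoothFn.deriv i (a * b)))
        = c.jac hW ψ k (.inl i) * ψ (c.γ W hW (SmoothFn.deriv i a)) * ψ (c.γ W hW b)
          + ψ (c.γ W hW a) * (c.jac hW ψ k (.inl i) * ψ (c.γ W hW (SmoothFn.deriv i b))) := by
      intro i
      rw [SmoothFn.deriv_mul hW, map_add, map_add, map_mul, map_mul, map_mul, map_mul, mul_add,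
        mul_assoc, ← mul_assoc (ψ (c.γ W hW a)), M.even_comm W _ (c.jac hW ψ k (.inl i)) (hev a),
        mul_assoc]
    simp only [D, h1, map_mul, pd_mul, htw, Finset.sum_add_distrib, ← Finset.sum_mul,
      ← Finset.mul_sum, sub_mul, mul_sub]
    abel
  have hconst : ∀ r : ℝ, D (algebraMap ℝ _ r) = 0 := fun r => by
    simp only [D, AlgHom.commutes, SmoothFn.deriv_algebraMap hW, map_zero, mul_zero,
      Finset.sum_const_zero, sub_zero]
    rw [Algebra.algebraMap_eq_smul_one, pd_smul, pd_one, smul_zero]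
  have hcoord : ∀ i, D (SmoothFn.coord c.chart W i) = 0 := fun i => by
    simp only [D, SmoothFn.deriv_coord hW]
    rw [Finset.sum_eq_single i]
    · rw [if_pos rfl, map_one, map_one, mul_one, jac_apply, res_x_inl, sub_self]
    · intro j _ hj
      rw [if_neg hj, map_zero, map_zero, mul_zero]
    · simp
  -- All `g` are treated at once, because the inductive hypothesis is applied to the Hadamard
  -- quotients of `g`.
  have key : ∀ (m : W) (n : ℕ) (g : SmoothFn c.chart W), c.VanishesToOrder hW m n (D g) := by
    intro m n
    induction n with
    | zero => exact fun g ν hν => absurd hν (Nat.not_lt_zero _)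
    | succ n ih =>
      intro g
      obtain ⟨h, hg⟩ := SmoothFn.exists_hadamard hW g m
      have hD0 : D 0 = 0 := by simpa using hconst 0
      have hDsum : ∀ (s : Finset (Fin p)) (t : Fin p → SmoothFn c.chart W),
          D (∑ i ∈ s, t i) = ∑ i ∈ s, D (t i) := fun s t => by
        induction s using Finset.induction_on with
        | empty => simpa using hD0
        | insert a s ha ihs => rw [Finset.sum_insert ha, Finset.sum_insert ha, hadd, ihs]
      rw [hg, hadd, hconst, zero_add, hDsum]
      refine .sum fun i _ => ?_
      have hlin : D (SmoothFn.coord c.chart W i - algebraMap ℝ _ (c.chart m.1 i)) = 0 := by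
        rw [sub_eq_add_neg, ← map_neg, hadd, hcoord, hconst, add_zero]
      rw [hmul, hlin, zero_mul, zero_add, add_comm]
      -- The factor `ψ(u_i - u_i(m))` supplies the additional order, since `ψ` preserves underlying
      -- functions.
      refine VanishesToOrder.mul ?_ (ih (h i))
      rw [vanishesToOrder_one_iff, hbody, bodyHom_γ]
      change c.chart m.1 i - c.chart m.1 i = 0
      exact sub_self _
  exact sub_eq_zero.1 (eq_zero_of_vanishesToOrder (c := c) (hW := hW) fun m n => key m n g)

/-- The chain rule. -/
theorem chain_rule (k : Fin p ⊕ Fin q) (f : M.O W) :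
    c.pd hW k (ψ f) = ∑ l, c.jac hW ψ k l * ψ (c.pd hW l f) := by
  induction f using c.induction_mul hW with
  | hadd f f' hf hf' =>
    simp only [map_add, pd_add, hf, hf', mul_add, Finset.sum_add_distrib]
  | hmul f f' hf hf' =>
    rw [map_mul, pd_mul, hf, hf', Finset.sum_mul, Finset.mul_sum, ← Finset.sum_add_distrib]
    refine Finset.sum_congr rfl fun l _ => ?_
    have h1 : ψ (M.twist W l f) = M.twist W l (ψ f) := by
      rcases l with i | j
      · rfl
      · exact hσ f
    rw [pd_mul, map_add, map_mul, map_mul, mul_add, h1, ← mul_assoc, ← mul_assoc, ← mul_assoc,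
      c.jac_mul hσ k l (M.twist W l (ψ f)), twist_twist]
  | hγ g =>
    rw [c.chain_rule_γ hσ hbody, Fintype.sum_sum_type]
    simp only [pd_γ_inl, pd_γ_inr, map_zero, mul_zero, Finset.sum_const_zero, add_zero]
  | hodd j =>
    rw [Fintype.sum_sum_type]
    simp only [pd_odd_inl, pd_odd_inr, map_zero, mul_zero, Finset.sum_const_zero, zero_add]
    rw [Finset.sum_eq_single j]
    · rw [if_pos rfl, map_one, mul_one, jac_apply, res_x_inr]
    · intro b _ hb
      rw [if_neg hb, map_zero, mul_zero]
    · simp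

end Parity

/-! ## Products of odd superfunctions -/

/-- The product `ξ_1 ⋯ ξ_q`. -/
def top : M.O W := c.monomial hW Finset.univ

/-- Every `ξ_k` annihilates `ξ_1 ⋯ ξ_q`, so only the underlying function of a factor survives. -/
theorem mul_top (f : M.O W) : f * c.top hW = c.γ W hW (c.bodyHom hW f) * c.top hW := by
  induction f using c.induction_mul hW with
  | hadd f f' hf hf' => rw [add_mul, hf, hf', map_add, map_add, add_mul]
  | hmul f f' hf hf' =>
    rw [mul_assoc, hf', ← mul_assoc, ← c.γ_comm, mul_assoc, hf, map_mul, map_mul, ← mul_assoc,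
      c.γ_comm hW (c.bodyHom hW f')]
  | hγ g => rw [bodyHom_γ]
  | hodd k =>
    rw [c.bodyHom_odd hW (c.σ_odd hW k), map_zero, zero_mul, top, odd_mul_monomial,
      if_pos (Finset.mem_univ k)]

theorem σ_top : M.σ W (c.top hW) = (-1 : ℝ) ^ q • c.top hW := by
  have := c.σ_γ_mul_monomial hW 1 Finset.univ
  simpa [top] using this

theorem top_mul (f : M.O W) : c.top hW * f = c.top hW * c.γ W hW (c.bodyHom hW f) := by
  induction f using c.induction_mul hW with
  | hadd f f' hf hf' => rw [mul_add, hf, hf', map_add, map_add, mul_add]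
  | hmul f f' hf hf' =>
    rw [← mul_assoc, hf, mul_assoc, c.γ_comm, ← mul_assoc, hf', map_mul, map_mul, mul_assoc,
      c.γ_comm hW (c.bodyHom hW f')]
  | hγ g => rw [bodyHom_γ]
  | hodd k =>
    have h1 := M.odd_mul (c.σ_odd hW k) (c.top hW)
    rw [σ_top, mul_top, c.bodyHom_odd hW (c.σ_odd hW k), map_zero, zero_mul, smul_mul_assoc] at h1
    rw [c.bodyHom_odd hW (c.σ_odd hW k), map_zero, mul_zero]
    exact (smul_eq_zero.1 h1.symm).resolve_left (pow_ne_zero _ (by norm_num))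

/-- Telescoping: replacing one factor by a congruent one changes the product by a term of one order
higher. -/
theorem list_prod_vanishes {hW} {m : W} {η a : Fin q → M.O W}
    (hη : ∀ j, c.VanishesToOrder hW m 1 (η j)) (ha : ∀ j, c.VanishesToOrder hW m 1 (a j))
    (hηa : ∀ j, c.VanishesToOrder hW m 2 (η j - a j)) (l : List (Fin q)) :
    c.VanishesToOrder hW m l.length (l.map η).prod ∧
      c.VanishesToOrder hW m (l.length + 1) ((l.map η).prod - (l.map a).prod) := by
  induction l with
  | nil =>
    refine ⟨fun ν hν => absurd hν (Nat.not_lt_zero _), ?_⟩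
    simp only [List.map_nil, sub_self]
    exact .zero
  | cons j l ih =>
    simp only [List.map_cons, List.prod_cons, List.length_cons]
    refine ⟨((hη j).mul ih.1).of_le (by omega), ?_⟩
    have h : η j * (l.map η).prod - a j * (l.map a).prod
        = (η j - a j) * (l.map η).prod + a j * ((l.map η).prod - (l.map a).prod) := by
      noncomm_ring
    rw [h]
    exact (((hηa j).mul ih.1).of_le (by omega)).add (((ha j).mul ih.2).of_le (by omega))

/-- The product of `q` linear combinations of the odd coordinates. -/
theorem prod_linear (v : Matrix (Fin q) (Fin q) (SmoothFn c.chart W)) :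
    ((List.finRange q).map fun j => ∑ k, c.γ W hW (v k j) * c.odd hW k).prod
      = c.γ W hW v.det * c.top hW := by
  let C := SmoothFn c.chart W
  let _ : Algebra C (M.O W) := (c.γ W hW).toRingHom.toAlgebra' fun a f => c.γ_comm hW a f
  have hsmul : ∀ (a : C) (f : M.O W), a • f = c.γ W hW a * f := fun a f => Algebra.smul_def a f
  let L : (Fin q → C) →ₗ[C] M.O W :=
    { toFun := fun w => ∑ k, c.γ W hW (w k) * c.odd hW k
      map_add' := fun w w' => by
        simp only [Pi.add_apply, map_add, add_mul, Finset.sum_add_distrib]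
      map_smul' := fun a w => by
        simp only [Pi.smul_apply, smul_eq_mul, map_mul, mul_assoc, ← Finset.mul_sum,
          RingHom.id_apply, hsmul] }
  have hL : ∀ w, L w * L w = 0 := fun w => M.odd_mul_self (by
    change M.σ W (∑ k, c.γ W hW (w k) * c.odd hW k) = -∑ k, c.γ W hW (w k) * c.odd hW k
    rw [map_sum, ← Finset.sum_neg_distrib]
    refine Finset.sum_congr rfl fun k _ => ?_
    rw [map_mul, σ_γ, σ_odd, mul_neg])
  -- Linear combinations of the `ξ_k` square to zero, so they induce a morphism from the exterior
  -- algebra. The top coefficient of a product is then an alternating form in `q` vectors, hence a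
  -- multiple of the determinant; its value on the standard basis is 1.
  let ℓ : ExteriorAlgebra C (Fin q → C) →ₐ[C] M.O W := ExteriorAlgebra.lift C ⟨L, hL⟩
  let topCoeff : M.O W →ₗ[C] C :=
    { toFun := fun f => c.coeff hW f Finset.univ
      map_add' := fun f g => by rw [coeff_add]; rfl
      map_smul' := fun a f => by rw [hsmul, coeff_γ_mul]; rfl }
  let A := (topCoeff ∘ₗ ℓ.toLinearMap).compAlternatingMap (ExteriorAlgebra.ιMulti C q (M := Fin q → C))
  have hA : ∀ w : Fin q → Fin q → C,
      A w = c.coeff hW ((List.finRange q).map fun j => L (w j)).prod Finset.univ := by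
    intro w
    change c.coeff hW (ℓ (ExteriorAlgebra.ιMulti C q w)) Finset.univ = _
    rw [ExteriorAlgebra.ιMulti_apply, map_list_prod, List.map_ofFn, List.ofFn_eq_map]
    congr 3
    funext j
    exact ExteriorAlgebra.lift_ι_apply C _ hL _
  have hdet := A.eq_smul_basis_det (Pi.basisFun C (Fin q))
  have he : A (Pi.basisFun C (Fin q)) = 1 := by
    rw [hA]
    have h1 : ((List.finRange q).map fun j => L (Pi.basisFun C (Fin q) j)).prod = c.top hW := by
      rw [top, monomial, oddMonomial_eq_finRange]
      congr 2
      funext j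
      rw [if_pos (Finset.mem_univ j)]
      change ∑ k, c.γ W hW (Pi.basisFun C (Fin q) j k) * c.odd hW k = c.odd hW j
      rw [Finset.sum_eq_single j]
      · simp
      · intro b _ hb
        simp [hb]
      · simp
    rw [h1, top, coeff_monomial, Pi.single_eq_same]
  have hAv : A (fun j k => v k j) = v.det := by
    rw [hdet, he, one_smul, Pi.basisFun_det, Matrix.detRowAlternating]
    exact v.det_transpose
  rw [hA] at hAv
  apply c.coeff_injective hW
  funext ν
  rw [top, coeff_γ_mul_monomial]
  by_cases hν : ν = Finset.univ
  · subst hν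
    rw [Pi.single_eq_same]
    exact hAv
  · rw [Pi.single_eq_of_ne hν]
    refine SmoothFn.ext_of_subset fun m => ?_
    -- A product of `q` elements of order 1 has order `q`, so its coefficients of lower degree
    -- vanish.
    have hL1 : ∀ j, c.VanishesToOrder hW m 1 (L fun k => v k j) := fun j => by
      change c.VanishesToOrder hW m 1 (∑ k, c.γ W hW (v k j) * c.odd hW k)
      refine .sum fun k _ => .γ_mul ?_ _
      have h0 : c.VanishesToOrder hW m 0 1 := fun ν hν => absurd hν (Nat.not_lt_zero _)
      simpa using h0.odd_mul k
    have h := (c.list_prod_vanishes hL1 hL1 (fun j => by rw [sub_self]; exact .zero)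
      (List.finRange q)).1
    refine h ν ?_
    rw [List.length_finRange]
    have := Finset.card_lt_univ_of_notMem (s := ν) (x := (Finset.exists_of_ssubset
      (Finset.ssubset_univ_iff.2 hν)).choose) (Finset.exists_of_ssubset
      (Finset.ssubset_univ_iff.2 hν)).choose_spec.2
    simpa using this

/-- The product of `q` odd superfunctions. -/
theorem prod_odd {η : Fin q → M.O W} (hη : ∀ j, M.σ W (η j) = -η j) :
    oddMonomial η Finset.univ = c.γ W hW
      (Matrix.of fun k j => c.bodyHom hW (c.pd hW (.inr k) (η j))).det * c.top hW := by
  rw [← prod_linear, oddMonomial_eq_finRange]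
  simp only [Finset.mem_univ, if_true, Matrix.of_apply]
  rw [← sub_eq_zero]
  -- The linear part of `η j` in the odd coordinates. An odd superfunction has no part of degree 0,
  -- so `η j` and `a j` agree up to order 2, and the two products agree up to order `q + 1`, that
  -- is, exactly.
  set a : Fin q → M.O W := fun j => ∑ k, c.γ W hW (c.bodyHom hW (c.pd hW (.inr k) (η j))) *
    c.odd hW k
  have hmain : ∀ m, c.VanishesToOrder hW m (q + 1)
      (((List.finRange q).map η).prod - ((List.finRange q).map a).prod) := by
    intro m
    have ha : ∀ j, M.σ W (a j) = -a j := fun j => by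
      simp only [a, map_sum, map_mul, σ_γ, σ_odd, mul_neg, Finset.sum_neg_distrib]
    have h := (c.list_prod_vanishes (hW := hW) (m := m) (η := η) (a := a)
      (fun j => ?_) (fun j => ?_) (fun j => ?_) (List.finRange q)).2
    · rwa [List.length_finRange] at h
    · rw [vanishesToOrder_one_iff, c.bodyHom_odd hW (hη j)]; rfl
    · rw [vanishesToOrder_one_iff, c.bodyHom_odd hW (ha j)]; rfl
    · intro ν hν
      have hcoeff : c.coeff hW (η j - a j) ν = 0 := by
        rcases Nat.lt_or_ge ν.card 1 with h0 | h1
        · have : ν = ∅ := Finset.card_eq_zero.1 (Nat.lt_one_iff.1 h0)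
          subst this
          rw [← bodyHom_apply, map_sub, c.bodyHom_odd hW (hη j), c.bodyHom_odd hW (ha j), sub_zero]
        · obtain ⟨k, rfl⟩ := Finset.card_eq_one.1 (show ν.card = 1 by omega)
          rw [coeff_sub, Pi.sub_apply, coeff_sum, Finset.sum_apply, Finset.sum_eq_single k]
          · rw [← monomial_singleton, coeff_γ_mul_monomial, Pi.single_eq_same, bodyHom_apply,
              coeff_pd_inr]
            simp
          · intro b _ hb
            rw [← monomial_singleton, coeff_γ_mul_monomial, Pi.single_eq_of_ne]
            simpa using hb.symm
          · simp
      rw [hcoeff]; rfl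
  apply c.coeff_injective hW
  rw [coeff_zero]
  funext ν
  refine SmoothFn.ext_of_subset fun m => hmain m ν ?_
  exact Nat.lt_succ_of_le (by simpa using Finset.card_le_univ ν)

theorem bodyHom_ringDet {n : ℕ} (X : Matrix (Fin n) (Fin n) (M.O W)) :
    c.bodyHom hW (ringDet X) = (X.map (c.bodyHom hW)).det := by
  rw [ringDet, Matrix.det_apply, map_sum]
  refine Finset.sum_congr rfl fun τ _ => ?_
  rw [map_zsmul, map_list_prod, List.map_ofFn, List.prod_ofFn]
  rfl

end Coord
end SuperSpace

namespace SuperSpace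
namespace Coord

variable {M : SuperSpace.{u}} {p q : ℕ} (c : Coord M p q) {W : Opens M.carrier} {hW : W ≤ c.dom}

/-! ## The transformation formula for the adjoint of an automorphism -/

section Automorphism

variable {ψ : M.O W ≃ₐ[ℝ] M.O W} (hσ : ∀ f, ψ (M.σ W f) = M.σ W (ψ f))
include hσ

theorem symm_σ (f : M.O W) : ψ.symm (M.σ W f) = M.σ W (ψ.symm f) := by
  apply ψ.injective
  rw [hσ, ψ.apply_symm_apply, ψ.apply_symm_apply]

variable (hbody : ∀ f, c.bodyHom hW (ψ f) = c.bodyHom hW f)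
include hbody

omit hσ in
theorem bodyHom_symm (f : M.O W) : c.bodyHom hW (ψ.symm f) = c.bodyHom hW f := by
  rw [← hbody, ψ.apply_symm_apply]

/-- The inverse of the Jacobian matrix. -/
def invJac (ψ : M.O W ≃ₐ[ℝ] M.O W) (hW : W ≤ c.dom) :
    Matrix (Fin p ⊕ Fin q) (Fin p ⊕ Fin q) (M.O W) :=
  (c.jac hW ψ.symm.toAlgHom).map ψ

/-- The chain rule for the inverse automorphism, transported by `ψ`: it expands the conjugated
derivation `ψ ∘ ∂_l ∘ ψ⁻¹` in coordinate derivations. -/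
theorem apply_pd_symm (l : Fin p ⊕ Fin q) (f : M.O W) :
    ψ (c.pd hW l (ψ.symm f)) = ∑ m, c.invJac ψ hW l m * c.pd hW m f := by
  have h := c.chain_rule (hW := hW) (ψ := ψ.symm.toAlgHom) (symm_σ hσ) (c.bodyHom_symm hbody) l f
  have h2 := congrArg ψ h
  rw [map_sum] at h2
  refine h2.trans (Finset.sum_congr rfl fun m _ => ?_)
  rw [map_mul]
  exact congrArg _ (ψ.apply_symm_apply _)

theorem jac_mul_invJac : c.jac hW ψ.toAlgHom * c.invJac ψ hW = 1 := by
  ext k m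
  have h := c.chain_rule (hW := hW) (ψ := ψ.toAlgHom) hσ hbody k (ψ.symm (M.res hW (c.x m)))
  rw [Matrix.mul_apply, Matrix.one_apply, ← c.pd_res_x hW k m]
  refine Eq.trans h.symm ?_
  exact congrArg _ (ψ.apply_symm_apply _)

theorem invJac_mul_jac : c.invJac ψ hW * c.jac hW ψ.toAlgHom = 1 := by
  ext l m
  have h := c.apply_pd_symm hσ hbody l (ψ (M.res hW (c.x m)))
  rw [ψ.symm_apply_apply, pd_res_x] at h
  rw [Matrix.mul_apply, Matrix.one_apply]
  refine Eq.trans h.symm ?_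
  split_ifs <;> simp

omit hbody in
theorem isEvenSupermatrix_invJac : IsEvenSupermatrix (c.invJac ψ hW) := by
  have h := c.isEvenSupermatrix_jac (hW := hW) (ψ := ψ.symm.toAlgHom) (symm_σ hσ)
  constructor
  · ext i j
    exact (hσ _).symm.trans (congrArg ψ (congrFun (congrFun h.map₁₁ i) j))
  · ext i j
    exact (hσ _).symm.trans ((congrArg ψ (congrFun (congrFun h.map₁₂ i) j)).trans (map_neg ψ _))
  · ext i j
    exact (hσ _).symm.trans ((congrArg ψ (congrFun (congrFun h.map₂₁ i) j)).trans (map_neg ψ _))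
  · ext i j
    exact (hσ _).symm.trans (congrArg ψ (congrFun (congrFun h.map₂₂ i) j))

/-- The divergence of the transported coordinate fields is the logarithmic derivative of the
Berezinian. -/
theorem pd_berezinian (j : Fin q) :
    c.pd hW (.inr j) (berezinian (c.jac hW ψ.toAlgHom)) = berezinian (c.jac hW ψ.toAlgHom) *
      ∑ l, ψ (c.pd hW l (ψ.symm (c.jac hW ψ.toAlgHom (.inr j) l))) := by
  set J := c.jac hW ψ.toAlgHom
  set K := c.invJac ψ hW
  have h := derivation_berezinian (D := c.pdₗ hW (.inr j)) (c.pd_mul hW (.inr j))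
    (c.pd_inr_σ hW j) (c.isEvenSupermatrix_jac (ψ := ψ.toAlgHom) hσ)
    (c.isEvenSupermatrix_invJac hσ) (c.jac_mul_invJac hσ hbody) (c.invJac_mul_jac hσ hbody)
  refine h.trans (congrArg _ ?_)
  -- Each entry of row `j` of `J` is a `ξ_j`-derivative of `ψ(x_l)`. Exchanging it with another
  -- coordinate derivation, with a sign if both are odd, yields the signed traces of
  -- `derivation_berezinian`.
  have hsum : ∀ l, ψ (c.pd hW l (ψ.symm (J (.inr j) l))) =
      ∑ i, K l (.inl i) * c.pd hW (.inr j) (J (.inl i) l)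
        - ∑ i, K l (.inr i) * c.pd hW (.inr j) (J (.inr i) l) := by
    intro l
    rw [c.apply_pd_symm hσ hbody, Fintype.sum_sum_type, sub_eq_add_neg, ← Finset.sum_neg_distrib]
    congr 1
    · refine Finset.sum_congr rfl fun i _ => ?_
      exact congrArg (K l (.inl i) * ·) (c.pd_inl_comm hW i (.inr j) _)
    · refine Finset.sum_congr rfl fun i _ => ?_
      exact (congrArg (K l (.inr i) * ·) (c.pd_inr_comm hW i j _)).trans (mul_neg _ _)
  simp only [hsum, Fintype.sum_sum_type, Finset.sum_sub_distrib]
  simp only [Matrix.trace, Matrix.diag, Matrix.mul_apply]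
  change (∑ x, ∑ i, K (.inl x) (.inl i) * c.pd hW (.inr j) (J (.inl i) (.inl x)))
    - (∑ x, ∑ i, K (.inl x) (.inr i) * c.pd hW (.inr j) (J (.inr i) (.inl x)))
    + (∑ x, ∑ i, K (.inr x) (.inl i) * c.pd hW (.inr j) (J (.inl i) (.inr x)))
    - (∑ x, ∑ i, K (.inr x) (.inr i) * c.pd hW (.inr j) (J (.inr i) (.inr x))) = _
  abel

omit hσ in
theorem bodyHom_jac : (c.jac hW ψ.toAlgHom).toBlocks₁₁.map (c.bodyHom hW) = 1 := by
  ext1 i j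
  rw [Matrix.map_apply, Matrix.one_apply]
  change c.bodyHom hW (c.pd hW (.inl i) (ψ (M.res hW (c.x (.inl j))))) = _
  rw [bodyHom_apply, coeff_pd_inl, ← bodyHom_apply, hbody, res_x_inl, bodyHom_γ,
    SmoothFn.deriv_coord hW]

/-- The Berezinian on the top component. -/
theorem berezinian_mul_apply_top :
    berezinian (c.jac hW ψ.toAlgHom) * ψ (c.top hW) = c.top hW := by
  set J := c.jac hW ψ.toAlgHom with hJdef
  have hJ : IsEvenSupermatrix J := c.isEvenSupermatrix_jac (ψ := ψ.toAlgHom) hσ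
  obtain ⟨U, hU, hVU, hUV⟩ := isUnit_toBlocks₂₂ hJ
    (c.isEvenSupermatrix_invJac hσ) (c.jac_mul_invJac hσ hbody)
  -- The odd superfunctions `ψ(ξ_j)` multiply to the underlying determinant of the odd block times
  -- `ξ_1 ⋯ ξ_q`, which the factor `det V⁻¹` of the Berezinian cancels.
  have htop : ψ (c.top hW) = c.γ W hW (c.bodyHom hW (ringDet J.toBlocks₂₂)) * c.top hW := by
    rw [top, monomial, map_oddMonomial, prod_odd (hW := hW), bodyHom_ringDet]
    · rfl
    · intro j
      rw [← hσ]
      exact (congrArg ψ (c.σ_odd hW j)).trans (map_neg _ _)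
  have hbS : J.toBlocks₁₂.map (c.bodyHom hW) = 0 := by
    ext1 i j
    exact c.bodyHom_odd hW (congrFun (congrFun hJ.map₁₂ i) j)
  have hbA : J.toBlocks₁₁.map (c.bodyHom hW) = 1 := c.bodyHom_jac hbody
  have hN : c.bodyHom hW (ringDet (J.toBlocks₁₁ - J.toBlocks₁₂ * U * J.toBlocks₂₁)) = 1 := by
    have hmul : (J.toBlocks₁₂ * U * J.toBlocks₂₁).map (c.bodyHom hW)
        = (J.toBlocks₁₂ * U).map (c.bodyHom hW) * J.toBlocks₂₁.map (c.bodyHom hW) :=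
      Matrix.map_mul (f := (c.bodyHom hW).toRingHom)
    have hmul' : (J.toBlocks₁₂ * U).map (c.bodyHom hW)
        = J.toBlocks₁₂.map (c.bodyHom hW) * U.map (c.bodyHom hW) :=
      Matrix.map_mul (f := (c.bodyHom hW).toRingHom)
    rw [bodyHom_ringDet, Matrix.map_sub _ (map_sub _), hbA, hmul, hmul', hbS, Matrix.zero_mul, Matrix.zero_mul, sub_zero, Matrix.det_one]
  rw [htop, berezinian_eq hVU hUV, ← mul_assoc, ← c.γ_comm, mul_assoc, mul_top, map_mul, hN,
    one_mul, ← mul_assoc, ← map_mul, ← map_mul, ← ringDet_mul_even hJ.map₂₂ hU, hVU, ringDet_one,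
    map_one, map_one, one_mul]

variable [T2Space M.carrier] (hsupp : ∀ f, HasCompactSupp f → HasCompactSupp (ψ f))
  {P : M.O W → M.O W}
  (hP : ∀ f g, HasCompactSupp g → c.integral hW (f * ψ g) = c.integral hW (P f * g))

omit hσ hbody in
theorem eq_of_integral_mul {f f' : M.O W}
    (h : ∀ g, HasCompactSupp g → c.integral hW (f * g) = c.integral hW (f' * g)) : f = f' := by
  refine sub_eq_zero.1 (c.eq_zero_of_integral_mul hW fun g hg => ?_)
  rw [sub_mul, sub_eq_add_neg, c.integral_add hW (hg.mul_left f) (by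
    rw [← neg_mul]; exact hg.mul_left (-f')), integral_neg, h g hg, add_neg_cancel]

include hP

omit hσ hbody in
-- Paired with `g`, both sides give the integral of `f ψ(h g)`; this is where multiplicativity of
-- `ψ` enters.
theorem adjoint_mul (f h : M.O W) : P (f * ψ h) = P f * h := by
  refine c.eq_of_integral_mul (hW := hW) fun g hg => ?_
  rw [← hP _ _ hg, mul_assoc, ← map_mul, hP _ _ (hg.mul_left h), mul_assoc]

omit hbody in
theorem adjoint_σ (f : M.O W) : P (M.σ W f) = M.σ W (P f) := by
  refine c.eq_of_integral_mul (hW := hW) fun g hg => ?_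
  have h1 : M.σ W f * ψ g = M.σ W (f * ψ (M.σ W g)) := by rw [map_mul, hσ, M.σ_σ]
  have h2 : M.σ W (P f) * g = M.σ W (P f * M.σ W g) := by rw [map_mul, M.σ_σ]
  rw [← hP _ _ hg, h1, h2, integral_σ, integral_σ, hP _ _ hg.σ]

include hsupp

/-- The adjoint of the chain rule. The integral of `∂_k(ψ g)` is zero; expanding by the chain rule,
passing from `ψ` to `P` and integrating by parts leaves this divergence paired with an arbitrary
`g`. -/
theorem sum_pd_adjoint_jac (k : Fin p ⊕ Fin q) :
    ∑ l, c.pd hW l (M.twist W l (P (c.jac hW ψ.toAlgHom k l))) = 0 := by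
  rw [← neg_eq_zero, ← Finset.sum_neg_distrib]
  refine c.eq_of_integral_mul (hW := hW) fun g hg => ?_
  rw [Finset.sum_mul, zero_mul, integral_zero, c.integral_sum hW fun l _ => hg.mul_left _]
  have h1 : ∀ l, c.integral hW (-c.pd hW l (M.twist W l (P (c.jac hW ψ.toAlgHom k l))) * g)
      = c.integral hW (c.jac hW ψ.toAlgHom k l * ψ (c.pd hW l g)) := fun l => by
    rw [← integral_mul_pd c hW _ hg, hP _ _ (c.hasCompactSupp_pd hW hg l)]
  simp only [h1]
  rw [← c.integral_sum hW fun l _ => (hsupp _ (c.hasCompactSupp_pd hW hg l)).mul_left _]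
  have h2 := c.chain_rule (hW := hW) (ψ := ψ.toAlgHom) hσ hbody k g
  exact (congrArg (c.integral hW) h2).symm.trans (c.integral_pd hW (hsupp g hg) k)

/-- The product `C` is annihilated by all `∂/∂ξ_j`, so it is determined by its underlying function,
which can be read off from its action on `ξ_1 ⋯ ξ_q`. -/
theorem apply_adjoint_one_mul_berezinian :
    ψ (P 1) * berezinian (c.jac hW ψ.toAlgHom) = 1 := by
  set J := c.jac hW ψ.toAlgHom with hJdef
  set b := P 1 with hb
  have hJ : IsEvenSupermatrix J := c.isEvenSupermatrix_jac (ψ := ψ.toAlgHom) hσ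
  have hPf : ∀ f, P f = b * ψ.symm f := fun f => by
    rw [hb, ← c.adjoint_mul hP, ψ.apply_symm_apply, one_mul]
  have hbe : M.σ W b = b := by rw [hb, ← c.adjoint_σ hσ hP, map_one]
  have hBe : M.σ W (ψ b) = ψ b := by rw [← hσ, hbe]
  have hBere : M.σ W (berezinian J) = berezinian J :=
    σ_berezinian hJ (c.isEvenSupermatrix_invJac hσ) (c.jac_mul_invJac hσ hbody)
  -- Apply `ψ` to the divergence identity with `P(J) = b ψ⁻¹(J)` and expand by Leibniz. The terms
  -- that differentiate `b` add up to the `ξ_j`-derivative of `ψ b` by the chain rule; the others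
  -- form the divergence of `pd_berezinian`.
  have hpdB : ∀ j, c.pd hW (.inr j) (ψ b)
      = -(ψ b * ∑ l, ψ (c.pd hW l (ψ.symm (J (.inr j) l)))) := by
    intro j
    have h := congrArg ψ (c.sum_pd_adjoint_jac hσ hbody hsupp hP (.inr j))
    rw [map_zero, map_sum] at h
    have h1 : ∀ l, ψ (c.pd hW l (M.twist W l (P (J (.inr j) l))))
        = J (.inr j) l * ψ (c.pd hW l b)
          + ψ b * ψ (c.pd hW l (ψ.symm (J (.inr j) l))) := by
      intro l
      have h2 : M.twist W l (P (J (.inr j) l)) = b * ψ.symm (J (.inr j) l) := by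
        rw [hPf]
        rcases l with i | i
        · rfl
        · rw [twist_inr, map_mul, hbe, ← symm_σ hσ]
          exact congrArg (fun z => b * ψ.symm z) (congrFun (congrFun hJ.map₂₂ j) i)
      have h3 : M.twist W l b = b := by
        rcases l with i | i
        · rfl
        · exact hbe
      rw [h2, pd_mul, h3, map_add, map_mul, map_mul, ψ.apply_symm_apply]
      congr 1
      rcases l with i | i
      · refine M.even_comm W _ _ ?_
        rw [← hσ, ← pd_inl_σ, hbe]
      · exact (M.even_comm W _ _ (congrFun (congrFun hJ.map₂₂ j) i)).symm
    simp only [← hJdef] at h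
    simp only [h1, Finset.sum_add_distrib, ← Finset.mul_sum] at h
    have h4 := c.chain_rule (hW := hW) (ψ := ψ.toAlgHom) hσ hbody (.inr j) b
    rw [eq_neg_iff_add_eq_zero, ← h]
    exact congrArg (· + _) h4
  set C := ψ b * berezinian J with hC
  have hpdC : ∀ j, c.pd hW (.inr j) C = 0 := by
    intro j
    rw [hC, pd_mul, hpdB, c.pd_berezinian hσ hbody, twist_inr, hBe,
      M.even_comm W (berezinian J) _ hBere, neg_mul, mul_assoc, neg_add_cancel]
  -- A nonzero coefficient at a nonempty `ν` would show up in the `ξ_j`-derivative for any `j ∈ ν`.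
  have hCγ : C = c.γ W hW (c.bodyHom hW C) := by
    apply c.coeff_injective hW
    funext ν
    rw [coeff_γ]
    rcases ν.eq_empty_or_nonempty with rfl | ⟨j, hj⟩
    · rw [Pi.single_eq_same, bodyHom_apply]
    · rw [Pi.single_eq_of_ne (Finset.nonempty_iff_ne_empty.1 ⟨j, hj⟩)]
      have h := c.coeff_pd_inr hW j C (ν.erase j)
      rw [hpdC, coeff_zero, if_neg (Finset.notMem_erase j ν), Finset.insert_erase hj] at h
      exact (smul_eq_zero.1 h.symm).resolve_left (pow_ne_zero _ (by norm_num))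
  -- Next to `ξ_1 ⋯ ξ_q` only the underlying function of `ψ g` counts, and that is the one of `g`.
  have hPtop : P (c.top hW) = c.top hW := by
    refine c.eq_of_integral_mul (hW := hW) fun g hg => ?_
    rw [← hP _ _ hg, top_mul, hbody, ← top_mul]
  have hCtop : C * c.top hW = c.top hW := by
    rw [hC, ← M.even_comm W (berezinian J) _ hBere, mul_assoc]
    conv_lhs => rw [← ψ.apply_symm_apply (c.top hW), ← map_mul, ← hPf, hPtop]
    exact c.berezinian_mul_apply_top hσ hbody
  have h1 : c.bodyHom hW C = 1 := by
    rw [mul_top] at hCtop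
    have h := congrArg (fun f => c.coeff hW f Finset.univ) hCtop
    simpa only [top, coeff_γ_mul_monomial, coeff_monomial, Pi.single_eq_same] using h
  rw [hCγ, h1, map_one]

/-- An automorphism over the identity transforms its adjoint by the Berezinian. -/
theorem berezinian_mul_apply_adjoint (f : M.O W) :
    berezinian (c.jac hW ψ.toAlgHom) * ψ (P f) = f := by
  have h := c.apply_adjoint_one_mul_berezinian hσ hbody hsupp hP
  have hBere : M.σ W (berezinian (c.jac hW ψ.toAlgHom)) = berezinian (c.jac hW ψ.toAlgHom) :=
    σ_berezinian (c.isEvenSupermatrix_jac (ψ := ψ.toAlgHom) hσ)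
      (c.isEvenSupermatrix_invJac hσ) (c.jac_mul_invJac hσ hbody)
  have hPf : P f = P 1 * ψ.symm f := by
    rw [← c.adjoint_mul hP, ψ.apply_symm_apply, one_mul]
  rw [hPf, map_mul, ψ.apply_symm_apply, ← mul_assoc, M.even_comm W _ _ hBere, h, one_mul]

/-- Puts the adjoint into the shape of the transformation law for Berezin forms; the converse uses
that the Berezinian is invertible. -/
theorem eq_adjoint_iff (f h : M.O W) :
    h = P f ↔ f = berezinian (c.jac hW ψ.toAlgHom) * ψ h := by
  have hu := c.apply_adjoint_one_mul_berezinian hσ hbody hsupp hP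
  have hf := c.berezinian_mul_apply_adjoint hσ hbody hsupp hP f
  constructor
  · rintro rfl
    exact hf.symm
  · intro h'
    rw [h'] at hf
    have h2 := congrArg (ψ (P 1) * ·) hf
    simp only [← mul_assoc, hu, one_mul] at h2
    rw [← h'] at h2
    exact (ψ.injective h2).symm

end Automorphism

end Coord
end SuperSpace

namespace SuperSpace

/-! ## Naturality under isomorphisms -/

section Map

variable {R S : Type*} [Ring R] [Ring S]

theorem map_ringDet {F : Type*} [FunLike F R S] [RingHomClass F R S] (f : F) {n : ℕ}
    (X : Matrix (Fin n) (Fin n) R) : f (ringDet X) = ringDet (X.map f) := by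
  simp only [ringDet, map_sum, map_zsmul, map_list_prod, List.map_ofFn]
  rfl

theorem map_inverse (f : R ≃+* S) (a : R) : f (Ring.inverse a) = Ring.inverse (f a) := by
  by_cases h : IsUnit a
  · obtain ⟨a, rfl⟩ := h
    rw [Ring.inverse_unit]
    exact (Ring.inverse_unit (Units.map (f : R →* S) a)).symm
  · rw [Ring.inverse_non_unit _ h, Ring.inverse_non_unit, map_zero]
    intro h'
    exact h (by simpa using h'.map f.symm)

/-- An isomorphism is required because `Ring.inverse` is zero at non-units, and a mere homomorphism
can send a non-unit to a unit. -/
theorem map_berezinian (f : R ≃+* S) {p q : ℕ} (J : Matrix (Fin p ⊕ Fin q) (Fin p ⊕ Fin q) R) :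
    f (berezinian J) = berezinian (J.map f) := by
  have hinv : (Ring.inverse J.toBlocks₂₂).map f = Ring.inverse (J.map f).toBlocks₂₂ :=
    map_inverse f.mapMatrix J.toBlocks₂₂
  have hmul : ∀ {l m n : Type} [Fintype m] (X : Matrix l m R) (Y : Matrix m n R),
      (X * Y).map f = X.map f * Y.map f := fun X Y => Matrix.map_mul (f := (f : R →+* S))
  rw [berezinian, map_mul, map_ringDet, map_ringDet, Matrix.map_sub _ (map_sub f), hmul, hmul,
    hinv]
  rfl

end Map

namespace Iso

variable {M N : SuperSpace.{u}} (φ : Iso M N) {p q : ℕ}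

theorem le_comap_comap' (W : Opens N.carrier) :
    W ≤ (W.comap φ.hom.base).comap φ.inv.base := fun n hn => by
  change φ.hom.base (φ.inv.base n) ∈ W
  rwa [φ.hom_inv_base]

/-- The pullback as an isomorphism of algebras of superfunctions. -/
def pullEquiv (W : Opens N.carrier) : N.O W ≃ₐ[ℝ] M.O (W.comap φ.hom.base) :=
  AlgEquiv.ofAlgHom (φ.hom.pull W)
    ((N.res (φ.le_comap_comap' W)).comp (φ.inv.pull (W.comap φ.hom.base)))
    (by
      ext f
      have h1 : ((W.comap φ.hom.base).comap φ.inv.base).comap φ.hom.base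
          ≤ W.comap φ.hom.base := fun m hm => by
        change φ.hom.base (φ.inv.base (φ.hom.base m)) ∈ W at hm
        rwa [φ.hom_inv_base] at hm
      simp only [AlgHom.comp_apply, AlgHom.id_apply]
      rw [φ.hom.pull_res, φ.hom_inv_pull (W.comap φ.hom.base) h1, res_res, res_self])
    (by
      ext f
      have h1 : (W.comap φ.hom.base).comap φ.inv.base ≤ W := fun n hn => by
        change φ.hom.base (φ.inv.base n) ∈ W at hn
        rwa [φ.hom_inv_base] at hn
      simp only [AlgHom.comp_apply, AlgHom.id_apply]
      rw [φ.inv_hom_pull W h1, res_res, res_self])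

theorem pullEquiv_apply (W : Opens N.carrier) (f : N.O W) :
    φ.pullEquiv W f = φ.hom.pull W f := rfl

section Coord

variable (c : Coord N p q) {W : Opens N.carrier} (hW : W ≤ c.dom)

/-- The pullback of smooth functions. -/
def pullFn (g : SmoothFn c.chart W) :
    SmoothFn (φ.pullCoord c).chart (W.comap φ.hom.base) :=
  ⟨fun w => g.1 ⟨φ.hom.base w.1, w.2⟩, by
    have hle : (W.comap φ.hom.base).comap φ.inv.base ≤ W := fun n hn => by
      change φ.hom.base (φ.inv.base n) ∈ W at hn
      rwa [φ.hom_inv_base] at hn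
    refine ContDiffOn.congr (SmoothFn.res hle g).2 fun v hv => ?_
    have hv2 : c.chart.symm v ∈ (W.comap φ.hom.base).comap φ.inv.base := hv.2
    refine (readFn_eq _ (W.comap φ.hom.base) _ hv.2).trans
      (Eq.trans ?_ (readFn_eq c.chart _ (SmoothFn.res hle g).1 hv2).symm)
    have h1 : φ.hom.base ((φ.pullCoord c).chart.symm v) = c.chart.symm v := φ.hom_inv_base _
    exact congrArg g.1 (Subtype.ext h1)⟩

theorem pullFn_apply (g : SmoothFn c.chart W) (w : W.comap φ.hom.base) :
    (φ.pullFn c g).1 w = g.1 ⟨φ.hom.base w.1, w.2⟩ := rfl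

/-- The pulled back chart is `chart ∘ φ₀`, so a function and its pullback have the same coordinate
expression. Compatibility of coefficients, derivations, Jacobians and Berezinians with pullback
follows from this. -/
theorem readFn_pullFn (g : SmoothFn c.chart W) :
    readFn (φ.pullCoord c).chart (W.comap φ.hom.base) (φ.pullFn c g).1
      = readFn c.chart W g.1 := by
  funext v
  have h1 : φ.hom.base ((φ.pullCoord c).chart.symm v) = c.chart.symm v := φ.hom_inv_base _
  have hiff : (φ.pullCoord c).chart.symm v ∈ W.comap φ.hom.base ↔ c.chart.symm v ∈ W := by
    rw [← h1]; rfl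
  unfold readFn
  by_cases h : c.chart.symm v ∈ W
  · rw [dif_pos h, dif_pos (hiff.2 h), pullFn_apply]
    exact congrArg g.1 (Subtype.ext h1)
  · rw [dif_neg h, dif_neg (fun h' => h (hiff.1 h'))]

theorem deriv_pullFn (i : Fin p) (g : SmoothFn c.chart W) :
    SmoothFn.deriv i (φ.pullFn c g) = φ.pullFn c (SmoothFn.deriv i g) := by
  refine SmoothFn.ext_of_subset fun w => ?_
  rw [SmoothFn.deriv_apply, readFn_pullFn]
  rfl

include hW in
theorem comap_le_dom : W.comap φ.hom.base ≤ (φ.pullCoord c).dom := fun _ hm => hW hm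

theorem γ_pullFn (g : SmoothFn c.chart W) :
    (φ.pullCoord c).γ (W.comap φ.hom.base) (φ.comap_le_dom c hW) (φ.pullFn c g)
      = φ.hom.pull W (c.γ W hW g) := by
  have hle : (W.comap φ.hom.base).comap φ.inv.base ≤ W := fun n hn => by
    change φ.hom.base (φ.inv.base n) ∈ W at hn
    rwa [φ.hom_inv_base] at hn
  change φ.pullTo (W.comap φ.hom.base) (c.γ _ _ (φ.pushFn c.chart _ (φ.pullFn c g))) = _
  have h1 : φ.pushFn c.chart (W.comap φ.hom.base) (φ.pullFn c g) = SmoothFn.res hle g := by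
    refine SmoothFn.ext_of_subset fun n => ?_
    exact congrArg g.1 (Subtype.ext (φ.hom_inv_base n.1))
  rw [h1, ← c.res_γ hW hle, φ.pullTo_res _ hle le_rfl, res_self]

theorem monomial_pullCoord (ν : Finset (Fin q)) :
    (φ.pullCoord c).monomial (φ.comap_le_dom c hW) ν = φ.hom.pull W (c.monomial hW ν) := by
  refine Eq.trans ?_ (map_oddMonomial (φ.hom.pull W) _ ν).symm
  refine congrArg (fun ξ => oddMonomial ξ ν) (funext fun j => ?_)
  exact (φ.hom.pull_res hW (c.ξ j)).symm

theorem coeff_pull (f : N.O W) (ν : Finset (Fin q)) :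
    (φ.pullCoord c).coeff (φ.comap_le_dom c hW) (φ.hom.pull W f) ν
      = φ.pullFn c (c.coeff hW f ν) := by
  have : φ.hom.pull W f = (φ.pullCoord c).ofCoeff (φ.comap_le_dom c hW)
      (fun ν => φ.pullFn c (c.coeff hW f ν)) := by
    conv_lhs => rw [← c.ofCoeff_coeff hW f]
    simp only [Coord.ofCoeff, map_sum, map_mul]
    exact Finset.sum_congr rfl fun ν _ =>
      congrArg₂ (· * ·) (φ.γ_pullFn c hW _).symm (φ.monomial_pullCoord c hW ν).symm
  rw [this, Coord.coeff_ofCoeff]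

theorem pd_pull (k : Fin p ⊕ Fin q) (f : N.O W) :
    (φ.pullCoord c).pd (φ.comap_le_dom c hW) k (φ.hom.pull W f)
      = φ.hom.pull W (c.pd hW k f) := by
  apply (φ.pullCoord c).coeff_injective (φ.comap_le_dom c hW)
  funext ν
  rw [φ.coeff_pull c hW]
  rcases k with i | j
  · rw [Coord.coeff_pd_inl, Coord.coeff_pd_inl, φ.coeff_pull c hW, deriv_pullFn]
  · rw [Coord.coeff_pd_inr, Coord.coeff_pd_inr, φ.coeff_pull c hW]
    split_ifs <;> rfl

theorem x_pullCoord (l : Fin p ⊕ Fin q) :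
    (φ.pullCoord c).x l = φ.hom.pull c.dom (c.x l) := by
  rcases l with i | j
  · exact φ.γ_pullFn c le_rfl (SmoothFn.coord c.chart c.dom i)
  · rfl

theorem body_pull (f : N.O W) (w : W.comap φ.hom.base) :
    (φ.pullCoord c).body (φ.comap_le_dom c hW) (φ.hom.pull W f) w
      = c.body hW f ⟨φ.hom.base w.1, w.2⟩ :=
  congrFun (congrArg Subtype.val (φ.coeff_pull c hW f ∅)) w

end Coord

theorem jacobian_pullCoord (x y : Coord N p q) {W : Opens N.carrier} (hx : W ≤ x.dom)
    (hy : W ≤ y.dom) :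
    jacobian (φ.pullCoord x) (φ.pullCoord y) (φ.comap_le_dom x hx) (φ.comap_le_dom y hy)
      = (jacobian x y hx hy).map (φ.hom.pull W) := by
  ext k l
  change (φ.pullCoord y).pd _ k (M.res _ ((φ.pullCoord x).x l)) = φ.hom.pull W _
  rw [x_pullCoord]
  refine Eq.trans ?_ (φ.pd_pull y hy k _)
  exact congrArg _ (φ.hom.pull_res hx (x.x l)).symm

theorem berezinian_pullCoord (x y : Coord N p q) {W : Opens N.carrier} (hx : W ≤ x.dom)
    (hy : W ≤ y.dom) :
    berezinian (jacobian (φ.pullCoord x) (φ.pullCoord y) (φ.comap_le_dom x hx)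
      (φ.comap_le_dom y hy)) = φ.hom.pull W (berezinian (jacobian x y hx hy)) := by
  rw [jacobian_pullCoord]
  exact (map_berezinian (φ.pullEquiv W).toRingEquiv _).symm

/-- The preimage of a family of local coefficients under the pullback. -/
def pushCoeffs (ω : LocalCoeffs M p q) : LocalCoeffs N p q :=
  fun x => (φ.pullEquiv x.dom).symm (ω (φ.pullCoord x))

theorem pull_pushCoeffs (ω : LocalCoeffs M p q) (x : Coord N p q) :
    φ.hom.pull x.dom (φ.pushCoeffs ω x) = ω (φ.pullCoord x) :=
  (φ.pullEquiv x.dom).apply_symm_apply _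

theorem isPullback_pushCoeffs (ω : LocalCoeffs M p q) : IsPullback φ (φ.pushCoeffs ω) ω :=
  fun x => (φ.pull_pushCoeffs ω x).symm

theorem pull_res_pushCoeffs (ω : LocalCoeffs M p q) (x : Coord N p q) {W : Opens N.carrier}
    (hx : W ≤ x.dom) : φ.hom.pull W (N.res hx (φ.pushCoeffs ω x))
      = M.res (φ.comap_le_dom x hx) (ω (φ.pullCoord x)) := by
  rw [φ.hom.pull_res hx, pull_pushCoeffs]
  rfl

theorem isBerezinForm_pushCoeffs {ω : LocalCoeffs M p q} (hω : IsBerezinForm ω) :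
    IsBerezinForm (φ.pushCoeffs ω) := by
  intro x y W hx hy
  apply (φ.pullEquiv W).injective
  rw [map_mul, pullEquiv_apply, pullEquiv_apply, pullEquiv_apply, pull_res_pushCoeffs,
    pull_res_pushCoeffs, ← φ.berezinian_pullCoord x y hx hy]
  exact hω _ _ _ _ _

theorem isBerezinDensity_pushCoeffs {ω : LocalCoeffs M p q} (hω : IsBerezinDensity ω) :
    IsBerezinDensity (φ.pushCoeffs ω) := by
  intro x y W hx hy ε hε
  apply (φ.pullEquiv W).injective
  rw [map_smul, map_mul, pullEquiv_apply, pullEquiv_apply, pullEquiv_apply, pull_res_pushCoeffs,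
    pull_res_pushCoeffs, ← φ.berezinian_pullCoord x y hx hy]
  refine hω _ _ _ _ _ ε fun w => ?_
  have h1 : (jacobian (φ.pullCoord x) (φ.pullCoord y) (φ.comap_le_dom x hx)
      (φ.comap_le_dom y hy)).toBlocks₁₁
      = (jacobian x y hx hy).toBlocks₁₁.map (φ.hom.pull W) := by
    rw [jacobian_pullCoord]; rfl
  rw [h1, ← map_ringDet, body_pull φ y hy]
  exact hε _

end Iso

/-! ## The right action of a pullback -/

section RightAction

variable {M : SuperSpace.{u}} {p q : ℕ}

/-- The derivation applied last is the first to be moved to the other factor. This reversal turns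
the left fold of `iteratedPd` into the right fold of `rightIteratedPd`. -/
theorem Coord.integral_mul_iteratedPd [T2Space M.carrier] (x : Coord M p q) (j : MultiIndex p q)
    (f : M.O x.dom) {g : M.O x.dom} (hg : HasCompactSupp g) :
    HasCompactSupp (x.iteratedPd j g) ∧
    x.integral le_rfl (f * x.iteratedPd j g)
      = x.integral le_rfl (x.rightIteratedPd j f * g) := by
  unfold iteratedPd rightIteratedPd
  induction j.toList generalizing g with
  | nil => exact ⟨hg, rfl⟩
  | cons k l ih =>
    have hk := x.hasCompactSupp_pd le_rfl hg k
    refine ⟨(ih hk).1, ?_⟩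
    rw [List.foldl_cons, List.foldr_cons, (ih hk).2, x.integral_mul_pd le_rfl _ hg]
    rcases k with i | i <;> rfl

/-- The right action of a represented operator. -/
def Coord.adjoint (x : Coord M p q) (a : MultiIndex p q →₀ M.O x.dom) (f : M.O x.dom) :
    M.O x.dom := a.sum fun j aj => x.rightIteratedPd j (f * aj)

variable [T2Space M.carrier] (φ : Iso M M) (h : ∀ m, φ.hom.base m = m)

theorem Coord.integral_mul_pullSelf (x : Coord M p q) {a : MultiIndex p q →₀ M.O x.dom}
    (ha : x.Represents a φ.hom.pullGlobal) (f : M.O x.dom) {g : M.O x.dom}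
    (hg : HasCompactSupp g) :
    x.integral le_rfl (f * φ.pullSelf h x.dom g) = x.integral le_rfl (x.adjoint a f * g) := by
  -- The operator is represented only on global superfunctions, so the test function is first
  -- extended by zero.
  obtain ⟨G, rfl⟩ := hg.exists_extension
  rw [← φ.res_pullGlobal h, ha G, Coord.adjoint, Finsupp.sum, Finsupp.sum, Finset.mul_sum,
    Finset.sum_mul, x.integral_sum le_rfl, x.integral_sum le_rfl]
  · refine Finset.sum_congr rfl fun j _ => ?_
    rw [← mul_assoc, (x.integral_mul_iteratedPd j _ hg).2]
  · exact fun j _ => hg.mul_left _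
  · exact fun j _ => ((x.integral_mul_iteratedPd j f hg).1.mul_left _).mul_left _

omit [T2Space M.carrier] in
theorem jacobian_pullCoord_self (x : Coord M p q) (hx : x.dom ≤ (φ.pullCoord x).dom) :
    jacobian (φ.pullCoord x) x hx le_rfl
      = x.jac le_rfl (φ.pullSelf h x.dom).toAlgHom := by
  ext k l
  refine congrArg (x.pd le_rfl k) ?_
  rw [φ.x_pullCoord, M.res_self]
  rfl

include h in
omit [T2Space M.carrier] in
theorem le_dom_pullCoord (x : Coord M p q) : x.dom ≤ (φ.pullCoord x).dom :=
  φ.le_comap_hom h x.dom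

omit [T2Space M.carrier] in
theorem pullSelf_pushCoeffs (ω : LocalCoeffs M p q) (x : Coord M p q) :
    φ.pullSelf h x.dom (φ.pushCoeffs ω x)
      = M.res (le_dom_pullCoord φ h x) (ω (φ.pullCoord x)) := by
  rw [φ.pullSelf_apply, φ.pull_pushCoeffs]
  rfl

include h in
-- The hypothesis is the unsigned transformation law from `φ^*(x)` to `x`. By `Coord.eq_adjoint_iff`
-- it says exactly that the pushed family is the adjoint applied to `ω x`, whatever coefficients
-- represent the operator.
theorem isRightAction_pushCoeffs {ω : LocalCoeffs M p q}
    (hω : ∀ x : Coord M p q, ω x =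
      berezinian (jacobian (φ.pullCoord x) x (le_dom_pullCoord φ h x) le_rfl) *
        M.res (le_dom_pullCoord φ h x) (ω (φ.pullCoord x))) :
    IsRightAction φ.hom.pullGlobal ω (φ.pushCoeffs ω) := by
  intro x a ha
  refine (x.eq_adjoint_iff (hW := le_rfl) (ψ := φ.pullSelf h x.dom) (P := x.adjoint a)
    (φ.pullSelf_σ h x.dom) (φ.bodyHom_pullSelf h x le_rfl)
    (fun _ => φ.hasCompactSupp_pullSelf h)
    (fun f g hg => x.integral_mul_pullSelf φ h ha f hg) (ω x) _).2 ?_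
  rw [pullSelf_pushCoeffs, ← jacobian_pullCoord_self φ h x (le_dom_pullCoord φ h x)]
  exact hω x

include h in
theorem isRightAction_of_isBerezinForm {ω : LocalCoeffs M p q} (hω : IsBerezinForm ω) :
    IsRightAction φ.hom.pullGlobal ω (φ.pushCoeffs ω) :=
  isRightAction_pushCoeffs φ h fun x => by
    have := hω (φ.pullCoord x) x x.dom (le_dom_pullCoord φ h x) le_rfl
    rwa [M.res_self] at this

include h in
theorem isRightAction_of_isBerezinDensity {ω : LocalCoeffs M p q} (hω : IsBerezinDensity ω) :
    IsRightAction φ.hom.pullGlobal ω (φ.pushCoeffs ω) :=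
  isRightAction_pushCoeffs φ h fun x => by
    -- The sign is 1 because the even block of the Jacobian matrix has underlying matrix 1.
    have := hω (φ.pullCoord x) x x.dom (le_dom_pullCoord φ h x) le_rfl 1 fun w => by
      rw [jacobian_pullCoord_self φ h, x.body_eq, x.bodyHom_ringDet, x.bodyHom_jac
        (φ.bodyHom_pullSelf h x le_rfl), Matrix.det_one]
      exact Real.sign_one
    rwa [M.res_self, one_smul] at this

end RightAction

/-! ## Uniqueness -/

section Unique

variable {M : SuperSpace.{u}} {p q : ℕ}

theorem IsBerezinForm.eq_of_locally_eq {η η' : LocalCoeffs M p q} (hη : IsBerezinForm η)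
    (hη' : IsBerezinForm η') (h : ∀ m, ∃ y : Coord M p q, m ∈ y.dom ∧ η y = η' y) : η = η' := by
  funext x
  refine SuperSpace.eq_of_locally_eq fun m hm => ?_
  obtain ⟨y, hy, heq⟩ := h m
  refine ⟨x.dom ⊓ y.dom, inf_le_left, ⟨hm, hy⟩, ?_⟩
  rw [hη y x _ inf_le_right inf_le_left, hη' y x _ inf_le_right inf_le_left, heq]

theorem res_jacobian (x y : Coord M p q) {V W : Opens M.carrier} (hVW : V ≤ W) (hx : W ≤ x.dom)
    (hy : W ≤ y.dom) :
    (jacobian x y hx hy).map (M.res hVW) = jacobian x y (hVW.trans hx) (hVW.trans hy) := by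
  ext k l
  refine (y.pd_res hy hVW k _).trans ?_
  rw [M.res_res]
  rfl

/-- An open subset of `W`, as an open subset of `M₀`. -/
theorem exists_opens {W : Opens M.carrier} {s : Set W} (hs : IsOpen s) :
    ∃ V : Opens M.carrier, V ≤ W ∧ ∀ w : W, w.1 ∈ V ↔ w ∈ s := by
  refine ⟨⟨Subtype.val '' s, W.isOpen.isOpenMap_subtype_val s hs⟩, ?_, fun w => ?_⟩
  · rintro _ ⟨w, -, rfl⟩
    exact w.2
  · exact Subtype.val_injective.mem_set_image

/-- The law for densities applies only where the sign of the underlying determinant `F` is constant.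
It is used on `F < 0`, on `F > 0` and on the interior of `F = 0`; the remaining points are reached
by continuity, so nonvanishing of `F` is not needed. -/
theorem IsBerezinDensity.eq_of_locally_eq {η η' : LocalCoeffs M p q} (hη : IsBerezinDensity η)
    (hη' : IsBerezinDensity η') (h : ∀ m, ∃ y : Coord M p q, m ∈ y.dom ∧ η y = η' y) :
    η = η' := by
  funext x
  refine SuperSpace.eq_of_locally_eq fun m hm => ?_
  obtain ⟨y, hy, heq⟩ := h m
  let W := x.dom ⊓ y.dom
  have hx : W ≤ x.dom := inf_le_left
  have hWy : W ≤ y.dom := inf_le_right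
  refine ⟨W, hx, ⟨hm, hy⟩, ?_⟩
  set F : W → ℝ := x.body hx (ringDet (jacobian y x hWy hx).toBlocks₁₁) with hF
  have hFc : Continuous F := SmoothFn.continuous hx _
  -- On an open set of constant sign the law expresses both densities by the same formula in the
  -- common coefficient at `y`.
  have key : ∀ (s : Set W) (ε : ℝ), IsOpen s → (∀ w ∈ s, Real.sign (F w) = ε) →
      ∀ w ∈ s, ∀ ν, (x.coeff hx (M.res hx (η x) - M.res hx (η' x)) ν).1 w = 0 := by
    intro s ε hs hsε w hw ν
    obtain ⟨V, hVW, hV⟩ := exists_opens hs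
    have hsign : ∀ v, Real.sign (x.body (hVW.trans hx)
        (ringDet (jacobian y x (hVW.trans hWy) (hVW.trans hx)).toBlocks₁₁) v) = ε := by
      intro v
      have h1 : ringDet (jacobian y x (hVW.trans hWy) (hVW.trans hx)).toBlocks₁₁
          = M.res hVW (ringDet (jacobian y x hWy hx).toBlocks₁₁) := by
        rw [map_ringDet, ← res_jacobian y x hVW hWy hx]
        rfl
      rw [h1, x.body_eq, x.bodyHom_res hx hVW]
      exact hsε ⟨v.1, hVW v.2⟩ ((hV ⟨v.1, hVW v.2⟩).1 v.2)
    have h2 : M.res hVW (M.res hx (η x) - M.res hx (η' x)) = 0 := by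
      rw [map_sub, M.res_res, M.res_res, hη y x V (hVW.trans hWy) (hVW.trans hx) ε hsign,
        hη' y x V (hVW.trans hWy) (hVW.trans hx) ε hsign, heq, sub_self]
    have h3 := x.coeff_res hx hVW (M.res hx (η x) - M.res hx (η' x)) ν
    rw [h2, x.coeff_zero] at h3
    exact (congrFun (congrArg Subtype.val h3) ⟨w.1, (hV w).2 hw⟩).symm
  rw [← sub_eq_zero]
  apply x.coeff_injective hx
  rw [x.coeff_zero]
  funext ν
  refine SmoothFn.ext_of_subset fun w => ?_
  change (x.coeff hx (M.res hx (η x) - M.res hx (η' x)) ν).1 w = 0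
  have hne : ∀ w, F w ≠ 0 → (x.coeff hx (M.res hx (η x) - M.res hx (η' x)) ν).1 w = 0 := by
    intro w hw
    rcases lt_or_gt_of_ne hw with hw | hw
    · exact key {w | F w < 0} (-1) (isOpen_lt hFc continuous_const)
        (fun w hw => Real.sign_of_neg hw) w hw ν
    · exact key {w | 0 < F w} 1 (isOpen_lt continuous_const hFc)
        (fun w hw => Real.sign_of_pos hw) w hw ν
  -- Coefficients are continuous, so their vanishing extends to the closure; the complement of the
  -- closure is open with `F = 0`.
  by_cases hw : w ∈ closure {w | F w ≠ 0}
  · exact closure_minimal (t := {w | (x.coeff hx (M.res hx (η x) - M.res hx (η' x)) ν).1 w = 0})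
      hne (isClosed_eq (SmoothFn.continuous hx _) continuous_const) hw
  · refine key (closure {w | F w ≠ 0})ᶜ 0 isClosed_closure.isOpen_compl (fun v hv => ?_) w hw ν
    have : F v = 0 := by
      by_contra hne
      exact hv (subset_closure hne)
    rw [this, Real.sign_zero]

end Unique

end SuperSpace

theorem mainTheorem5 {p q : ℕ} (M : Supermanifold.{u} p q)
    (φ : SuperSpace.Iso M.toSuperSpace M.toSuperSpace)
    (hφ : SuperSpace.IsDiffOp M.toSuperSpace p q φ.hom.pullGlobal) :
    (∀ ω : SuperSpace.LocalCoeffs M.toSuperSpace p q, SuperSpace.IsBerezinDensity ω →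
      ∃ η : SuperSpace.LocalCoeffs M.toSuperSpace p q,
        (SuperSpace.IsBerezinDensity η ∧ SuperSpace.IsRightAction φ.hom.pullGlobal ω η) ∧
        (∀ η' : SuperSpace.LocalCoeffs M.toSuperSpace p q, SuperSpace.IsBerezinDensity η' →
          SuperSpace.IsRightAction φ.hom.pullGlobal ω η' → η' = η) ∧
        SuperSpace.IsPullback φ η ω) ∧
    (∀ ω : SuperSpace.LocalCoeffs M.toSuperSpace p q, SuperSpace.IsBerezinForm ω →
      ∃ η : SuperSpace.LocalCoeffs M.toSuperSpace p q,
        (SuperSpace.IsBerezinForm η ∧ SuperSpace.IsRightAction φ.hom.pullGlobal ω η) ∧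
        (∀ η' : SuperSpace.LocalCoeffs M.toSuperSpace p q, SuperSpace.IsBerezinForm η' →
          SuperSpace.IsRightAction φ.hom.pullGlobal ω η' → η' = η) ∧
        SuperSpace.IsPullback φ η ω) := by
  have := M.t2
  have h := SuperSpace.base_eq_of_isDiffOp M.exists_coord φ.hom hφ
  -- Near each point some coordinate system represents the operator, and there the right action is
  -- an explicit formula in `ω`.
  have hloc : ∀ {ω η η' : SuperSpace.LocalCoeffs M.toSuperSpace p q},
      SuperSpace.IsRightAction φ.hom.pullGlobal ω η →
      SuperSpace.IsRightAction φ.hom.pullGlobal ω η' →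
      ∀ m, ∃ y : SuperSpace.Coord M.toSuperSpace p q, m ∈ y.dom ∧ η' y = η y := by
    intro ω η η' hη hη' m
    obtain ⟨y, hy, a, ha⟩ := hφ m
    exact ⟨y, hy, (hη' y a ha).trans (hη y a ha).symm⟩
  refine ⟨fun ω hω => ?_, fun ω hω => ?_⟩
  · have hd := φ.isBerezinDensity_pushCoeffs hω
    have hr := SuperSpace.isRightAction_of_isBerezinDensity φ h hω
    exact ⟨φ.pushCoeffs ω, ⟨hd, hr⟩, fun η' hd' hr' => hd'.eq_of_locally_eq hd (hloc hr hr'),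
      φ.isPullback_pushCoeffs ω⟩
  · have hd := φ.isBerezinForm_pushCoeffs hω
    have hr := SuperSpace.isRightAction_of_isBerezinForm φ h hω
    exact ⟨φ.pushCoeffs ω, ⟨hd, hr⟩, fun η' hd' hr' => hd'.eq_of_locally_eq hd (hloc hr hr'),
      φ.isPullback_pushCoeffs ω⟩

end
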